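/- **Setting.** Let $(X_i,Y_i,W_i)_{i\ge 1}$ be i.i.d. with values in $\mathbb R^d\times\mathbb R\times\mathbb R^{d_w}$, $X_i\in\mathcal X$, $W_i\in\mathcal W$ almost surely, $Y_i=h_0(X_i)+u_i$ and $E[u_i\mid W_i]=0$. For all $J,K$ let $\psi^J=(\psi_{J1},\dots,\psi_{JJ})'$ and $b^K=(b_{K1},\dots,b_{KK})'$ be vectors of measurable functions, bounded on $\mathcal X$ and $\mathcal W$ respectively, such that $G_\psi=E[\psi^J(X)\psi^J(X)']$ and $G_b=E[b^K(W)b^K(W)']$ are positive definite. Let $\Psi_J=\mathrm{span}\{\psi_{J1},\dots,\psi_{JJ}\}$, $B_K=\mathrm{span}\{b_{K1},\dots,b_{KK}\}$, $S=E[b^K(W)\psi^J(X)']$, and let $J=J_n\to\infty$ and $K=K_n$ be deterministic with $J\le K=O(J)$ and $S$ of full column rank $J$. With $\Psi=(\psi^J(X_1),\dots,\psi^J(X_n))'$, $B=(b^K(W_1),\dots,b^K(W_n))'$, $Y=(Y_1,\dots,Y_n)'$ and $A^-$ any generalized inverse of $A$ (i.e. $AA^-A=A$), the sieve NPIV estimator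 is $$\widehat h(x)=\psi^J(x)'\,[\Psi'B(B'B)^-B'\Psi]^-\,\Psi'B(B'B)^-B'Y .$$ **Notation.** $\|f\|_\infty=\sup_{x\in\mathcal X}|f(x)|$; $(Th)(w)=E[h(X)\mid W=w]$; $\Pi_J$ and $\Pi_K$ are the $L^2(X)$- and $L^2(W)$-orthogonal projections onto $\Psi_J$ and $B_K$; $Q_Jh=\psi^J(\cdot)'[S'G_b^{-1}S]^{-1}S'G_b^{-1}E[b^K(W)h(X)]$; $h_{0,J}\in\Psi_J$ is any minimizer of $\|h_0-h\|_\infty$ over $h\in\Psi_J$; $\|\Pi_J\|_\infty$ is the norm of $\Pi_J$ on bounded measurable functions with the sup-norm (the Lebesgue constant); $$\tau_J=\sup_{0\ne h\in\Psi_J}\frac{\|h\|_{L^2(X)}}{\|Th\|_{L^2(W)}},\quad e_J=\lambda_{\min}(G_\psi),\quad \xi_{\psi,J}=\sup_{x\in\mathcal X}\|\psi^J(x)\|_{\ell^1},$$ $$\zeta=\max\Big\{\sup_{w\in\mathcal W}\|G_b^{-1/2}b^K(w)\|_{\ell^2},\ \sup_{x\in\mathcal X}\|G_\psi^{-1/2}\psi^J(x)\|_{\ell^2}\Big\}.$$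 All limits and orders are as $n\to\infty$ along $J=J_n$, $K=K_n$. **Assumptions.** 1. $\mathcal X$ is a compact rectangle with nonempty interior on which $X_i$ has a density bounded away from $0$ and $\infty$; $T:L^2(X)\to L^2(W)$ is injective; $h_0\in\mathcal H$ for a class $\mathcal H$ of bounded measurable functions on $\mathcal X$, $\Psi_J\subset\Psi_{J'}$ for $J'>J$, and $\bigcup_J\Psi_J$ is dense in $\mathcal H$ for the $L^2(X)$ norm. 2. $E[u_i^2\mid W_i]\le\overline\sigma^2<\infty$ almost surely for a constant $\overline\sigma^2$, and $E|u_i|^{2+\delta}<\infty$ for some $\delta>0$. 3. $\tau_J\zeta^2/\sqrt n=O(1)$ and $\zeta^{(2+\delta)/\delta}\sqrt{(\log n)/n}=o(1)$. 4. $\sup_{h\in\Psi_J,\,\|h\|_{L^2(X)}=1}\|(\Pi_KT-T)h\|_{L^2(W)}=o(\tau_J^{-1})$; $\ \tau_J\|T(h_0-\Pi_Jh_0)\|_{L^2(W)}\le \mathrm{const}\times\|h_0-\Pi_Jh_0\|_{L^2(X)}$; $\ \|Q_Jh_0-\Pi_Jh_0\|_\infty\le O(1)\times\|h_0-\Pi_Jh_0\|_\infty$.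 **Theorem.** (1) Under these assumptions, $$\|\widehat h-h_0\|_\infty=O_p\Big(\|h_0-\Pi_Jh_0\|_\infty+\tau_J\,\xi_{\psi,J}\sqrt{(\log n)/(n e_J)}\Big).$$ (2) If in addition $\|\Pi_J\|_\infty=O(1)$ and $\xi_{\psi,J}/\sqrt{e_J}=O(\sqrt J)$, then $$\|\widehat h-h_0\|_\infty=O_p\Big(\|h_0-h_{0,J}\|_\infty+\tau_J\sqrt{(J\log n)/n}\Big).$$ -/

import Mathlib

open MeasureTheory ProbabilityTheory Filter Asymptotics
open scoped Matrix

/-- Sup-norm of `f` over the set `s`, `sup_{x ∈ s} |f x|` (used for functions bounded on `s`). -/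
noncomputable def supNorm {α : Type*} (s : Set α) (f : α → ℝ) : ℝ := ⨆ x : s, |f x|

/-- `f` is bounded on `s`. -/
def BoundedOn {α : Type*} (s : Set α) (f : α → ℝ) : Prop := ∃ C : ℝ, ∀ x ∈ s, |f x| ≤ C

/-- `L²(ν)` norm of a square-integrable function. -/
noncomputable def l2Norm {α : Type*} [MeasurableSpace α] (ν : Measure α) (f : α → ℝ) : ℝ :=
  Real.sqrt (∫ x, f x ^ 2 ∂ν)

/-- Smallest eigenvalue of a real symmetric matrix. -/
noncomputable def lambdaMin {m : ℕ} (A : Matrix (Fin m) (Fin m) ℝ) : ℝ := sInf (spectrum ℝ A)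

/-- Gram matrix `E[φ φ']` of the functions `φ₁, …, φ_m` in `L²(ν)`. -/
noncomputable def gramMat {α : Type*} [MeasurableSpace α] (ν : Measure α) {m : ℕ}
    (φ : Fin m → α → ℝ) : Matrix (Fin m) (Fin m) ℝ :=
  Matrix.of fun j k => ∫ x, φ j x * φ k x ∂ν

/-- The function `x ↦ φ(x)' c`. -/
def linComb {α : Type*} {m : ℕ} (φ : Fin m → α → ℝ) (c : Fin m → ℝ) : α → ℝ :=
  fun x => ∑ j, φ j x * c j

/-- The linear span of finitely many functions. -/
def sieveSpace {α : Type*} {m : ℕ} (φ : Fin m → α → ℝ) : Submodule ℝ (α → ℝ) :=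
  Submodule.span ℝ (Set.range φ)

/-- `L²(ν)`-orthogonal projection of `h` onto the span of `φ₁, …, φ_m` (with nonsingular Gram
matrix), as the pointwise defined function `φ(x)' G⁻¹ E[φ h]`. -/
noncomputable def l2Proj {α : Type*} [MeasurableSpace α] (ν : Measure α) {m : ℕ}
    (φ : Fin m → α → ℝ) (h : α → ℝ) : α → ℝ :=
  linComb φ ((gramMat ν φ)⁻¹ *ᵥ fun j => ∫ x, φ j x * h x ∂ν)

/-- `sup_{x ∈ s} ‖G^{-1/2} φ(x)‖₂`, where `‖G^{-1/2} v‖₂² = v' G⁻¹ v`. -/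
noncomputable def zetaSup {α : Type*} [MeasurableSpace α] (ν : Measure α) (s : Set α) {m : ℕ}
    (φ : Fin m → α → ℝ) : ℝ :=
  ⨆ x : s, Real.sqrt ((fun j => φ j x) ⬝ᵥ ((gramMat ν φ)⁻¹ *ᵥ fun j => φ j x))

/-- `sup_{x ∈ s} ‖φ(x)‖₁`. -/
noncomputable def xiSup {α : Type*} (s : Set α) {m : ℕ} (φ : Fin m → α → ℝ) : ℝ :=
  ⨆ x : s, ∑ j, |φ j x|

/-- Lebesgue constant: the norm of the `L²(ν)` projection onto the span of the `φ`'s, as an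
operator on the bounded measurable functions on `s` with the sup-norm. -/
noncomputable def lebesgueConst {α : Type*} [MeasurableSpace α] (ν : Measure α) (s : Set α)
    {m : ℕ} (φ : Fin m → α → ℝ) : ℝ :=
  ⨆ h : {h : α → ℝ // Measurable h ∧ BoundedOn s h ∧ supNorm s h ≤ 1}, supNorm s (l2Proj ν φ h)

/-- `φ` is a triangular array of bases: for every dimension `m`, bounded measurable functions
`φ_{m1}, …, φ_{mm}` whose Gram matrix is positive definite. -/
structure IsBasisArray {α : Type*} [MeasurableSpace α] (ν : Measure α) (s : Set α)
    (φ : ∀ m : ℕ, Fin m → α → ℝ) : Prop where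
  measurable : ∀ m j, Measurable (φ m j)
  bounded : ∀ m j, BoundedOn s (φ m j)
  posDef : ∀ m, (gramMat ν (φ m)).PosDef

/-- `Z_n = O_p(r_n)`. If a variable is not measurable, `μ` is the outer measure. -/
def IsBigOInProb {Ω : Type*} [MeasurableSpace Ω] (μ : Measure Ω) (Z : ℕ → Ω → ℝ)
    (r : ℕ → ℝ) : Prop :=
  ∀ ε : ℝ, 0 < ε → ∃ C : ℝ, 0 < C ∧
    ∀ᶠ n in atTop, μ {ω | C * r n < |Z n ω|} ≤ ENNReal.ofReal ε

/-- A choice of generalized inverse for every real square matrix: `A A⁻ A = A`. -/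
def IsGenInverse (ginv : ∀ m : ℕ, Matrix (Fin m) (Fin m) ℝ → Matrix (Fin m) (Fin m) ℝ) : Prop :=
  ∀ m A, A * ginv m A * A = A

/-- The objects of a nonparametric instrumental variables problem; no condition is imposed here
except that `μ` is a probability measure. -/
structure NPIV (Ω : Type*) [MeasurableSpace Ω] (d dw : ℕ) where
  /-- the probability measure -/
  μ : Measure Ω
  prob : IsProbabilityMeasure μ
  /-- endogenous regressors -/
  X : ℕ → Ω → EuclideanSpace ℝ (Fin d)
  /-- instruments -/
  W : ℕ → Ω → EuclideanSpace ℝ (Fin dw)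
  /-- responses -/
  Y : ℕ → Ω → ℝ
  /-- structural function -/
  h₀ : EuclideanSpace ℝ (Fin d) → ℝ
  /-- the set in which the regressors take their values -/
  XX : Set (EuclideanSpace ℝ (Fin d))
  /-- the set in which the instruments take their values -/
  WW : Set (EuclideanSpace ℝ (Fin dw))
  /-- sieve basis functions `ψ_{J1}, …, ψ_{JJ}` -/
  ψ : ∀ J : ℕ, Fin J → EuclideanSpace ℝ (Fin d) → ℝ
  /-- instrument basis functions `b_{K1}, …, b_{KK}` -/
  b : ∀ K : ℕ, Fin K → EuclideanSpace ℝ (Fin dw) → ℝ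

attribute [instance] NPIV.prob

namespace NPIV

variable {Ω : Type*} [MeasurableSpace Ω] {d dw : ℕ} (M : NPIV Ω d dw)

/-- law of the regressor -/
noncomputable def lawX : Measure (EuclideanSpace ℝ (Fin d)) := M.μ.map (M.X 0)

/-- law of the instrument -/
noncomputable def lawW : Measure (EuclideanSpace ℝ (Fin dw)) := M.μ.map (M.W 0)

/-- residual `u_i = Y_i - h₀(X_i)` -/
def u (i : ℕ) (ω : Ω) : ℝ := M.Y i ω - M.h₀ (M.X i ω)

/-- The conditional expectation operator `(T h)(w) = E[h(X) | W = w]`. -/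
noncomputable def T (h : EuclideanSpace ℝ (Fin d) → ℝ) : EuclideanSpace ℝ (Fin dw) → ℝ :=
  fun w => ∫ x, h x ∂(condDistrib (M.X 0) (M.W 0) M.μ w)

/-- `‖h‖_{L²(X)}` -/
noncomputable def normX (h : EuclideanSpace ℝ (Fin d) → ℝ) : ℝ := l2Norm M.lawX h

/-- `‖g‖_{L²(W)}` -/
noncomputable def normW (g : EuclideanSpace ℝ (Fin dw) → ℝ) : ℝ := l2Norm M.lawW g

/-- the sieve space `Ψ_J` -/
def Psi (J : ℕ) : Submodule ℝ (EuclideanSpace ℝ (Fin d) → ℝ) := sieveSpace (M.ψ J)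

/-- `Π_J h`, the `L²(X)` projection onto `Ψ_J` -/
noncomputable def projX (J : ℕ) (h : EuclideanSpace ℝ (Fin d) → ℝ) :
    EuclideanSpace ℝ (Fin d) → ℝ := l2Proj M.lawX (M.ψ J) h

/-- `Π_K g`, the `L²(W)` projection onto `B_K` -/
noncomputable def projW (K : ℕ) (g : EuclideanSpace ℝ (Fin dw) → ℝ) :
    EuclideanSpace ℝ (Fin dw) → ℝ := l2Proj M.lawW (M.b K) g

/-- `S_{JK} = E[b^K(W) ψ^J(X)']` -/
noncomputable def S (J K : ℕ) : Matrix (Fin K) (Fin J) ℝ :=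
  Matrix.of fun k j => ∫ ω, M.b K k (M.W 0 ω) * M.ψ J j (M.X 0 ω) ∂M.μ

/-- The sieve 2SLS projection `Q_J h = ψ^J(·)' [S' G_b⁻¹ S]⁻¹ S' G_b⁻¹ E[b^K(W) h(X)]`. -/
noncomputable def Q (J K : ℕ) (h : EuclideanSpace ℝ (Fin d) → ℝ) :
    EuclideanSpace ℝ (Fin d) → ℝ :=
  linComb (M.ψ J)
    (((M.S J K)ᵀ * (gramMat M.lawW (M.b K))⁻¹ * M.S J K)⁻¹ *ᵥ
      (((M.S J K)ᵀ * (gramMat M.lawW (M.b K))⁻¹) *ᵥ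
        fun k => ∫ ω, M.b K k (M.W 0 ω) * h (M.X 0 ω) ∂M.μ))

/-- sieve measure of ill-posedness `τ_J = sup_{h ∈ Ψ_J, h ≠ 0} ‖h‖_{L²(X)} / ‖T h‖_{L²(W)}` -/
noncomputable def tau (J : ℕ) : ℝ :=
  ⨆ h : {h : EuclideanSpace ℝ (Fin d) → ℝ // h ∈ M.Psi J ∧ M.normX h ≠ 0},
    M.normX h / M.normW (M.T h)

/-- `e_J = λ_min(G_{ψ,J})` -/
noncomputable def e (J : ℕ) : ℝ := lambdaMin (gramMat M.lawX (M.ψ J))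

/-- `ξ_{ψ,J}` -/
noncomputable def xi (J : ℕ) : ℝ := xiSup M.XX (M.ψ J)

/-- `ζ = ζ_{b,K} ∨ ζ_{ψ,J}` -/
noncomputable def zeta (J K : ℕ) : ℝ :=
  max (zetaSup M.lawW M.WW (M.b K)) (zetaSup M.lawX M.XX (M.ψ J))

/-- the `n × J` matrix `Ψ` with rows `ψ^J(X_i)'` -/
def designX (n J : ℕ) (ω : Ω) : Matrix (Fin n) (Fin J) ℝ :=
  Matrix.of fun i j => M.ψ J j (M.X i ω)

/-- the `n × K` matrix `B` with rows `b^K(W_i)'` -/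
def designW (n K : ℕ) (ω : Ω) : Matrix (Fin n) (Fin K) ℝ :=
  Matrix.of fun i k => M.b K k (M.W i ω)

/-- The sieve NPIV estimator computed from the first `n` observations:
`ĥ = ψ^J(·)' [Ψ'B(B'B)⁻B'Ψ]⁻ Ψ'B(B'B)⁻B'Y`. -/
def hHat (ginv : ∀ m : ℕ, Matrix (Fin m) (Fin m) ℝ → Matrix (Fin m) (Fin m) ℝ)
    (n J K : ℕ) (ω : Ω) : EuclideanSpace ℝ (Fin d) → ℝ :=
  let P := M.designX n J ω
  let B := M.designW n K ω
  let A := Pᵀ * B * ginv K (Bᵀ * B) * Bᵀ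
  linComb (M.ψ J) (ginv J (A * P) *ᵥ (A *ᵥ fun i : Fin n => M.Y i ω))

/-- The data are a random sample from `Y = h₀(X) + u`, `E[u | W] = 0`. -/
structure IsModel : Prop where
  measurable_X : ∀ i, Measurable (M.X i)
  measurable_W : ∀ i, Measurable (M.W i)
  measurable_Y : ∀ i, Measurable (M.Y i)
  measurable_h₀ : Measurable M.h₀
  indep : iIndepFun (fun i ω => (M.X i ω, M.Y i ω, M.W i ω)) M.μ
  ident : ∀ i, IdentDistrib (fun ω => (M.X i ω, M.Y i ω, M.W i ω))
    (fun ω => (M.X 0 ω, M.Y 0 ω, M.W 0 ω)) M.μ M.μ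
  mem_WW : ∀ i, ∀ᵐ ω ∂M.μ, M.W i ω ∈ M.WW
  integrable_u : ∀ i, Integrable (M.u i) M.μ
  exog : ∀ i, M.μ[M.u i | MeasurableSpace.comap (M.W i) inferInstance] =ᵐ[M.μ] 0

/-- The regressor has compact rectangular support with nonempty interior and a density bounded
away from zero and infinity there. -/
def RegressorDensity : Prop :=
  (∃ lo hi : Fin d → ℝ, (∀ k, lo k < hi k) ∧ M.XX = {x | ∀ k, x k ∈ Set.Icc (lo k) (hi k)}) ∧
  ∃ (f : EuclideanSpace ℝ (Fin d) → ℝ) (c C : ℝ), 0 < c ∧ Measurable f ∧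
    (∀ x ∈ M.XX, c ≤ f x ∧ f x ≤ C) ∧
    M.lawX = (volume.restrict M.XX).withDensity fun x => ENNReal.ofReal (f x)

/-- `T : L²(X) → L²(W)` is injective. -/
def TInjective : Prop :=
  ∀ h : EuclideanSpace ℝ (Fin d) → ℝ, Measurable h → MemLp h 2 M.lawX →
    M.T h =ᵐ[M.lawW] 0 → h =ᵐ[M.lawX] 0

/-- `h₀ ∈ H ⊆ L^∞(X)`, the sieve spaces are nested (as subspaces of `L²(X)`), and their union is
dense in `H` for the `L²(X)` norm. -/
structure SieveDense (H : Set (EuclideanSpace ℝ (Fin d) → ℝ)) : Prop where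
  mem : M.h₀ ∈ H
  bounded : ∀ h ∈ H, Measurable h ∧ BoundedOn M.XX h
  nested : ∀ J J' : ℕ, J < J' → ∀ g ∈ M.Psi J, ∃ g' ∈ M.Psi J', g =ᵐ[M.lawX] g'
  dense : ∀ h ∈ H, ∀ ε : ℝ, 0 < ε → ∃ J : ℕ, ∃ g ∈ M.Psi J, M.normX (h - g) < ε

/-- `E[u² | W]` is bounded and `E|u|^{2+δ} < ∞`. -/
structure ResidualMoments (δ : ℝ) : Prop where
  delta_pos : 0 < δ
  condVar : ∃ σ2 : ℝ, ∀ᵐ ω ∂M.μ,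
    (M.μ[fun ω' => M.u 0 ω' ^ 2 | MeasurableSpace.comap (M.W 0) inferInstance]) ω ≤ σ2
  moment : Integrable (fun ω => |M.u 0 ω| ^ (2 + δ)) M.μ

/-- Sieve dimensions: `J_n → ∞` and `J_n ≤ K_n = O(J_n)`; the bases have positive definite Gram
matrices and `S` has full column rank. -/
structure SieveSetup (J K : ℕ → ℕ) : Prop where
  basisX : IsBasisArray M.lawX M.XX M.ψ
  basisW : IsBasisArray M.lawW M.WW M.b
  tendsto : Tendsto J atTop atTop
  le : ∀ n, J n ≤ K n
  bigO : (fun n => (K n : ℝ)) =O[atTop] fun n => (J n : ℝ)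
  rank : ∀ n, (M.S (J n) (K n)).rank = J n

/-- `τ_J ζ² / √n = O(1)` and `ζ^{(2+δ)/δ} √(log n / n) = o(1)`. -/
structure SieveGrowth (δ : ℝ) (J K : ℕ → ℕ) : Prop where
  illPosed : (fun n : ℕ => M.tau (J n) * M.zeta (J n) (K n) ^ 2 / Real.sqrt n)
    =O[atTop] fun _ => (1 : ℝ)
  moment : (fun n : ℕ => M.zeta (J n) (K n) ^ ((2 + δ) / δ) * Real.sqrt (Real.log n / n))
    =o[atTop] fun _ => (1 : ℝ)

/-- Approximation and stability conditions:
`sup_{h ∈ Ψ_J, ‖h‖ = 1} ‖(Π_K T - T) h‖_{L²(W)} = o(τ_J⁻¹)`,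
`τ_J ‖T(h₀ - Π_J h₀)‖_{L²(W)} ≤ const ‖h₀ - Π_J h₀‖_{L²(X)}` and
`‖Q_J h₀ - Π_J h₀‖_∞ ≤ O(1) ‖h₀ - Π_J h₀‖_∞`. -/
structure SieveApprox (J K : ℕ → ℕ) : Prop where
  instrument : (fun n : ℕ =>
      ⨆ h : {h : EuclideanSpace ℝ (Fin d) → ℝ // h ∈ M.Psi (J n) ∧ M.normX h = 1},
        M.normW (M.projW (K n) (M.T h) - M.T h))
    =o[atTop] fun n => (M.tau (J n))⁻¹
  stableL2 : (fun n : ℕ => M.tau (J n) * M.normW (M.T (M.h₀ - M.projX (J n) M.h₀)))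
    =O[atTop] fun n => M.normX (M.h₀ - M.projX (J n) M.h₀)
  stableSup : (fun n : ℕ => supNorm M.XX (M.Q (J n) (K n) M.h₀ - M.projX (J n) M.h₀))
    =O[atTop] fun n => supNorm M.XX (M.h₀ - M.projX (J n) M.h₀)

end NPIV

/-! Choose square matrices `R` with `R G R' = 1` (`exists_whitening`), so that both bases become
orthonormal systems whose value vectors have Euclidean length at most ζ. In these coordinates the
estimator's coefficients solve a saddle point system Ŝc − Ĝq = n⁻¹ ∑ b̃(Wᵢ)Yᵢ, Ŝ'q = 0
(`tsls_normal_equations`). Its population version has S = E[b̃ψ̃'] and the identity in place of Ŝ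
and Ĝ. By full rank and the instrument condition, S is bounded below by 1/(2τ) (`tau_bounds`,
`eucl_crossMean_ge`).

Put r = h₀ − Π_J h₀, ρ = E[b̃ r], ν = n⁻¹ ∑ b̃(Wᵢ)uᵢ and N = (S'S)⁻¹S'. When Ŝ − S and Ĝ − 1 are
small relative to 1/τ, `supNorm_hHat_sub_le` starts from ĥ − h₀ = −r + (Q_J h₀ − Π_J h₀) + ψ̃'Nν +
ψ̃'e.

Bias. The first two terms are of order ‖r‖_∞, the second one by assumption.

Leading noise. In the original basis, ψ̃'Nν is at most ξ times the largest of J coordinates. Each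
coordinate is a mean of qⱼ(W)u with conditional variance of order τ²/e. Truncating u, then applying
Bernstein's inequality with a union bound, gives τ√(log n/(ne)). The moment growth condition is
exactly what makes the truncation admissible (`isBigOInProb_norm_noise`).

Remainder. Perturbing the saddle point system (`tsls_error_le`) bounds e by Ŝ − S, its transpose and
Ĝ − 1, applied to images of ρ and ν. These are fixed vectors or images of one sample mean, so second
moments suffice. Each term equals the bounded quantity τζ²/√n times at most a constant multiple of
‖r‖ + τ√(K/n) (`sqDominated_remainder`). The last summand is absorbed through √J ≤ ξ/√e.

Operator norms. It remains to see that τ²‖D‖² → 0 in probability for D = Ŝ − S and D = Ĝ − 1.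
Bounding ‖D‖ by its Frobenius norm only gives O(1). Instead n²‖Dw‖² is split into pairs i = j and
pairs i ≠ j. The diagonal is controlled by the sample Gram matrix. The off-diagonal part is a
degenerate statistic of order two, for which the Frobenius norm is good enough
(`IsSample.integral_gramOffDiag_le`). This yields ‖D‖² of order ζ²√k/n with k columns, and τ²ζ²√k/n
= (τζ²/√n)²·√k/ζ² = O(k^(-1/2)) because k ≤ ζ².

The second claim follows from the first by Lebesgue's lemma (`supNorm_sub_projX_le`). -/

/-! ### Second moments of sums and of degenerate bilinear statistics. -/

/-- `V₀, V₁, …` are independent with common law `ν`. -/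
structure IsSample {Ω 𝒱 : Type*} [MeasurableSpace Ω] [MeasurableSpace 𝒱] (μ : Measure Ω)
    (ν : Measure 𝒱) (V : ℕ → Ω → 𝒱) : Prop where
  law : ∀ i, MeasurePreserving (V i) μ ν
  indep : iIndepFun V μ

/-- The `σ`-algebra generated by the first `n` observations. -/
@[reducible] def pastSigma {Ω 𝒱 : Type*} [MeasurableSpace 𝒱] (V : ℕ → Ω → 𝒱) (n : ℕ) : MeasurableSpace Ω :=
  ⨆ i ∈ Set.Iio n, MeasurableSpace.comap (V i) inferInstance

/-- Sum of `f` over the first `n` observations. -/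
def sampleSum {Ω 𝒱 : Type*} (V : ℕ → Ω → 𝒱) (n : ℕ) (f : 𝒱 → ℝ) (ω : Ω) : ℝ :=
  ∑ i ∈ Finset.range n, f (V i ω)

namespace IsSample

variable {Ω 𝒱 : Type*} [MeasurableSpace Ω] [MeasurableSpace 𝒱] {μ : Measure Ω}
  {ν : Measure 𝒱} {V : ℕ → Ω → 𝒱}

theorem pastSigma_le (h : IsSample μ ν V) (n : ℕ) : pastSigma V n ≤ ‹MeasurableSpace Ω› :=
  iSup₂_le fun i _ => (h.law i).measurable.comap_le

omit [MeasurableSpace Ω] in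
theorem measurable_pastSigma {i n : ℕ} (hi : i < n) {f : 𝒱 → ℝ} (hf : Measurable f) :
    Measurable[pastSigma V n] fun ω => f (V i ω) := by
  have h1 : Measurable[MeasurableSpace.comap (V i) inferInstance] (V i) :=
    comap_measurable (V i)
  have h2 : MeasurableSpace.comap (V i) inferInstance ≤ pastSigma V n :=
    le_iSup₂ (f := fun i (_ : i ∈ Set.Iio n) =>
      MeasurableSpace.comap (V i) (inferInstance : MeasurableSpace 𝒱)) i hi
  exact (hf.comp h1).mono h2 le_rfl

omit [MeasurableSpace Ω] in
theorem measurable_sampleSum {n : ℕ} {f : 𝒱 → ℝ} (hf : Measurable f) :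
    Measurable[pastSigma V n] (sampleSum V n f) := by
  unfold sampleSum
  exact Finset.measurable_fun_sum _ fun i hi => measurable_pastSigma (Finset.mem_range.1 hi) hf

theorem indepFun_past (h : IsSample μ ν V) {n : ℕ} {X : Ω → ℝ} (hX : Measurable[pastSigma V n] X)
    {g : 𝒱 → ℝ} (hg : Measurable g) : IndepFun X (fun ω => g (V n ω)) μ := by
  have h1 := indep_iSup_of_disjoint (fun i => (h.law i).measurable.comap_le) h.indep
    (S := Set.Iio n) (T := {n}) (by simp)
  rw [IndepFun_iff_Indep]
  refine indep_of_indep_of_le_right (indep_of_indep_of_le_left h1 ?_) ?_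
  · exact hX.comap_le
  · simp only [Set.mem_singleton_iff, iSup_iSup_eq_left]
    exact (hg.comp (comap_measurable (V n))).comap_le

theorem memLp_comp (h : IsSample μ ν V) {f : 𝒱 → ℝ} {p : ENNReal} (hf : MemLp f p ν) (i : ℕ) :
    MemLp (fun ω => f (V i ω)) p μ :=
  hf.comp_measurePreserving (h.law i)

theorem integral_comp (h : IsSample μ ν V) {f : 𝒱 → ℝ} (hf : Measurable f) (i : ℕ) :
    ∫ ω, f (V i ω) ∂μ = ∫ v, f v ∂ν := by
  rw [← (h.law i).map_eq, integral_map (h.law i).measurable.aemeasurable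
    hf.aestronglyMeasurable]

theorem memLp_sampleSum (h : IsSample μ ν V) {f : 𝒱 → ℝ} {p : ENNReal} (hf : MemLp f p ν)
    (n : ℕ) : MemLp (sampleSum V n f) p μ :=
  memLp_finsetSum _ fun i _ => h.memLp_comp hf i

theorem memLp_mul_indep {X Y : Ω → ℝ} (hXY : IndepFun X Y μ) (hX : MemLp X 2 μ)
    (hY : MemLp Y 2 μ) : MemLp (fun ω => X ω * Y ω) 2 μ := by
  refine (memLp_two_iff_integrable_sq (hX.1.mul hY.1)).2 ?_
  have h2 : IndepFun (fun ω => X ω ^ 2) (fun ω => Y ω ^ 2) μ :=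
    hXY.comp (measurable_id.pow_const 2) (measurable_id.pow_const 2)
  exact (h2.integrable_mul hX.integrable_sq hY.integrable_sq).congr
    (ae_of_all _ fun ω => by simp [mul_pow])

theorem integral_mul_past (h : IsSample μ ν V) {n : ℕ} {X : Ω → ℝ}
    (hX : Measurable[pastSigma V n] X) {g : 𝒱 → ℝ} (hg : Measurable g) :
    ∫ ω, X ω * g (V n ω) ∂μ = (∫ ω, X ω ∂μ) * ∫ v, g v ∂ν := by
  rw [(h.indepFun_past hX hg).integral_fun_mul_eq_mul_integral
    (hX.mono (h.pastSigma_le n) le_rfl).aestronglyMeasurable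
    (hg.comp (h.law n).measurable).aestronglyMeasurable, h.integral_comp hg]

theorem integral_sampleSum (h : IsSample μ ν V) {f : 𝒱 → ℝ} (hf : Measurable f)
    (hi : Integrable f ν) (n : ℕ) : ∫ ω, sampleSum V n f ω ∂μ = n * ∫ v, f v ∂ν := by
  unfold sampleSum
  have hi' : ∀ i, Integrable (fun ω => f (V i ω)) μ := fun i =>
    (h.law i).integrable_comp_of_integrable hi
  rw [integral_finsetSum _ fun i _ => hi' i]
  simp [h.integral_comp hf]

/-- Only the pairs i = j survive: a centred function of the newest observation is independent of the
sum over the past. -/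
theorem integral_sampleSum_mul (h : IsSample μ ν V) {f g : 𝒱 → ℝ} (hf : Measurable f)
    (hg : Measurable g) (hf2 : MemLp f 2 ν) (hg2 : MemLp g 2 ν) (hf0 : ∫ v, f v ∂ν = 0)
    (hg0 : ∫ v, g v ∂ν = 0) (n : ℕ) :
    ∫ ω, sampleSum V n f ω * sampleSum V n g ω ∂μ = n * ∫ v, f v * g v ∂ν := by
  induction n with
  | zero => simp [sampleSum]
  | succ n ih =>
    have e : ∀ ω, sampleSum V (n + 1) f ω * sampleSum V (n + 1) g ω =
        sampleSum V n f ω * sampleSum V n g ω + sampleSum V n f ω * g (V n ω)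
          + sampleSum V n g ω * f (V n ω) + f (V n ω) * g (V n ω) := by
      intro ω; simp only [sampleSum, Finset.sum_range_succ]; ring
    have i1 : Integrable (fun ω => sampleSum V n f ω * sampleSum V n g ω) μ :=
      (h.memLp_sampleSum hf2 n).integrable_mul (h.memLp_sampleSum hg2 n)
    have i2 : Integrable (fun ω => sampleSum V n f ω * g (V n ω)) μ :=
      (h.memLp_sampleSum hf2 n).integrable_mul (h.memLp_comp hg2 n)
    have i3 : Integrable (fun ω => sampleSum V n g ω * f (V n ω)) μ :=
      (h.memLp_sampleSum hg2 n).integrable_mul (h.memLp_comp hf2 n)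
    have i4 : Integrable (fun ω => f (V n ω) * g (V n ω)) μ :=
      (h.memLp_comp hf2 n).integrable_mul (h.memLp_comp hg2 n)
    simp_rw [e]
    rw [integral_add (by fun_prop) i4, integral_add (by fun_prop) i3,
      integral_add i1 i2, ih,
      h.integral_mul_past (measurable_sampleSum hf) hg,
      h.integral_mul_past (measurable_sampleSum hg) hf, hf0, hg0,
      h.integral_comp (f := fun v => f v * g v) (hf.mul hg)]
    push_cast; ring

/-- Second moment of `∑ₐ (∑_{i<n} pₐ(Vᵢ)) qₐ(Vₙ)`. -/
theorem integral_sum_past_sq (h : IsSample μ ν V) {ι : Type*} [Fintype ι] {p q : ι → 𝒱 → ℝ}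
    (hp : ∀ a, Measurable (p a)) (hq : ∀ a, Measurable (q a)) (hp2 : ∀ a, MemLp (p a) 2 ν)
    (hq2 : ∀ a, MemLp (q a) 2 ν) (hp0 : ∀ a, ∫ v, p a v ∂ν = 0) (n : ℕ) :
    MemLp (fun ω => ∑ a, sampleSum V n (p a) ω * q a (V n ω)) 2 μ ∧
    ∫ ω, (∑ a, sampleSum V n (p a) ω * q a (V n ω)) ^ 2 ∂μ =
      n * ∑ a, ∑ b, (∫ v, p a v * p b v ∂ν) * ∫ v, q a v * q b v ∂ν := by
  have hm : ∀ a, MemLp (fun ω => sampleSum V n (p a) ω * q a (V n ω)) 2 μ := fun a =>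
    memLp_mul_indep (h.indepFun_past (measurable_sampleSum (hp a)) (hq a))
      (h.memLp_sampleSum (hp2 a) n) (h.memLp_comp (hq2 a) n)
  refine ⟨memLp_finsetSum _ fun a _ => hm a, ?_⟩
  have e : ∀ ω, (∑ a, sampleSum V n (p a) ω * q a (V n ω)) ^ 2 =
      ∑ a, ∑ b, (sampleSum V n (p a) ω * q a (V n ω)) * (sampleSum V n (p b) ω * q b (V n ω)) := by
    intro ω; rw [sq, Finset.sum_mul_sum]
  have hmm : ∀ a b, Integrable (fun ω => (sampleSum V n (p a) ω * q a (V n ω)) *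
      (sampleSum V n (p b) ω * q b (V n ω))) μ := fun a b => (hm a).integrable_mul (hm b)
  simp_rw [e]
  rw [integral_finsetSum _ fun a _ => integrable_finsetSum _ fun b _ => hmm a b, Finset.mul_sum]
  refine Finset.sum_congr rfl fun a _ => ?_
  rw [integral_finsetSum _ fun b _ => hmm a b, Finset.mul_sum]
  refine Finset.sum_congr rfl fun b _ => ?_
  -- Regroup into a past factor times a function of the new observation; independence then factors
  -- the integral.
  have e2 : ∀ ω, (sampleSum V n (p a) ω * q a (V n ω)) * (sampleSum V n (p b) ω * q b (V n ω)) =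
      (sampleSum V n (p a) ω * sampleSum V n (p b) ω) * (fun v => q a v * q b v) (V n ω) := by
    intro ω; ring
  simp_rw [e2]
  have hpp : Measurable[pastSigma V n]
      fun ω => sampleSum V n (p a) ω * sampleSum V n (p b) ω :=
    (measurable_sampleSum (hp a)).mul (measurable_sampleSum (hp b))
  rw [h.integral_mul_past hpp (g := fun v => q a v * q b v) ((hq a).mul (hq b)),
    h.integral_sampleSum_mul (hp a) (hp b) (hp2 a) (hp2 b) (hp0 a) (hp0 b)]
  ring

/-- The off-diagonal bilinear statistic `∑_{i ≠ j} ∑ₐ pₐ(Vᵢ) qₐ(Vⱼ)`. -/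
def offDiag {ι : Type*} [Fintype ι] (V : ℕ → Ω → 𝒱) (n : ℕ) (p q : ι → 𝒱 → ℝ) (ω : Ω) : ℝ :=
  ∑ a, sampleSum V n (p a) ω * sampleSum V n (q a) ω
    - sampleSum V n (fun v => ∑ a, p a v * q a v) ω

/-- Variance bound for a canonical bilinear statistic of order two. -/
theorem integral_offDiag_sq_le (h : IsSample μ ν V) {ι : Type*} [Fintype ι] {p q : ι → 𝒱 → ℝ}
    (hp : ∀ a, Measurable (p a)) (hq : ∀ a, Measurable (q a)) (hp2 : ∀ a, MemLp (p a) 2 ν)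
    (hq2 : ∀ a, MemLp (q a) 2 ν) (hp0 : ∀ a, ∫ v, p a v ∂ν = 0) (hq0 : ∀ a, ∫ v, q a v ∂ν = 0)
    (n : ℕ) :
    MemLp (offDiag V n p q) 2 μ ∧ ∫ ω, offDiag V n p q ω ^ 2 ∂μ ≤
      2 * n ^ 2 * ∑ a, ∑ b, (∫ v, p a v * p b v ∂ν) * ∫ v, q a v * q b v ∂ν := by
  set Θ := ∑ a, ∑ b, (∫ v, p a v * p b v ∂ν) * ∫ v, q a v * q b v ∂ν with hΘ
  have hΘ' : Θ = ∑ a, ∑ b, (∫ v, q a v * q b v ∂ν) * ∫ v, p a v * p b v ∂ν := by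
    simp only [hΘ, mul_comm]
  induction n with
  | zero =>
    have : offDiag V 0 p q = 0 := by ext ω; simp [offDiag, sampleSum]
    rw [this]; simp
  | succ n ih =>
    obtain ⟨hU, hUb⟩ := ih
    obtain ⟨hA, hAe⟩ := h.integral_sum_past_sq hp hq hp2 hq2 hp0 n
    obtain ⟨hB, hBe⟩ := h.integral_sum_past_sq hq hp hq2 hp2 hq0 n
    rw [← hΘ] at hAe
    rw [← hΘ'] at hBe
    set A := fun ω => ∑ a, sampleSum V n (p a) ω * q a (V n ω) with hAdef
    set B := fun ω => ∑ a, sampleSum V n (q a) ω * p a (V n ω) with hBdef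
    -- A new observation adds exactly the pairs in which it occupies one of the two slots: `A` is
    -- the second slot, `B` the first.
    have e : ∀ ω, offDiag V (n + 1) p q ω = offDiag V n p q ω + (A ω + B ω) := by
      intro ω
      simp only [offDiag, sampleSum, Finset.sum_range_succ, hAdef, hBdef, add_mul, mul_add,
        Finset.sum_add_distrib]
      have : ∑ a, p a (V n ω) * ∑ i ∈ Finset.range n, q a (V i ω) =
        ∑ a, (∑ i ∈ Finset.range n, q a (V i ω)) * p a (V n ω) := by simp only [mul_comm]
      rw [this]; ring
    have hmU : Measurable[pastSigma V n] (offDiag V n p q) := by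
      unfold offDiag
      refine Measurable.sub (Finset.measurable_fun_sum _ fun a _ => ?_) ?_
      · exact (measurable_sampleSum (hp a)).mul (measurable_sampleSum (hq a))
      · exact measurable_sampleSum (Finset.measurable_fun_sum _ fun a _ => (hp a).mul (hq a))
    -- The increments are martingale differences: the new observation enters through a centred
    -- factor, so they are orthogonal to everything past.
    have cross : ∀ {p q : ι → 𝒱 → ℝ}, (∀ a, Measurable (p a)) → (∀ a, Measurable (q a)) →
        (∀ a, MemLp (p a) 2 ν) → (∀ a, MemLp (q a) 2 ν) → (∀ a, ∫ v, q a v ∂ν = 0) →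
        ∀ {U : Ω → ℝ}, Measurable[pastSigma V n] U → MemLp U 2 μ →
        ∫ ω, U ω * ∑ a, sampleSum V n (p a) ω * q a (V n ω) ∂μ = 0 := by
      intro p q hp hq hp2 hq2 hq0 U hmU hU
      simp_rw [Finset.mul_sum]
      rw [integral_finsetSum]
      · refine Finset.sum_eq_zero fun a _ => ?_
        simp_rw [← mul_assoc]
        have hm' : Measurable[pastSigma V n] fun ω => U ω * sampleSum V n (p a) ω :=
          hmU.mul (measurable_sampleSum (hp a))
        rw [h.integral_mul_past hm' (hq a), hq0 a, mul_zero]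
      · intro a _
        exact hU.integrable_mul (memLp_mul_indep
          (h.indepFun_past (measurable_sampleSum (hp a)) (hq a))
          (h.memLp_sampleSum (hp2 a) n) (h.memLp_comp (hq2 a) n))
    have cA : ∫ ω, offDiag V n p q ω * A ω ∂μ = 0 := cross hp hq hp2 hq2 hq0 hmU hU
    have cB : ∫ ω, offDiag V n p q ω * B ω ∂μ = 0 := cross hq hp hq2 hp2 hp0 hmU hU
    have hfun : offDiag V (n + 1) p q = fun ω => offDiag V n p q ω + (A ω + B ω) := funext e
    refine ⟨by rw [hfun]; exact hU.add (hA.add hB), ?_⟩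
    have e2 : ∀ ω, offDiag V (n + 1) p q ω ^ 2 ≤ offDiag V n p q ω ^ 2
        + 2 * (offDiag V n p q ω * A ω) + 2 * (offDiag V n p q ω * B ω)
        + 2 * A ω ^ 2 + 2 * B ω ^ 2 := by
      intro ω; rw [e]; nlinarith [sq_nonneg (A ω - B ω)]
    have j1 := hU.integrable_sq
    have j2 : Integrable (fun ω => 2 * (offDiag V n p q ω * A ω)) μ :=
      (hU.integrable_mul hA).const_mul 2
    have j3 : Integrable (fun ω => 2 * (offDiag V n p q ω * B ω)) μ :=
      (hU.integrable_mul hB).const_mul 2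
    have j4 : Integrable (fun ω => 2 * A ω ^ 2) μ := hA.integrable_sq.const_mul 2
    have j5 : Integrable (fun ω => 2 * B ω ^ 2) μ := hB.integrable_sq.const_mul 2
    have hint : MemLp (offDiag V (n + 1) p q) 2 μ := by rw [hfun]; exact hU.add (hA.add hB)
    calc ∫ ω, offDiag V (n + 1) p q ω ^ 2 ∂μ
        ≤ ∫ ω, (offDiag V n p q ω ^ 2 + 2 * (offDiag V n p q ω * A ω)
          + 2 * (offDiag V n p q ω * B ω) + 2 * A ω ^ 2 + 2 * B ω ^ 2) ∂μ :=
          integral_mono hint.integrable_sq ((((j1.add j2).add j3).add j4).add j5) e2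
      _ = ∫ ω, offDiag V n p q ω ^ 2 ∂μ + 2 * (n * Θ) + 2 * (n * Θ) := by
          rw [integral_add (by fun_prop) j5, integral_add (by fun_prop) j4,
            integral_add (by fun_prop) j3, integral_add j1 j2, integral_const_mul,
            integral_const_mul, integral_const_mul, integral_const_mul, cA, cB, hAe, hBe]
          ring
      _ ≤ 2 * (n + 1 : ℕ) ^ 2 * Θ := by
          -- For n = 1 the formula of `integral_sum_past_sq` exhibits Θ as a second moment, hence
          -- its sign. The induction then closes by 2n² + 4n ≤ 2(n + 1)².
          have hΘ0 : 0 ≤ Θ := by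
            have h1 := (h.integral_sum_past_sq hp hq hp2 hq2 hp0 1).2
            rw [← hΘ] at h1
            have h2 : 0 ≤ ∫ ω, (∑ a, sampleSum V 1 (p a) ω * q a (V 1 ω)) ^ 2 ∂μ :=
              integral_nonneg fun ω => sq_nonneg _
            rw [h1] at h2; simpa using h2
          push_cast; nlinarith

end IsSample

/-! ### Euclidean vectors, orthonormal systems and Bessel's inequality. -/

/-- Euclidean norm of a coordinate vector. -/
noncomputable def eucl {m : ℕ} (v : Fin m → ℝ) : ℝ := ‖(WithLp.toLp 2 v : EuclideanSpace ℝ (Fin m))‖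

theorem eucl_sq {m : ℕ} (v : Fin m → ℝ) : eucl v ^ 2 = ∑ a, v a ^ 2 := by
  simp [eucl, EuclideanSpace.norm_sq_eq]

theorem eucl_nonneg {m : ℕ} (v : Fin m → ℝ) : 0 ≤ eucl v := norm_nonneg _

theorem eucl_eq_sqrt {m : ℕ} (v : Fin m → ℝ) : eucl v = Real.sqrt (∑ a, v a ^ 2) := by
  rw [← eucl_sq, Real.sqrt_sq (eucl_nonneg v)]

theorem eucl_sq_dot {m : ℕ} (v : Fin m → ℝ) : eucl v ^ 2 = v ⬝ᵥ v := by
  rw [eucl_sq]; simp [dotProduct, sq]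

theorem eucl_add_le {m : ℕ} (v w : Fin m → ℝ) : eucl (v + w) ≤ eucl v + eucl w := by
  simpa [eucl] using norm_add_le (WithLp.toLp 2 v : EuclideanSpace ℝ (Fin m)) (WithLp.toLp 2 w)

theorem eucl_sub_le {m : ℕ} (v w : Fin m → ℝ) : eucl (v - w) ≤ eucl v + eucl w := by
  simpa [eucl] using norm_sub_le (WithLp.toLp 2 v : EuclideanSpace ℝ (Fin m)) (WithLp.toLp 2 w)

theorem eucl_neg {m : ℕ} (v : Fin m → ℝ) : eucl (-v) = eucl v := by
  simp [eucl]

theorem eucl_smul {m : ℕ} (c : ℝ) (v : Fin m → ℝ) : eucl (c • v) = |c| * eucl v := by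
  simp [eucl, norm_smul]

theorem eucl_eq_zero {m : ℕ} {v : Fin m → ℝ} : eucl v = 0 ↔ v = 0 := by
  simp [eucl]

theorem abs_dotProduct_le {m : ℕ} (v w : Fin m → ℝ) : |v ⬝ᵥ w| ≤ eucl v * eucl w := by
  have h := abs_real_inner_le_norm (WithLp.toLp 2 v : EuclideanSpace ℝ (Fin m)) (WithLp.toLp 2 w)
  simpa [eucl, EuclideanSpace.inner_eq_star_dotProduct, dotProduct_comm] using h

section Ortho

variable {𝒱 : Type*} [MeasurableSpace 𝒱]

/-- `φ₁, …, φ_m` are orthonormal in `L²(ν)` and the Euclidean norm of `(φ₁, …, φ_m)` is almost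
surely at most `ζ`. -/
structure IsBddOrtho (ν : Measure 𝒱) {m : ℕ} (φ : Fin m → 𝒱 → ℝ) (ζ : ℝ) : Prop where
  measurable : ∀ a, Measurable (φ a)
  bdd : ∀ᵐ v ∂ν, ∑ a, φ a v ^ 2 ≤ ζ ^ 2
  ortho : ∀ a b, ∫ v, φ a v * φ b v ∂ν = if a = b then 1 else 0

theorem memLp_bdd_mul {ν : Measure 𝒱} {f g : 𝒱 → ℝ} {C : ℝ} (hf : Measurable f)
    (hC : ∀ᵐ v ∂ν, |f v| ≤ C) {p : ENNReal} (hg : MemLp g p ν) :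
    MemLp (fun v => f v * g v) p ν := by
  refine hg.of_le_mul (c := C) (hf.aestronglyMeasurable.mul hg.1) ?_
  filter_upwards [hC] with v hv
  rw [norm_mul]
  exact mul_le_mul_of_nonneg_right hv (norm_nonneg _)

namespace IsBddOrtho

variable {ν : Measure 𝒱} {m k : ℕ} {φ : Fin m → 𝒱 → ℝ} {χ : Fin k → 𝒱 → ℝ} {ζ : ℝ}

theorem abs_le (h : IsBddOrtho ν φ ζ) (a : Fin m) : ∀ᵐ v ∂ν, |φ a v| ≤ |ζ| := by
  filter_upwards [h.bdd] with v hv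
  rw [← sq_le_sq]
  exact (Finset.single_le_sum (f := fun a => φ a v ^ 2) (fun i _ => sq_nonneg _)
    (Finset.mem_univ a)).trans hv

theorem memLp_mul (h : IsBddOrtho ν φ ζ) (a : Fin m) {p : ENNReal} {g : 𝒱 → ℝ}
    (hg : MemLp g p ν) : MemLp (fun v => φ a v * g v) p ν :=
  memLp_bdd_mul (h.measurable a) (h.abs_le a) hg

theorem measurable_lin (h : IsBddOrtho ν φ ζ) (w : Fin m → ℝ) :
    Measurable fun v => ∑ a, φ a v * w a :=
  Finset.measurable_fun_sum _ fun a _ => (h.measurable a).mul_const _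

variable [IsProbabilityMeasure ν]

theorem memLp (h : IsBddOrtho ν φ ζ) (a : Fin m) (p : ENNReal) : MemLp (φ a) p ν := by
  simpa using h.memLp_mul a (memLp_const (1 : ℝ) (p := p) (μ := ν))

theorem memLp_lin (h : IsBddOrtho ν φ ζ) (w : Fin m → ℝ) (p : ENNReal) :
    MemLp (fun v => ∑ a, φ a v * w a) p ν :=
  memLp_finsetSum _ fun a _ => by
    simpa [mul_comm] using (h.memLp a p).const_mul (w a)

theorem integral_lin_sq (h : IsBddOrtho ν φ ζ) (w : Fin m → ℝ) :
    ∫ v, (∑ a, φ a v * w a) ^ 2 ∂ν = ∑ a, w a ^ 2 := by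
  have e : ∀ v, (∑ a, φ a v * w a) ^ 2 = ∑ a, ∑ b, (w a * w b) * (φ a v * φ b v) := by
    intro v; rw [sq, Finset.sum_mul_sum]
    exact Finset.sum_congr rfl fun a _ => Finset.sum_congr rfl fun b _ => by ring
  have hi : ∀ a b, Integrable (fun v => (w a * w b) * (φ a v * φ b v)) ν := fun a b =>
    ((h.memLp a 2).integrable_mul (h.memLp b 2)).const_mul _
  simp_rw [e]
  rw [integral_finsetSum _ fun a _ => integrable_finsetSum _ fun b _ => hi a b]
  refine Finset.sum_congr rfl fun a _ => ?_
  rw [integral_finsetSum _ fun b _ => hi a b]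
  simp [integral_const_mul, h.ortho, sq]

/-- Bessel's inequality. -/
theorem bessel (h : IsBddOrtho ν φ ζ) {g : 𝒱 → ℝ} (hg : MemLp g 2 ν) :
    ∑ a, (∫ v, φ a v * g v ∂ν) ^ 2 ≤ ∫ v, g v ^ 2 ∂ν := by
  set w : Fin m → ℝ := fun a => ∫ v, φ a v * g v ∂ν with hw
  have hl := h.memLp_lin w 2
  have i1 := hg.integrable_sq
  have i2 := hl.integrable_sq
  have i3 : Integrable (fun v => 2 * (g v * ∑ a, φ a v * w a)) ν :=
    (hg.integrable_mul hl).const_mul 2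
  have e3 : ∫ v, g v * ∑ a, φ a v * w a ∂ν = ∑ a, w a ^ 2 := by
    simp_rw [Finset.mul_sum]
    have : ∀ a, Integrable (fun v => g v * (φ a v * w a)) ν := fun a => by
      have := ((h.memLp a 2).integrable_mul hg).mul_const (w a)
      exact this.congr (ae_of_all _ fun v => by simp only [Pi.mul_apply]; ring)
    rw [integral_finsetSum _ fun a _ => this a]
    refine Finset.sum_congr rfl fun a _ => ?_
    rw [sq, hw, ← integral_mul_const]
    exact integral_congr_ae (ae_of_all _ fun v => by simp only; ring)
  have h0 : 0 ≤ ∫ v, (g v - ∑ a, φ a v * w a) ^ 2 ∂ν := integral_nonneg fun v => sq_nonneg _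
  have e : ∀ v, (g v - ∑ a, φ a v * w a) ^ 2 =
      g v ^ 2 - 2 * (g v * ∑ a, φ a v * w a) + (∑ a, φ a v * w a) ^ 2 := fun v => by ring
  simp_rw [e] at h0
  rw [integral_add (by fun_prop) i2, integral_sub i1 i3, integral_const_mul, e3,
    h.integral_lin_sq] at h0
  linarith

end IsBddOrtho

/-- The matrix `E[φ χ']`. -/
noncomputable def crossMean (ν : Measure 𝒱) {m k : ℕ} (φ : Fin m → 𝒱 → ℝ) (χ : Fin k → 𝒱 → ℝ) :
    Matrix (Fin m) (Fin k) ℝ :=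
  Matrix.of fun a l => ∫ v, φ a v * χ l v ∂ν

theorem crossMean_transpose (ν : Measure 𝒱) {m k : ℕ} (φ : Fin m → 𝒱 → ℝ)
    (χ : Fin k → 𝒱 → ℝ) : (crossMean ν φ χ)ᵀ = crossMean ν χ φ := by
  ext; simp [crossMean, mul_comm]

theorem IsBddOrtho.crossMean_self {ν : Measure 𝒱} {m : ℕ} {φ : Fin m → 𝒱 → ℝ} {ζ : ℝ}
    (h : IsBddOrtho ν φ ζ) : crossMean ν φ φ = 1 := by
  ext a b; simp [crossMean, h.ortho, Matrix.one_apply]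

theorem IsBddOrtho.crossMean_mulVec {ν : Measure 𝒱} [IsProbabilityMeasure ν] {m k : ℕ}
    {φ : Fin m → 𝒱 → ℝ} {χ : Fin k → 𝒱 → ℝ} {ζ : ℝ} (h : IsBddOrtho ν φ ζ)
    (h' : IsBddOrtho ν χ ζ) (w : Fin k → ℝ) (a : Fin m) :
    (crossMean ν φ χ *ᵥ w) a = ∫ v, φ a v * ∑ l, χ l v * w l ∂ν := by
  simp_rw [Finset.mul_sum, ← mul_assoc]
  have : ∀ l, Integrable (fun v => φ a v * χ l v * w l) ν := fun l =>
    ((h.memLp a 2).integrable_mul (h'.memLp l 2)).mul_const _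
  rw [integral_finsetSum _ fun l _ => this l]
  simp [crossMean, Matrix.mulVec, dotProduct, integral_mul_const]

/-- The entries of the image are the φ-coefficients of ∑ χₗwₗ, whose L² norm is the Euclidean norm
of w; Bessel's inequality makes the cross moment matrix a contraction. -/
theorem IsBddOrtho.eucl_crossMean_mulVec_le {ν : Measure 𝒱} [IsProbabilityMeasure ν] {m k : ℕ}
    {φ : Fin m → 𝒱 → ℝ} {χ : Fin k → 𝒱 → ℝ} {ζ : ℝ} (h : IsBddOrtho ν φ ζ)
    (h' : IsBddOrtho ν χ ζ) (w : Fin k → ℝ) : eucl (crossMean ν φ χ *ᵥ w) ≤ eucl w := by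
  rw [← pow_le_pow_iff_left₀ (eucl_nonneg _) (eucl_nonneg _) two_ne_zero, eucl_sq, eucl_sq,
    ← h'.integral_lin_sq w]
  simp_rw [h.crossMean_mulVec h']
  exact h.bessel (h'.memLp_lin w 2)

end Ortho

/-! ### Mean squared errors of sample means and sample cross moments. -/

/-- The quadratic form bound is applied at each v to the vector (gₗ(v)) and integrated. This
contracts one Gram matrix of a variance formula against another. -/
theorem sum_mul_integral_le {𝒱 : Type*} [MeasurableSpace 𝒱] {ν : Measure 𝒱} {k : ℕ}
    {C : Fin k → Fin k → ℝ} {κ : ℝ}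
    (hC : ∀ w : Fin k → ℝ, ∑ l, ∑ l', C l l' * (w l * w l') ≤ κ * ∑ l, w l ^ 2)
    {g : Fin k → 𝒱 → ℝ} (hg : ∀ l, MemLp (g l) 2 ν) :
    ∑ l, ∑ l', C l l' * ∫ v, g l v * g l' v ∂ν ≤ κ * ∑ l, ∫ v, g l v ^ 2 ∂ν := by
  have i1 : ∀ l l', Integrable (fun v => C l l' * (g l v * g l' v)) ν := fun l l' =>
    ((hg l).integrable_mul (hg l')).const_mul _
  have e1 : ∑ l, ∑ l', C l l' * ∫ v, g l v * g l' v ∂ν =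
      ∫ v, ∑ l, ∑ l', C l l' * (g l v * g l' v) ∂ν := by
    rw [integral_finsetSum _ fun l _ => integrable_finsetSum _ fun l' _ => i1 l l']
    refine Finset.sum_congr rfl fun l _ => ?_
    rw [integral_finsetSum _ fun l' _ => i1 l l']
    simp [integral_const_mul]
  have e2 : κ * ∑ l, ∫ v, g l v ^ 2 ∂ν = ∫ v, κ * ∑ l, g l v ^ 2 ∂ν := by
    rw [integral_const_mul, integral_finsetSum _ fun l _ => (hg l).integrable_sq]
  rw [e1, e2]
  exact integral_mono (integrable_finsetSum _ fun l _ => integrable_finsetSum _ fun l' _ => i1 l l')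
    ((integrable_finsetSum _ fun l _ => (hg l).integrable_sq).const_mul κ) fun v => hC _

theorem integral_sub_mean_sq_le {𝒱 : Type*} [MeasurableSpace 𝒱] {ν : Measure 𝒱}
    [IsProbabilityMeasure ν] {f : 𝒱 → ℝ} (hf : MemLp f 2 ν) :
    ∫ v, (f v - ∫ v', f v' ∂ν) ^ 2 ∂ν ≤ ∫ v, f v ^ 2 ∂ν := by
  set c := ∫ v', f v' ∂ν with hc
  have i1 := hf.integrable_sq
  have i2 : Integrable (fun v => 2 * c * f v) ν := (hf.integrable one_le_two).const_mul _
  have e : ∀ v, (f v - c) ^ 2 = f v ^ 2 - 2 * c * f v + c ^ 2 := fun v => by ring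
  simp_rw [e]
  rw [integral_add (by fun_prop) (by fun_prop), integral_sub i1 i2, integral_const_mul, ← hc]
  simp; nlinarith [sq_nonneg c]

/-- Sample mean of `f` over the first `n` observations. -/
noncomputable def sampleMean {Ω 𝒱 : Type*} (V : ℕ → Ω → 𝒱) (n : ℕ) (f : 𝒱 → ℝ) (ω : Ω) : ℝ :=
  sampleSum V n f ω / n

/-- The matrix `n⁻¹ ∑ φ(Vᵢ) χ(Vᵢ)'`. -/
noncomputable def crossSample {Ω 𝒱 : Type*} (V : ℕ → Ω → 𝒱) (n : ℕ) {m k : ℕ}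
    (φ : Fin m → 𝒱 → ℝ) (χ : Fin k → 𝒱 → ℝ) (ω : Ω) : Matrix (Fin m) (Fin k) ℝ :=
  Matrix.of fun a l => sampleMean V n (fun v => φ a v * χ l v) ω

section

variable {Ω 𝒱 : Type*} {V : ℕ → Ω → 𝒱}

theorem sampleMean_sub_const {n : ℕ} (hn : n ≠ 0) (f : 𝒱 → ℝ) (c : ℝ) (ω : Ω) :
    sampleMean V n f ω - c = sampleMean V n (fun v => f v - c) ω := by
  have : (n : ℝ) ≠ 0 := by exact_mod_cast hn
  simp only [sampleMean, sampleSum, Finset.sum_sub_distrib, Finset.sum_const, Finset.card_range,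
    nsmul_eq_mul]
  field_simp

theorem sampleMean_sum {ι : Type*} (s : Finset ι) (f : ι → 𝒱 → ℝ) (n : ℕ) (ω : Ω) :
    sampleMean V n (fun v => ∑ a ∈ s, f a v) ω = ∑ a ∈ s, sampleMean V n (f a) ω := by
  simp only [sampleMean, sampleSum, ← Finset.sum_div]
  rw [Finset.sum_comm]

theorem sampleMean_mul_const (f : 𝒱 → ℝ) (c : ℝ) (n : ℕ) (ω : Ω) :
    sampleMean V n (fun v => f v * c) ω = sampleMean V n f ω * c := by
  simp only [sampleMean, sampleSum, ← Finset.sum_mul]; ring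

theorem crossSample_mulVec {m k : ℕ} (φ : Fin m → 𝒱 → ℝ) (χ : Fin k → 𝒱 → ℝ) (n : ℕ) (ω : Ω)
    (w : Fin k → ℝ) (a : Fin m) :
    (crossSample V n φ χ ω *ᵥ w) a = sampleMean V n (fun v => φ a v * ∑ l, χ l v * w l) ω := by
  simp_rw [Finset.mul_sum, ← mul_assoc]
  rw [sampleMean_sum]
  simp [crossSample, Matrix.mulVec, dotProduct, sampleMean_mul_const]

end

namespace IsSample

variable {Ω 𝒱 : Type*} [MeasurableSpace Ω] [MeasurableSpace 𝒱] {μ : Measure Ω}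
  [IsProbabilityMeasure μ] {ν : Measure 𝒱} [IsProbabilityMeasure ν] {V : ℕ → Ω → 𝒱}

omit [IsProbabilityMeasure μ] [IsProbabilityMeasure ν] in
theorem memLp_sampleMean (h : IsSample μ ν V) {f : 𝒱 → ℝ} {p : ENNReal} (hf : MemLp f p ν)
    (n : ℕ) : MemLp (sampleMean V n f) p μ := by
  have := (h.memLp_sampleSum hf n).const_mul ((n : ℝ)⁻¹)
  exact this.ae_eq (ae_of_all _ fun ω => by simp [sampleMean, div_eq_inv_mul])

omit [IsProbabilityMeasure μ] in
/-- Variance of a sample mean. -/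
theorem integral_sampleMean_sub_sq_le (h : IsSample μ ν V) {f : 𝒱 → ℝ} (hf : Measurable f)
    (hf2 : MemLp f 2 ν) {n : ℕ} (hn : n ≠ 0) :
    ∫ ω, (sampleMean V n f ω - ∫ v, f v ∂ν) ^ 2 ∂μ ≤ (∫ v, f v ^ 2 ∂ν) / n := by
  have hn' : (0 : ℝ) < n := by positivity
  set c := ∫ v, f v ∂ν with hc
  have hg2 : MemLp (fun v => f v - c) 2 ν := hf2.sub (memLp_const c)
  have hg0 : ∫ v, (f v - c) ∂ν = 0 := by
    rw [integral_sub (hf2.integrable one_le_two) (integrable_const c)]; simp [hc]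
  have key := h.integral_sampleSum_mul (hf.sub_const c) (hf.sub_const c) hg2 hg2 hg0 hg0 n
  have e : ∀ ω, (sampleMean V n f ω - c) ^ 2 =
      (n : ℝ)⁻¹ ^ 2 * (sampleSum V n (fun v => f v - c) ω * sampleSum V n (fun v => f v - c) ω) := by
    intro ω; rw [sampleMean_sub_const hn, sampleMean]; ring
  simp_rw [e]
  rw [integral_const_mul, key]
  have : ∫ v, (f v - c) * (f v - c) ∂ν ≤ ∫ v, f v ^ 2 ∂ν := by
    simpa [sq] using integral_sub_mean_sq_le hf2
  rw [div_eq_inv_mul]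
  calc (n : ℝ)⁻¹ ^ 2 * (n * ∫ v, (f v - c) * (f v - c) ∂ν)
      = (n : ℝ)⁻¹ * ∫ v, (f v - c) * (f v - c) ∂ν := by field_simp
    _ ≤ _ := by gcongr

omit [IsProbabilityMeasure ν] in
theorem memLp_sampleMean_sub (h : IsSample μ ν V) {f : 𝒱 → ℝ} (hf2 : MemLp f 2 ν) (n : ℕ) (c : ℝ) :
    MemLp (fun ω => sampleMean V n f ω - c) 2 μ :=
  (h.memLp_sampleMean hf2 n).sub (memLp_const c)

theorem integral_sampleSum_sq_le (h : IsSample μ ν V) {f : 𝒱 → ℝ} (hf : Measurable f)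
    (hf2 : MemLp f 2 ν) (n : ℕ) :
    ∫ ω, sampleSum V n f ω ^ 2 ∂μ ≤ 2 * n * (∫ v, f v ^ 2 ∂ν) + 2 * n ^ 2 * (∫ v, f v ∂ν) ^ 2 := by
  rcases eq_or_ne n 0 with rfl | hn
  · simp [sampleSum]
  have hn' : (0 : ℝ) < n := by positivity
  have k := h.integral_sampleMean_sub_sq_le hf hf2 hn
  set c := ∫ v, f v ∂ν
  have i1 := (h.memLp_sampleMean_sub hf2 n c).integrable_sq
  calc ∫ ω, sampleSum V n f ω ^ 2 ∂μ
      ≤ ∫ ω, (2 * (n : ℝ) ^ 2 * (sampleMean V n f ω - c) ^ 2 + 2 * (n : ℝ) ^ 2 * c ^ 2) ∂μ := by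
        refine integral_mono (h.memLp_sampleSum hf2 n).integrable_sq
          ((i1.const_mul _).add (integrable_const _)) fun ω => ?_
        have : sampleSum V n f ω = n * (sampleMean V n f ω - c) + n * c := by
          rw [sampleMean]; field_simp; ring
        simp only [this]
        nlinarith [sq_nonneg (n * (sampleMean V n f ω - c) - n * c)]
    _ = 2 * (n : ℝ) ^ 2 * ∫ ω, (sampleMean V n f ω - c) ^ 2 ∂μ + 2 * (n : ℝ) ^ 2 * c ^ 2 := by
        rw [integral_add (i1.const_mul _) (integrable_const _), integral_const_mul]; simp
    _ ≤ 2 * (n : ℝ) ^ 2 * ((∫ v, f v ^ 2 ∂ν) / n) + 2 * (n : ℝ) ^ 2 * c ^ 2 := by gcongr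
    _ = _ := by field_simp

/-- Mean squared error of `n⁻¹ ∑ φ(Vᵢ) r(Vᵢ)`. -/
theorem integral_eucl_sampleMean_sub_le (h : IsSample μ ν V) {m : ℕ} {φ : Fin m → 𝒱 → ℝ} {ζ : ℝ}
    (hφ : IsBddOrtho ν φ ζ) {r : 𝒱 → ℝ} (hr : Measurable r) (hr2 : MemLp r 2 ν)
    {n : ℕ} (hn : n ≠ 0) :
    Integrable (fun ω => eucl (fun a => sampleMean V n (fun v => φ a v * r v) ω
      - ∫ v, φ a v * r v ∂ν) ^ 2) μ ∧
    ∫ ω, eucl (fun a => sampleMean V n (fun v => φ a v * r v) ω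
      - ∫ v, φ a v * r v ∂ν) ^ 2 ∂μ ≤ ζ ^ 2 * (∫ v, r v ^ 2 ∂ν) / n := by
  have hi : ∀ a, Integrable (fun ω => (sampleMean V n (fun v => φ a v * r v) ω
      - ∫ v, φ a v * r v ∂ν) ^ 2) μ := fun a =>
    (h.memLp_sampleMean_sub (hφ.memLp_mul a hr2) n _).integrable_sq
  simp_rw [eucl_sq]
  refine ⟨integrable_finsetSum _ fun a _ => hi a, ?_⟩
  rw [integral_finsetSum _ fun a _ => hi a]
  calc _ ≤ ∑ a, (∫ v, (φ a v * r v) ^ 2 ∂ν) / n := Finset.sum_le_sum fun a _ =>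
        h.integral_sampleMean_sub_sq_le ((hφ.measurable a).mul hr) (hφ.memLp_mul a hr2) hn
    _ = (∫ v, ∑ a, (φ a v * r v) ^ 2 ∂ν) / n := by
        rw [integral_finsetSum _ fun a _ => (hφ.memLp_mul a hr2).integrable_sq, Finset.sum_div]
    _ ≤ _ := by
        rw [← integral_const_mul]
        gcongr ?_ / _
        refine integral_mono_ae (integrable_finsetSum _ fun a _ =>
          (hφ.memLp_mul a hr2).integrable_sq) (hr2.integrable_sq.const_mul _) ?_
        filter_upwards [hφ.bdd] with v hv
        simp only [mul_pow, ← Finset.sum_mul]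
        exact mul_le_mul_of_nonneg_right hv (sq_nonneg _)

/-- Mean squared error of `n⁻¹ ∑ φ(Vᵢ) χ(Vᵢ)'` applied to a fixed vector. -/
theorem integral_eucl_crossSample_sub_le (h : IsSample μ ν V) {m k : ℕ} {φ : Fin m → 𝒱 → ℝ}
    {χ : Fin k → 𝒱 → ℝ} {ζ : ℝ} (hφ : IsBddOrtho ν φ ζ) (hχ : IsBddOrtho ν χ ζ) (w : Fin k → ℝ)
    {n : ℕ} (hn : n ≠ 0) :
    Integrable (fun ω => eucl ((crossSample V n φ χ ω - crossMean ν φ χ) *ᵥ w) ^ 2) μ ∧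
    ∫ ω, eucl ((crossSample V n φ χ ω - crossMean ν φ χ) *ᵥ w) ^ 2 ∂μ ≤
      ζ ^ 2 * eucl w ^ 2 / n := by
  have k := h.integral_eucl_sampleMean_sub_le hφ (hχ.measurable_lin w) (hχ.memLp_lin w 2) hn
  rw [hχ.integral_lin_sq, ← eucl_sq] at k
  have e : ∀ ω, (crossSample V n φ χ ω - crossMean ν φ χ) *ᵥ w = fun a =>
      sampleMean V n (fun v => φ a v * ∑ l, χ l v * w l) ω - ∫ v, φ a v * ∑ l, χ l v * w l ∂ν := by
    intro ω; ext a
    rw [Matrix.sub_mulVec, Pi.sub_apply, crossSample_mulVec, hφ.crossMean_mulVec hχ]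
  simp_rw [e]
  exact k

end IsSample

/-! ### Operator norm of the fluctuation of a sample cross moment matrix. -/

/-- The centred products `φₐ χₗ - E[φₐ χₗ]`. -/
noncomputable def centred {𝒱 : Type*} [MeasurableSpace 𝒱] (ν : Measure 𝒱) {m k : ℕ}
    (φ : Fin m → 𝒱 → ℝ) (χ : Fin k → 𝒱 → ℝ) (a : Fin m) (l : Fin k) (v : 𝒱) : ℝ :=
  φ a v * χ l v - crossMean ν φ χ a l

theorem centred_swap {𝒱 : Type*} [MeasurableSpace 𝒱] (ν : Measure 𝒱) {m k : ℕ}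
    (φ : Fin m → 𝒱 → ℝ) (χ : Fin k → 𝒱 → ℝ) (a : Fin m) (l : Fin k) :
    centred ν φ χ a l = centred ν χ φ l a := by
  ext v; simp [centred, crossMean, mul_comm]

section Centred

variable {𝒱 : Type*} [MeasurableSpace 𝒱] {ν : Measure 𝒱} [IsProbabilityMeasure ν] {m k : ℕ}
  {φ : Fin m → 𝒱 → ℝ} {χ : Fin k → 𝒱 → ℝ} {ζ : ℝ}

omit [IsProbabilityMeasure ν] in
theorem measurable_centred (hφ : IsBddOrtho ν φ ζ) (hχ : IsBddOrtho ν χ ζ) (a : Fin m)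
    (l : Fin k) : Measurable (centred ν φ χ a l) :=
  ((hφ.measurable a).mul (hχ.measurable l)).sub_const _

theorem memLp_centred (hφ : IsBddOrtho ν φ ζ) (hχ : IsBddOrtho ν χ ζ) (a : Fin m)
    (l : Fin k) : MemLp (centred ν φ χ a l) 2 ν :=
  (hφ.memLp_mul a (hχ.memLp l 2)).sub (memLp_const _)

theorem integral_centred (hφ : IsBddOrtho ν φ ζ) (hχ : IsBddOrtho ν χ ζ) (a : Fin m)
    (l : Fin k) : ∫ v, centred ν φ χ a l v ∂ν = 0 := by
  have : Integrable (fun v => φ a v * χ l v) ν :=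
    (hφ.memLp_mul a (hχ.memLp l 2)).integrable one_le_two
  simp only [centred]
  rw [integral_sub this (integrable_const _)]
  simp [crossMean]

omit [IsProbabilityMeasure ν] in
theorem centred_mul_sum (w : Fin k → ℝ) (a : Fin m) (v : 𝒱) :
    ∑ l, centred ν φ χ a l v * w l = φ a v * ∑ l, χ l v * w l - (crossMean ν φ χ *ᵥ w) a := by
  simp only [centred, sub_mul, Finset.sum_sub_distrib, Finset.mul_sum, ← mul_assoc]
  rfl

/-- The left side is the sum over a of the variances of φₐ·∑ χₗwₗ. Variances are at most second
moments, ∑ φₐ² ≤ ζ² almost surely, and orthonormality of χ leaves ∑ wₗ². -/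
theorem centred_quadForm_le (hφ : IsBddOrtho ν φ ζ) (hχ : IsBddOrtho ν χ ζ) (w : Fin k → ℝ) :
    ∑ l, ∑ l', (∑ a, ∫ v, centred ν φ χ a l v * centred ν φ χ a l' v ∂ν) * (w l * w l') ≤
      ζ ^ 2 * ∑ l, w l ^ 2 := by
  have hi : ∀ a l l', Integrable (fun v => centred ν φ χ a l v * w l *
      (centred ν φ χ a l' v * w l')) ν := fun a l l' =>
    ((memLp_centred hφ hχ a l).mul_const _).integrable_mul ((memLp_centred hφ hχ a l').mul_const _)
  have e : ∑ l, ∑ l', (∑ a, ∫ v, centred ν φ χ a l v * centred ν φ χ a l' v ∂ν) * (w l * w l') =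
      ∑ a, ∫ v, (∑ l, centred ν φ χ a l v * w l) ^ 2 ∂ν := by
    have : ∀ a, ∫ v, (∑ l, centred ν φ χ a l v * w l) ^ 2 ∂ν =
        ∑ l, ∑ l', (∫ v, centred ν φ χ a l v * centred ν φ χ a l' v ∂ν) * (w l * w l') := by
      intro a
      simp_rw [sq, Finset.sum_mul_sum]
      rw [integral_finsetSum _ fun l _ => integrable_finsetSum _ fun l' _ => hi a l l']
      refine Finset.sum_congr rfl fun l _ => ?_
      rw [integral_finsetSum _ fun l' _ => hi a l l']
      refine Finset.sum_congr rfl fun l' _ => ?_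
      rw [← integral_mul_const]
      exact integral_congr_ae (ae_of_all _ fun v => by simp only; ring)
    simp_rw [this, Finset.sum_mul]
    symm
    rw [Finset.sum_comm]
    refine Finset.sum_congr rfl fun l _ => ?_
    rw [Finset.sum_comm]
  have hw := hχ.memLp_lin w 2
  rw [e]
  calc ∑ a, ∫ v, (∑ l, centred ν φ χ a l v * w l) ^ 2 ∂ν
      ≤ ∑ a, ∫ v, (φ a v * ∑ l, χ l v * w l) ^ 2 ∂ν := by
        refine Finset.sum_le_sum fun a _ => ?_
        simp_rw [centred_mul_sum, hφ.crossMean_mulVec hχ]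
        exact integral_sub_mean_sq_le (hφ.memLp_mul a hw)
    _ = ∫ v, ∑ a, (φ a v * ∑ l, χ l v * w l) ^ 2 ∂ν := by
        rw [integral_finsetSum _ fun a _ => (hφ.memLp_mul a hw).integrable_sq]
    _ ≤ ∫ v, ζ ^ 2 * (∑ l, χ l v * w l) ^ 2 ∂ν := by
        refine integral_mono_ae (integrable_finsetSum _ fun a _ =>
          (hφ.memLp_mul a hw).integrable_sq) (hw.integrable_sq.const_mul _) ?_
        filter_upwards [hφ.bdd] with v hv
        simp only [mul_pow, ← Finset.sum_mul]
        exact mul_le_mul_of_nonneg_right hv (sq_nonneg _)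
    _ = _ := by rw [integral_const_mul, hχ.integral_lin_sq]

theorem sum_integral_centred_sq_le (hφ : IsBddOrtho ν φ ζ) (hχ : IsBddOrtho ν χ ζ) :
    ∑ l, ∑ a, ∫ v, centred ν φ χ a l v ^ 2 ∂ν ≤ ζ ^ 2 * k := by
  have h1 : ∀ l, ∑ a, ∫ v, centred ν φ χ a l v ^ 2 ∂ν ≤ ζ ^ 2 := by
    intro l
    have := centred_quadForm_le hφ hχ (Pi.single l 1)
    simpa [Pi.single_apply, sq] using this
  calc _ ≤ ∑ _l : Fin k, ζ ^ 2 := Finset.sum_le_sum fun l _ => h1 l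
    _ = _ := by simp [mul_comm]

variable {Ω : Type*} [MeasurableSpace Ω] {μ : Measure Ω} [IsProbabilityMeasure μ]
  {V : ℕ → Ω → 𝒱}

omit [IsProbabilityMeasure ν] [MeasurableSpace Ω] in
theorem crossSample_sub_apply {n : ℕ} (hn : n ≠ 0) (a : Fin m) (l : Fin k) (ω : Ω) :
    (crossSample V n φ χ ω - crossMean ν φ χ) a l = sampleSum V n (centred ν φ χ a l) ω / n := by
  simp only [Matrix.sub_apply, crossSample, Matrix.of_apply]
  rw [sampleMean_sub_const hn]
  rfl

/-- Off-diagonal part of the Gram matrix of `∑ (φ(Vᵢ) χ(Vᵢ)' - E[φ χ'])`, entry `(l, l')`. -/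
noncomputable def gramOffDiag (ν : Measure 𝒱) (V : ℕ → Ω → 𝒱) (n : ℕ) (φ : Fin m → 𝒱 → ℝ)
    (χ : Fin k → 𝒱 → ℝ) (l l' : Fin k) : Ω → ℝ :=
  IsSample.offDiag V n (fun a => centred ν φ χ a l) (fun a => centred ν φ χ a l')

omit [IsProbabilityMeasure μ] in
-- Removing the pairs i = j makes each entry degenerate, so `integral_offDiag_sq_le` applies
-- entrywise. The resulting fourfold sum is not estimated term by term: one factor ζ² comes from an
-- operator bound and only the other one from a trace, which costs ζ²k.
theorem IsSample.integral_gramOffDiag_le (h : IsSample μ ν V) (hφ : IsBddOrtho ν φ ζ)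
    (hχ : IsBddOrtho ν χ ζ) (n : ℕ) :
    Integrable (fun ω => ∑ l, ∑ l', gramOffDiag ν V n φ χ l l' ω ^ 2) μ ∧
    ∫ ω, ∑ l, ∑ l', gramOffDiag ν V n φ χ l l' ω ^ 2 ∂μ ≤ 2 * n ^ 2 * (ζ ^ 4 * k) := by
  have key := fun l l' => h.integral_offDiag_sq_le
    (fun a => measurable_centred hφ hχ a l) (fun a => measurable_centred hφ hχ a l')
    (fun a => memLp_centred hφ hχ a l) (fun a => memLp_centred hφ hχ a l')
    (fun a => integral_centred hφ hχ a l) (fun a => integral_centred hφ hχ a l') n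
  have hi : ∀ l l', Integrable (fun ω => gramOffDiag ν V n φ χ l l' ω ^ 2) μ := fun l l' =>
    (key l l').1.integrable_sq
  refine ⟨integrable_finsetSum _ fun l _ => integrable_finsetSum _ fun l' _ => hi l l', ?_⟩
  rw [integral_finsetSum _ fun l _ => integrable_finsetSum _ fun l' _ => hi l l']
  -- Summing over l first produces the matrix in (a, b) of `centred_quadForm_le` with the roles of φ
  -- and χ exchanged, so its quadratic form is at most ζ².
  have h1 : ∀ l', ∑ l, ∑ a, ∑ b, (∫ v, centred ν φ χ a l v * centred ν φ χ b l v ∂ν) *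
      ∫ v, centred ν φ χ a l' v * centred ν φ χ b l' v ∂ν ≤
      ζ ^ 2 * ∑ a, ∫ v, centred ν φ χ a l' v ^ 2 ∂ν := by
    intro l'
    have hq := sum_mul_integral_le (g := fun a => centred ν φ χ a l')
      (C := fun a b => ∑ l, ∫ v, centred ν φ χ a l v * centred ν φ χ b l v ∂ν) (κ := ζ ^ 2)
      (fun w => by
        have := centred_quadForm_le hχ hφ w
        simpa only [centred_swap ν χ φ] using this)
      (fun a => memLp_centred hφ hχ a l')
    refine le_trans (le_of_eq ?_) hq
    simp_rw [Finset.sum_mul]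
    rw [Finset.sum_comm]
    refine Finset.sum_congr rfl fun a _ => ?_
    rw [Finset.sum_comm]
  calc ∑ l, ∫ ω, ∑ l', gramOffDiag ν V n φ χ l l' ω ^ 2 ∂μ
      = ∑ l, ∑ l', ∫ ω, gramOffDiag ν V n φ χ l l' ω ^ 2 ∂μ :=
        Finset.sum_congr rfl fun l _ => integral_finsetSum _ fun l' _ => hi l l'
    _ ≤ ∑ l, ∑ l', 2 * (n : ℝ) ^ 2 * ∑ a, ∑ b,
          (∫ v, centred ν φ χ a l v * centred ν φ χ b l v ∂ν) *
          ∫ v, centred ν φ χ a l' v * centred ν φ χ b l' v ∂ν :=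
        Finset.sum_le_sum fun l _ => Finset.sum_le_sum fun l' _ => (key l l').2
    _ = 2 * (n : ℝ) ^ 2 * ∑ l', ∑ l, ∑ a, ∑ b,
          (∫ v, centred ν φ χ a l v * centred ν φ χ b l v ∂ν) *
          ∫ v, centred ν φ χ a l' v * centred ν φ χ b l' v ∂ν := by
        rw [Finset.sum_comm, Finset.mul_sum]
        simp_rw [Finset.mul_sum]
    _ ≤ 2 * (n : ℝ) ^ 2 * ∑ l', ζ ^ 2 * ∑ a, ∫ v, centred ν φ χ a l' v ^ 2 ∂ν := by
        gcongr with l' _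
        exact h1 l'
    _ = 2 * (n : ℝ) ^ 2 * (ζ ^ 2 * ∑ l', ∑ a, ∫ v, centred ν φ χ a l' v ^ 2 ∂ν) := by
        rw [← Finset.mul_sum]
    _ ≤ 2 * (n : ℝ) ^ 2 * (ζ ^ 2 * (ζ ^ 2 * k)) := by
        gcongr
        exact sum_integral_centred_sq_le hφ hχ
    _ = _ := by ring

/-- Mean squared Frobenius error of the sample Gram matrix. -/
theorem IsSample.integral_gram_frob_le (h : IsSample μ ν V) (hχ : IsBddOrtho ν χ ζ)
    {n : ℕ} (hn : n ≠ 0) :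
    Integrable (fun ω => ∑ l, ∑ l', (crossSample V n χ χ ω - 1) l l' ^ 2) μ ∧
    ∫ ω, ∑ l, ∑ l', (crossSample V n χ χ ω - 1) l l' ^ 2 ∂μ ≤ ζ ^ 2 * k / n := by
  have key := fun l' => h.integral_eucl_crossSample_sub_le hχ hχ (Pi.single l' 1) hn
  simp_rw [hχ.crossMean_self, Matrix.mulVec_single_one, eucl_sq, Matrix.col_apply] at key
  have e : ∀ ω, ∑ l, ∑ l', (crossSample V n χ χ ω - 1) l l' ^ 2 =
      ∑ l', ∑ l, (crossSample V n χ χ ω - 1) l l' ^ 2 := fun ω => Finset.sum_comm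
  simp_rw [e]
  refine ⟨integrable_finsetSum _ fun l' _ => (key l').1, ?_⟩
  rw [integral_finsetSum _ fun l' _ => (key l').1]
  calc _ ≤ ∑ _l' : Fin k, ζ ^ 2 / n := Finset.sum_le_sum fun l' _ => by
        refine (key l').2.trans (le_of_eq ?_)
        simp [Pi.single_apply]
    _ = _ := by simp; ring

end Centred

section

variable {𝒱 : Type*} [MeasurableSpace 𝒱] {ν : Measure 𝒱} [IsProbabilityMeasure ν] {m k : ℕ}
  {φ : Fin m → 𝒱 → ℝ} {χ : Fin k → 𝒱 → ℝ} {ζ : ℝ}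
  {Ω : Type*} [MeasurableSpace Ω] {μ : Measure Ω}
  {V : ℕ → Ω → 𝒱}

/-- Random bound for the squared operator norm of `n⁻¹ ∑ φ(Vᵢ) χ(Vᵢ)' - E[φ χ']`. -/
noncomputable def opBound (ν : Measure 𝒱) (V : ℕ → Ω → 𝒱) (n : ℕ) (φ : Fin m → 𝒱 → ℝ)
    (χ : Fin k → 𝒱 → ℝ) (ζ : ℝ) (ω : Ω) : ℝ :=
  2 * ζ ^ 2 / n * (1 + Real.sqrt (∑ l, ∑ l', (crossSample V n χ χ ω - 1) l l' ^ 2)) + 2 / n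
    + Real.sqrt (∑ l, ∑ l', gramOffDiag ν V n φ χ l l' ω ^ 2) / n ^ 2

theorem sum_sum_mul_le_sqrt (A : Fin k → Fin k → ℝ) (w : Fin k → ℝ) :
    ∑ l, ∑ l', A l l' * (w l * w l') ≤ Real.sqrt (∑ l, ∑ l', A l l' ^ 2) * eucl w ^ 2 := by
  have h := Finset.sum_mul_sq_le_sq_mul_sq (Finset.univ : Finset (Fin k × Fin k))
    (fun p => A p.1 p.2) (fun p => w p.1 * w p.2)
  simp only [Fintype.sum_prod_type] at h
  have e : ∑ l, ∑ l', (w l * w l') ^ 2 = (eucl w ^ 2) ^ 2 := by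
    rw [eucl_sq, sq (∑ a, w a ^ 2), Finset.sum_mul_sum]
    simp only [mul_pow]
  rw [e] at h
  have h0 : 0 ≤ ∑ l, ∑ l', A l l' ^ 2 := Finset.sum_nonneg fun _ _ => Finset.sum_nonneg
    fun _ _ => sq_nonneg _
  refine le_trans (Real.le_sqrt_of_sq_le h) ?_
  rw [Real.sqrt_mul h0, Real.sqrt_sq (sq_nonneg _)]

/-- The exceptional null set comes only from the almost sure bound on φ along the sample, so one
null set serves all w and the estimate is a genuine operator norm bound. -/
theorem IsSample.eucl_crossSample_sub_sq_le (h : IsSample μ ν V) (hφ : IsBddOrtho ν φ ζ)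
    (hχ : IsBddOrtho ν χ ζ) {n : ℕ} (hn : n ≠ 0) :
    ∀ᵐ ω ∂μ, ∀ w, eucl ((crossSample V n φ χ ω - crossMean ν φ χ) *ᵥ w) ^ 2 ≤
      opBound ν V n φ χ ζ ω * eucl w ^ 2 := by
  have hn' : (0 : ℝ) < n := by positivity
  have hb : ∀ᵐ ω ∂μ, ∀ i, ∑ a, φ a (V i ω) ^ 2 ≤ ζ ^ 2 :=
    ae_all_iff.2 fun i => (h.law i).quasiMeasurePreserving.ae hφ.bdd
  filter_upwards [hb] with ω hω w
  have e1 : eucl ((crossSample V n φ χ ω - crossMean ν φ χ) *ᵥ w) ^ 2 =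
      (∑ l, ∑ l', (∑ a, sampleSum V n (centred ν φ χ a l) ω *
        sampleSum V n (centred ν φ χ a l') ω) * (w l * w l')) / n ^ 2 := by
    rw [eucl_sq]
    simp_rw [Matrix.mulVec, dotProduct, crossSample_sub_apply hn, Finset.sum_mul]
    rw [Finset.sum_div]
    simp_rw [sq (∑ l, _), Finset.sum_mul_sum]
    rw [Finset.sum_comm]
    refine Finset.sum_congr rfl fun l _ => ?_
    rw [Finset.sum_comm, Finset.sum_div]
    refine Finset.sum_congr rfl fun l' _ => ?_
    rw [Finset.sum_div]
    refine Finset.sum_congr rfl fun a _ => ?_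
    field_simp
  -- Split the double sum over observations into pairs i ≠ j, which form `gramOffDiag`, and pairs i
  -- = j.
  have e2 : ∑ l, ∑ l', (∑ a, sampleSum V n (centred ν φ χ a l) ω *
        sampleSum V n (centred ν φ χ a l') ω) * (w l * w l') =
      ∑ l, ∑ l', gramOffDiag ν V n φ χ l l' ω * (w l * w l') +
      ∑ i ∈ Finset.range n, ∑ a, (∑ l, centred ν φ χ a l (V i ω) * w l) ^ 2 := by
    have : ∑ i ∈ Finset.range n, ∑ a, (∑ l, centred ν φ χ a l (V i ω) * w l) ^ 2 =
        ∑ l, ∑ l', sampleSum V n (fun v => ∑ a, centred ν φ χ a l v * centred ν φ χ a l' v) ω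
          * (w l * w l') := by
      simp_rw [sq, Finset.sum_mul_sum, sampleSum, Finset.sum_mul]
      symm
      calc _ = ∑ l, ∑ i ∈ Finset.range n, ∑ l', ∑ a, centred ν φ χ a l (V i ω) *
              centred ν φ χ a l' (V i ω) * (w l * w l') :=
            Finset.sum_congr rfl fun l _ => Finset.sum_comm
        _ = _ := by
            rw [Finset.sum_comm]
            refine Finset.sum_congr rfl fun i _ => ?_
            symm
            rw [Finset.sum_comm]
            refine Finset.sum_congr rfl fun l _ => ?_
            rw [Finset.sum_comm]
            exact Finset.sum_congr rfl fun l' _ => Finset.sum_congr rfl fun a _ => by ring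
    rw [this, ← Finset.sum_add_distrib]
    refine Finset.sum_congr rfl fun l _ => ?_
    rw [← Finset.sum_add_distrib]
    refine Finset.sum_congr rfl fun l' _ => ?_
    rw [← add_mul, gramOffDiag, IsSample.offDiag]
    ring
  have b1 := sum_sum_mul_le_sqrt (fun l l' => gramOffDiag ν V n φ χ l l' ω) w
  have b2 : ∑ i ∈ Finset.range n, ∑ a, (∑ l, centred ν φ χ a l (V i ω) * w l) ^ 2 ≤
      2 * ζ ^ 2 * n * ((1 + Real.sqrt (∑ l, ∑ l', (crossSample V n χ χ ω - 1) l l' ^ 2))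
        * eucl w ^ 2) + 2 * n * eucl w ^ 2 := by
    have c1 : ∀ i, ∑ a, (∑ l, centred ν φ χ a l (V i ω) * w l) ^ 2 ≤
        2 * ζ ^ 2 * (∑ l, χ l (V i ω) * w l) ^ 2 + 2 * eucl w ^ 2 := by
      intro i
      have c3 : eucl (crossMean ν φ χ *ᵥ w) ^ 2 ≤ eucl w ^ 2 :=
        pow_le_pow_left₀ (eucl_nonneg _) (hφ.eucl_crossMean_mulVec_le hχ w) 2
      calc ∑ a, (∑ l, centred ν φ χ a l (V i ω) * w l) ^ 2
          ≤ ∑ a, (2 * (φ a (V i ω) ^ 2 * (∑ l, χ l (V i ω) * w l) ^ 2)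
              + 2 * (crossMean ν φ χ *ᵥ w) a ^ 2) := by
            refine Finset.sum_le_sum fun a _ => ?_
            rw [centred_mul_sum]
            nlinarith [sq_nonneg (φ a (V i ω) * ∑ l, χ l (V i ω) * w l
              + (crossMean ν φ χ *ᵥ w) a)]
        _ = 2 * ((∑ a, φ a (V i ω) ^ 2) * (∑ l, χ l (V i ω) * w l) ^ 2)
              + 2 * eucl (crossMean ν φ χ *ᵥ w) ^ 2 := by
            rw [Finset.sum_add_distrib, ← Finset.mul_sum, ← Finset.mul_sum, ← Finset.sum_mul,
              eucl_sq]
        _ ≤ 2 * (ζ ^ 2 * (∑ l, χ l (V i ω) * w l) ^ 2) + 2 * eucl w ^ 2 := by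
            gcongr
            exact hω i
        _ = _ := by ring
    -- The diagonal is n times the quadratic form of the sample Gram matrix of χ, here written as
    -- identity plus fluctuation.
    have c2 : ∑ i ∈ Finset.range n, (∑ l, χ l (V i ω) * w l) ^ 2 =
        n * ((∑ l, ∑ l', (crossSample V n χ χ ω - 1) l l' * (w l * w l')) + eucl w ^ 2) := by
      have d1 : ∑ l, ∑ l', (1 : Matrix (Fin k) (Fin k) ℝ) l l' * (w l * w l') = eucl w ^ 2 := by
        rw [eucl_sq]; simp [Matrix.one_apply, sq]
      rw [← d1, ← Finset.sum_add_distrib]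
      simp_rw [← Finset.sum_add_distrib, ← add_mul, Matrix.sub_apply, sub_add_cancel, crossSample,
        Matrix.of_apply, sampleMean, sampleSum, sq, Finset.sum_mul_sum, Finset.mul_sum]
      rw [Finset.sum_comm]
      refine Finset.sum_congr rfl fun l _ => ?_
      rw [Finset.sum_comm]
      refine Finset.sum_congr rfl fun l' _ => ?_
      rw [div_mul_eq_mul_div, mul_div_cancel₀ _ hn'.ne', Finset.sum_mul]
      exact Finset.sum_congr rfl fun i _ => by ring
    have b3 := sum_sum_mul_le_sqrt (fun l l' => (crossSample V n χ χ ω - 1) l l') w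
    calc _ ≤ ∑ i ∈ Finset.range n, (2 * ζ ^ 2 * (∑ l, χ l (V i ω) * w l) ^ 2 + 2 * eucl w ^ 2) :=
          Finset.sum_le_sum fun i _ => c1 i
      _ = 2 * ζ ^ 2 * (n * ((∑ l, ∑ l', (crossSample V n χ χ ω - 1) l l' * (w l * w l'))
            + eucl w ^ 2)) + 2 * n * eucl w ^ 2 := by
          rw [Finset.sum_add_distrib, ← Finset.mul_sum, c2]; simp; ring
      _ ≤ 2 * ζ ^ 2 * (n * (Real.sqrt (∑ l, ∑ l', (crossSample V n χ χ ω - 1) l l' ^ 2)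
            * eucl w ^ 2 + eucl w ^ 2)) + 2 * n * eucl w ^ 2 := by gcongr
      _ = _ := by ring
  rw [e1, e2, div_le_iff₀ (by positivity)]
  refine (add_le_add b1 b2).trans (le_of_eq ?_)
  rw [opBound]
  field_simp
  ring

/-! ### A matrix fluctuation applied to the mean of the same sample. -/

/-- `n⁻¹ ∑ φ(Vᵢ) χ(Vᵢ)' - E[φ χ']` applied to the sample mean of a centred random vector `g(V)`. -/
theorem IsSample.integral_eucl_crossSample_mulVec_mean_le [IsProbabilityMeasure μ] (h : IsSample μ ν V)
    (hφ : IsBddOrtho ν φ ζ) (hχ : IsBddOrtho ν χ ζ) {g : Fin k → 𝒱 → ℝ}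
    (hg : ∀ l, Measurable (g l)) (hg2 : ∀ l, MemLp (g l) 2 ν) (hg0 : ∀ l, ∫ v, g l v ∂ν = 0)
    {n : ℕ} (hn : n ≠ 0) :
    Integrable (fun ω => eucl ((crossSample V n φ χ ω - crossMean ν φ χ) *ᵥ
      fun l => sampleMean V n (g l) ω) ^ 2) μ ∧
    ∫ ω, eucl ((crossSample V n φ χ ω - crossMean ν φ χ) *ᵥ
      fun l => sampleMean V n (g l) ω) ^ 2 ∂μ ≤
    4 * (ζ ^ 2 / n ^ 2 + 2 * (ζ ^ 4 + 1) / n ^ 3) * (∑ l, ∫ v, g l v ^ 2 ∂ν)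
      + 4 / n ^ 2 * ∑ a, (∫ v, φ a v * ∑ l, χ l v * g l v ∂ν) ^ 2 := by
  have hn' : (0 : ℝ) < n := by positivity
  -- Matrix and vector come from the same observations. `D` collects the pairs i = j; it is not
  -- centred, and its mean produces the last summand of the bound. The pairs i ≠ j are degenerate.
  set D : Fin m → 𝒱 → ℝ := fun a v => ∑ l, centred ν φ χ a l v * g l v with hD
  have hχg : MemLp (fun v => ∑ l, χ l v * g l v) 2 ν :=
    memLp_finsetSum _ fun l _ => hχ.memLp_mul l (hg2 l)
  have hSg : ∀ a, MemLp (fun v => ∑ l, crossMean ν φ χ a l * g l v) 2 ν := fun a =>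
    memLp_finsetSum _ fun l _ => (hg2 l).const_mul _
  have hDe : ∀ a v, D a v = φ a v * ∑ l, χ l v * g l v - ∑ l, crossMean ν φ χ a l * g l v := by
    intro a v
    simp only [hD, centred, sub_mul, Finset.sum_sub_distrib, Finset.mul_sum, mul_assoc]
  have hφχ : ∀ a, MemLp (fun v => φ a v * ∑ l, χ l v * g l v) 2 ν := fun a => hφ.memLp_mul a hχg
  have hD2 : ∀ a, MemLp (D a) 2 ν := fun a =>
    ((hφχ a).sub (hSg a)).ae_eq (ae_of_all _ fun v => (hDe a v).symm)
  have hDm : ∀ a, Measurable (D a) := fun a => Finset.measurable_fun_sum _ fun l _ =>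
    (measurable_centred hφ hχ a l).mul (hg l)
  have hD0 : ∀ a, ∫ v, D a v ∂ν = ∫ v, φ a v * ∑ l, χ l v * g l v ∂ν := by
    intro a
    simp_rw [hDe]
    rw [integral_sub ((hφχ a).integrable one_le_two) ((hSg a).integrable one_le_two),
      integral_finsetSum _ fun l _ => ((hg2 l).integrable one_le_two).const_mul _]
    simp [integral_const_mul, hg0]
  have hDs : ∑ a, ∫ v, D a v ^ 2 ∂ν ≤ 2 * (ζ ^ 4 + 1) * ∑ l, ∫ v, g l v ^ 2 ∂ν := by
    have i1 := fun a => (hφχ a).integrable_sq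
    have i2 := fun a => (hSg a).integrable_sq
    rw [← integral_finsetSum _ fun a _ => (hD2 a).integrable_sq,
      ← integral_finsetSum _ fun l _ => (hg2 l).integrable_sq, ← integral_const_mul]
    refine integral_mono_ae (integrable_finsetSum _ fun a _ => (hD2 a).integrable_sq)
      ((integrable_finsetSum _ fun l _ => (hg2 l).integrable_sq).const_mul _) ?_
    filter_upwards [hφ.bdd, hχ.bdd] with v hv hv'
    have c3 : eucl (crossMean ν φ χ *ᵥ fun l => g l v) ^ 2 ≤ eucl (fun l => g l v) ^ 2 :=
      pow_le_pow_left₀ (eucl_nonneg _) (hφ.eucl_crossMean_mulVec_le hχ _) 2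
    have c4 : (∑ l, χ l v * g l v) ^ 2 ≤ ζ ^ 2 * ∑ l, g l v ^ 2 :=
      (Finset.sum_mul_sq_le_sq_mul_sq _ _ _).trans
        (mul_le_mul_of_nonneg_right hv' (Finset.sum_nonneg fun _ _ => sq_nonneg _))
    have hg0' : 0 ≤ ∑ l, g l v ^ 2 := Finset.sum_nonneg fun _ _ => sq_nonneg _
    rw [eucl_sq (fun l => g l v)] at c3
    calc ∑ a, D a v ^ 2 ≤ ∑ a, (2 * (φ a v ^ 2 * (∑ l, χ l v * g l v) ^ 2)
          + 2 * (crossMean ν φ χ *ᵥ fun l => g l v) a ^ 2) := by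
          refine Finset.sum_le_sum fun a _ => ?_
          rw [hDe]
          simp only [Matrix.mulVec, dotProduct]
          nlinarith [sq_nonneg (φ a v * ∑ l, χ l v * g l v + ∑ l, crossMean ν φ χ a l * g l v)]
      _ = 2 * ((∑ a, φ a v ^ 2) * (∑ l, χ l v * g l v) ^ 2)
            + 2 * eucl (crossMean ν φ χ *ᵥ fun l => g l v) ^ 2 := by
          rw [Finset.sum_add_distrib, ← Finset.mul_sum, ← Finset.mul_sum, ← Finset.sum_mul,
            eucl_sq]
      _ ≤ 2 * (ζ ^ 2 * (ζ ^ 2 * ∑ l, g l v ^ 2)) + 2 * ∑ l, g l v ^ 2 := by gcongr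
      _ = _ := by ring
  have hU := fun a => h.integral_offDiag_sq_le
    (fun l => measurable_centred hφ hχ a l) hg (fun l => memLp_centred hφ hχ a l) hg2
    (fun l => integral_centred hφ hχ a l) hg0 n
  have hUs : ∑ a, ∑ l, ∑ l', (∫ v, centred ν φ χ a l v * centred ν φ χ a l' v ∂ν) *
      ∫ v, g l v * g l' v ∂ν ≤ ζ ^ 2 * ∑ l, ∫ v, g l v ^ 2 ∂ν := by
    refine le_trans (le_of_eq ?_) (sum_mul_integral_le (centred_quadForm_le hφ hχ) hg2)
    simp_rw [Finset.sum_mul]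
    rw [Finset.sum_comm]
    refine Finset.sum_congr rfl fun a _ => ?_
    rw [Finset.sum_comm]
  have e : ∀ ω a, ((crossSample V n φ χ ω - crossMean ν φ χ) *ᵥ
      fun l => sampleMean V n (g l) ω) a =
      (IsSample.offDiag V n (fun l => centred ν φ χ a l) g ω + sampleSum V n (D a) ω) / n ^ 2 := by
    intro ω a
    simp_rw [Matrix.mulVec, dotProduct, crossSample_sub_apply hn, IsSample.offDiag, hD, sampleMean]
    rw [sub_add_cancel, Finset.sum_div]
    exact Finset.sum_congr rfl fun l _ => by field_simp
  have hY : ∀ a, MemLp (fun ω => (IsSample.offDiag V n (fun l => centred ν φ χ a l) g ω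
      + sampleSum V n (D a) ω) / n ^ 2) 2 μ := fun a => by
    have := ((hU a).1.add (h.memLp_sampleSum (hD2 a) n)).const_mul ((n : ℝ) ^ 2)⁻¹
    exact this.ae_eq (ae_of_all _ fun ω => by simp [div_eq_inv_mul])
  simp_rw [eucl_sq, e]
  refine ⟨integrable_finsetSum _ fun a _ => (hY a).integrable_sq, ?_⟩
  rw [integral_finsetSum _ fun a _ => (hY a).integrable_sq]
  have step : ∀ a, ∫ ω, ((IsSample.offDiag V n (fun l => centred ν φ χ a l) g ω
      + sampleSum V n (D a) ω) / n ^ 2) ^ 2 ∂μ ≤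
      2 / n ^ 4 * (2 * n ^ 2 * ∑ l, ∑ l', (∫ v, centred ν φ χ a l v * centred ν φ χ a l' v ∂ν) *
        ∫ v, g l v * g l' v ∂ν) + 2 / n ^ 4 * (2 * n * (∫ v, D a v ^ 2 ∂ν)
        + 2 * n ^ 2 * (∫ v, φ a v * ∑ l, χ l v * g l v ∂ν) ^ 2) := by
    intro a
    have j1 := (hU a).1.integrable_sq
    have j2 := (h.memLp_sampleSum (hD2 a) n).integrable_sq
    calc _ ≤ ∫ ω, (2 / (n : ℝ) ^ 4 * IsSample.offDiag V n (fun l => centred ν φ χ a l) g ω ^ 2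
          + 2 / (n : ℝ) ^ 4 * sampleSum V n (D a) ω ^ 2) ∂μ := by
          refine integral_mono (hY a).integrable_sq ((j1.const_mul _).add (j2.const_mul _))
            fun ω => ?_
          simp only
          rw [div_pow, ← pow_mul, ← mul_add, div_mul_eq_mul_div]
          gcongr
          nlinarith [sq_nonneg (IsSample.offDiag V n (fun l => centred ν φ χ a l) g ω
            - sampleSum V n (D a) ω)]
      _ = 2 / (n : ℝ) ^ 4 * ∫ ω, IsSample.offDiag V n (fun l => centred ν φ χ a l) g ω ^ 2 ∂μ
          + 2 / (n : ℝ) ^ 4 * ∫ ω, sampleSum V n (D a) ω ^ 2 ∂μ := by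
          rw [integral_add (j1.const_mul _) (j2.const_mul _), integral_const_mul,
            integral_const_mul]
      _ ≤ _ := by
          have := h.integral_sampleSum_sq_le (hDm a) (hD2 a) n
          rw [hD0] at this
          gcongr
          exact (hU a).2
  calc _ ≤ _ := Finset.sum_le_sum fun a _ => step a
    _ = 4 / n ^ 2 * (∑ a, ∑ l, ∑ l', (∫ v, centred ν φ χ a l v * centred ν φ χ a l' v ∂ν) *
        ∫ v, g l v * g l' v ∂ν) + 4 / n ^ 3 * (∑ a, ∫ v, D a v ^ 2 ∂ν)
        + 4 / n ^ 2 * ∑ a, (∫ v, φ a v * ∑ l, χ l v * g l v ∂ν) ^ 2 := by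
        rw [Finset.mul_sum, Finset.mul_sum, Finset.mul_sum, ← Finset.sum_add_distrib,
          ← Finset.sum_add_distrib]
        refine Finset.sum_congr rfl fun a _ => ?_
        field_simp
        ring
    _ ≤ 4 / n ^ 2 * (ζ ^ 2 * ∑ l, ∫ v, g l v ^ 2 ∂ν)
        + 4 / n ^ 3 * (2 * (ζ ^ 4 + 1) * ∑ l, ∫ v, g l v ^ 2 ∂ν)
        + 4 / n ^ 2 * ∑ a, (∫ v, φ a v * ∑ l, χ l v * g l v ∂ν) ^ 2 := by gcongr
    _ = _ := by ring

end

/-! ### Bernstein's inequality and a truncated maximal inequality. -/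

theorem exp_le_one_add_add_sq {x : ℝ} (hx : |x| ≤ 1) : Real.exp x ≤ 1 + x + x ^ 2 := by
  have := (abs_le.1 (Real.abs_exp_sub_one_sub_id_le hx)).2
  linarith

section Bernstein

variable {Ω 𝒱 : Type*} [MeasurableSpace Ω] [MeasurableSpace 𝒱] {μ : Measure Ω}
  [IsProbabilityMeasure μ] {ν : Measure 𝒱} [IsProbabilityMeasure ν] {V : ℕ → Ω → 𝒱}

/-- Since t·b ≤ 1, the exponential is at most 1 + x + x² on the range of t·f. Centring removes the
linear term, and 1 + y ≤ exp y does the rest. -/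
theorem integral_exp_mul_le {f : 𝒱 → ℝ} (hf : Measurable f) {b t : ℝ}
    (hb : ∀ᵐ v ∂ν, |f v| ≤ b) (h0 : ∫ v, f v ∂ν = 0) (ht : 0 ≤ t) (htb : t * b ≤ 1) :
    ∫ v, Real.exp (t * f v) ∂ν ≤ Real.exp (t ^ 2 * ∫ v, f v ^ 2 ∂ν) := by
  have hf2 : MemLp f 2 ν := MemLp.of_bound hf.aestronglyMeasurable b hb
  have i0 : Integrable (fun v => t * f v) ν := (hf2.integrable one_le_two).const_mul t
  have i1 : Integrable (fun v => 1 + t * f v + t ^ 2 * f v ^ 2) ν :=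
    ((integrable_const 1).add i0).add (hf2.integrable_sq.const_mul (t ^ 2))
  have hexp : ∀ᵐ v ∂ν, Real.exp (t * f v) ≤ 1 + t * f v + t ^ 2 * f v ^ 2 := by
    filter_upwards [hb] with v hv
    rw [← mul_pow]
    refine exp_le_one_add_add_sq ?_
    rw [abs_mul, abs_of_nonneg ht]
    exact (mul_le_mul_of_nonneg_left hv ht).trans htb
  calc ∫ v, Real.exp (t * f v) ∂ν ≤ ∫ v, (1 + t * f v + t ^ 2 * f v ^ 2) ∂ν :=
        integral_mono_of_nonneg (ae_of_all _ fun v => (Real.exp_pos _).le) i1 hexp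
    _ = 1 + t ^ 2 * ∫ v, f v ^ 2 ∂ν := by
        rw [integral_add (by fun_prop) (hf2.integrable_sq.const_mul (t ^ 2)),
          integral_add (integrable_const 1) i0, integral_const_mul, integral_const_mul, h0]
        simp
    _ ≤ _ := by rw [add_comm]; exact Real.add_one_le_exp _

/-- Bernstein's inequality, one-sided. -/
theorem IsSample.measure_sampleSum_ge_le (h : IsSample μ ν V) {f : 𝒱 → ℝ} (hf : Measurable f)
    {b t s : ℝ} (hb : ∀ᵐ v ∂ν, |f v| ≤ b) (h0 : ∫ v, f v ∂ν = 0) (ht : 0 ≤ t) (htb : t * b ≤ 1)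
    (hs : ∫ v, f v ^ 2 ∂ν ≤ s) (n : ℕ) (x : ℝ) :
    μ.real {ω | x ≤ sampleSum V n f ω} ≤ Real.exp (-t * x + n * (t ^ 2 * s)) := by
  have hind : iIndepFun (fun i ω => f (V i ω)) μ := h.indep.comp (fun _ => f) fun _ => hf
  have hm : ∀ i, Measurable fun ω => f (V i ω) := fun i => hf.comp (h.law i).measurable
  have hsum : (∑ i ∈ Finset.range n, fun ω => f (V i ω)) = sampleSum V n f := by
    ext ω; simp [sampleSum]
  have hmgf := hind.mgf_sum hm (t := t) (Finset.range n)
  rw [hsum] at hmgf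
  have h1 : ∀ i, mgf (fun ω => f (V i ω)) μ t ≤ Real.exp (t ^ 2 * s) := by
    intro i
    rw [mgf, h.integral_comp (f := fun v => Real.exp (t * f v)) (by fun_prop)]
    exact (integral_exp_mul_le hf hb h0 ht htb).trans (Real.exp_le_exp.2 (by gcongr))
  have hint : Integrable (fun ω => Real.exp (t * sampleSum V n f ω)) μ := by
    have hbω : ∀ᵐ ω ∂μ, ∀ i, |f (V i ω)| ≤ b :=
      ae_all_iff.2 fun i => (h.law i).quasiMeasurePreserving.ae hb
    refine Integrable.of_bound (C := Real.exp (t * (n * b))) ?_ ?_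
    · have : Measurable (sampleSum V n f) := by
        unfold sampleSum; exact Finset.measurable_fun_sum _ fun i _ => hm i
      fun_prop
    · filter_upwards [hbω] with ω hω
      rw [Real.norm_eq_abs, Real.abs_exp, Real.exp_le_exp]
      refine mul_le_mul_of_nonneg_left ?_ ht
      calc sampleSum V n f ω ≤ ∑ _i ∈ Finset.range n, b :=
            Finset.sum_le_sum fun i _ => (le_abs_self _).trans (hω i)
        _ = n * b := by simp
  calc _ ≤ Real.exp (-t * x) * mgf (sampleSum V n f) μ t := measure_ge_le_exp_mul_mgf x ht hint
    _ ≤ Real.exp (-t * x) * Real.exp (n * (t ^ 2 * s)) := by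
        gcongr
        rw [hmgf]
        calc _ ≤ ∏ _i ∈ Finset.range n, Real.exp (t ^ 2 * s) :=
              Finset.prod_le_prod (fun i _ => mgf_nonneg) fun i _ => h1 i
          _ = _ := by simp [← Real.exp_nat_mul]
    _ = _ := by rw [← Real.exp_add]

/-- Bernstein's inequality with a union bound. -/
theorem IsSample.measure_exists_sampleSum_le (h : IsSample μ ν V) {m : ℕ} {f : Fin m → 𝒱 → ℝ}
    (hf : ∀ j, Measurable (f j)) {b t s : ℝ} (hb : ∀ j, ∀ᵐ v ∂ν, |f j v| ≤ b)
    (h0 : ∀ j, ∫ v, f j v ∂ν = 0) (ht : 0 ≤ t) (htb : t * b ≤ 1)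
    (hs : ∀ j, ∫ v, f j v ^ 2 ∂ν ≤ s) (n : ℕ) (x : ℝ) :
    μ {ω | ∃ j, x ≤ |sampleSum V n (f j) ω|} ≤
      ENNReal.ofReal (2 * m * Real.exp (-t * x + n * (t ^ 2 * s))) := by
  set E := Real.exp (-t * x + n * (t ^ 2 * s))
  have h1 : ∀ j, μ {ω | x ≤ sampleSum V n (f j) ω} ≤ ENNReal.ofReal E := fun j => by
    rw [← ENNReal.ofReal_toReal (measure_ne_top μ _)]
    exact ENNReal.ofReal_le_ofReal
      (h.measure_sampleSum_ge_le (hf j) (hb j) (h0 j) ht htb (hs j) n x)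
  have h2 : ∀ j, μ {ω | x ≤ sampleSum V n (fun v => -f j v) ω} ≤ ENNReal.ofReal E := fun j => by
    rw [← ENNReal.ofReal_toReal (measure_ne_top μ _)]
    exact ENNReal.ofReal_le_ofReal
      (h.measure_sampleSum_ge_le (f := fun v => -f j v) (hf j).neg (by simpa using hb j)
        (by rw [integral_neg, h0, neg_zero]) ht htb (by simpa using hs j) n x)
  calc μ {ω | ∃ j, x ≤ |sampleSum V n (f j) ω|}
      ≤ μ (⋃ j, ({ω | x ≤ sampleSum V n (f j) ω} ∪ {ω | x ≤ sampleSum V n (fun v => -f j v) ω})) := by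
        refine measure_mono ?_
        rintro ω ⟨j, hj⟩
        refine Set.mem_iUnion.2 ⟨j, ?_⟩
        rcases le_abs.1 hj with h | h
        · exact Or.inl h
        · right
          simpa [sampleSum] using h
    _ ≤ ∑ j, μ ({ω | x ≤ sampleSum V n (f j) ω} ∪ {ω | x ≤ sampleSum V n (fun v => -f j v) ω}) :=
        measure_iUnion_fintype_le _ _
    _ ≤ ∑ _j : Fin m, (ENNReal.ofReal E + ENNReal.ofReal E) := Finset.sum_le_sum fun j _ =>
        (measure_union_le _ _).trans (add_le_add (h1 j) (h2 j))
    _ = _ := by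
        rw [← ENNReal.ofReal_add (Real.exp_pos _).le (Real.exp_pos _).le, Finset.sum_const,
          ← ENNReal.ofReal_nsmul]
        congr 1
        simp only [Finset.card_univ, Fintype.card_fin, nsmul_eq_mul]; ring

/-- Maximal inequality for sample means of `q_j u`, with bounded `q_j` and truncation of `u` at
the level `B`. -/
theorem IsSample.measure_norm_sampleMean_mul_gt_le (h : IsSample μ ν V) {m : ℕ}
    {q : Fin m → 𝒱 → ℝ} {u : 𝒱 → ℝ} (hq : ∀ j, Measurable (q j)) (hu : Measurable u)
    {A B δ κ t s η x : ℝ} (hA : 0 ≤ A) (hqA : ∀ j, ∀ᵐ v ∂ν, |q j v| ≤ A) (hB : 0 < B) (hδ : 0 < δ)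
    (hint : Integrable (fun v => |u v| ^ (2 + δ)) ν) (hκ : ∫ v, |u v| ^ (2 + δ) ∂ν ≤ κ)
    (hu2 : MemLp u 2 ν) (h0 : ∀ j, ∫ v, q j v * u v ∂ν = 0)
    (hs : ∀ j, ∫ v, (q j v * u v) ^ 2 ∂ν ≤ s) (ht : 0 ≤ t) (htb : t * (2 * A * B) ≤ 1)
    (hη : 0 < η) {n : ℕ} (hn : n ≠ 0) (hx : 0 ≤ x) :
    μ {ω | x + A * (κ / B ^ (1 + δ)) * (1 + 1 / η) <
        ‖fun j => sampleMean V n (fun v => q j v * u v) ω‖} ≤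
      ENNReal.ofReal (2 * m * Real.exp (-t * (n * x) + n * (t ^ 2 * s))) + ENNReal.ofReal η := by
  have hn' : (0 : ℝ) < n := by positivity
  set S : Set 𝒱 := {v | |u v| ≤ B} with hS
  have hSm : MeasurableSet S := measurableSet_le hu.abs measurable_const
  -- The tail of |u| beyond `B`. On it |u| ≤ |u|^(2+δ)/B^(1+δ), so its mean is at most `κ / B ^ (1 +
  -- δ)`.
  set T : 𝒱 → ℝ := Sᶜ.indicator fun v => |u v| with hT
  have hTm : Measurable T := hu.abs.indicator hSm.compl
  have hT0 : ∀ v, 0 ≤ T v := fun v => Set.indicator_nonneg (fun _ _ => abs_nonneg _) v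
  have hTle : ∀ v, T v ≤ |u v| ^ (2 + δ) / B ^ (1 + δ) := by
    intro v
    by_cases hv : v ∈ S
    · simp only [hT, Set.indicator_of_notMem (Set.notMem_compl_iff.2 hv)]; positivity
    · have hv' : B < |u v| := not_le.1 hv
      have hpos : 0 < |u v| := hB.trans hv'
      simp only [hT, Set.indicator_of_mem (Set.mem_compl hv)]
      rw [le_div_iff₀ (by positivity)]
      calc |u v| * B ^ (1 + δ) ≤ |u v| * |u v| ^ (1 + δ) := by gcongr
        _ = |u v| ^ (2 + δ) := by
            rw [← Real.rpow_one_add' hpos.le (by linarith)]; congr 1; ring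
  have hTi : Integrable T ν := (hint.div_const _).mono' hTm.aestronglyMeasurable
    (ae_of_all _ fun v => by rw [Real.norm_eq_abs, abs_of_nonneg (hT0 v)]; exact hTle v)
  set τ := κ / B ^ (1 + δ) with hτ
  have hTτ : ∫ v, T v ∂ν ≤ τ := by
    calc _ ≤ ∫ v, |u v| ^ (2 + δ) / B ^ (1 + δ) ∂ν := integral_mono hTi (hint.div_const _) hTle
      _ ≤ _ := by rw [integral_div, hτ]; exact div_le_div_of_nonneg_right hκ (by positivity)
  have hτ0 : 0 ≤ τ := (integral_nonneg hT0).trans hTτ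
  set f : Fin m → 𝒱 → ℝ := fun j => S.indicator fun v => q j v * u v with hf
  have hfm : ∀ j, Measurable (f j) := fun j => ((hq j).mul hu).indicator hSm
  have hfb : ∀ j, ∀ᵐ v ∂ν, |f j v| ≤ A * B := fun j => by
    filter_upwards [hqA j] with v hv
    by_cases hvS : v ∈ S
    · simp only [hf, Set.indicator_of_mem hvS, abs_mul]
      exact mul_le_mul hv hvS (abs_nonneg _) hA
    · simp only [hf, Set.indicator_of_notMem hvS, abs_zero]; positivity
  have hfL : ∀ j, MemLp (f j) 2 ν := fun j => MemLp.of_bound (hfm j).aestronglyMeasurable _ (hfb j)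
  have hqu2 : ∀ j, MemLp (fun v => q j v * u v) 2 ν := fun j => memLp_bdd_mul (hq j) (hqA j) hu2
  have hdiff : ∀ j, ∀ᵐ v ∂ν, |q j v * u v - f j v| ≤ A * T v := fun j => by
    filter_upwards [hqA j] with v hv
    by_cases hvS : v ∈ S
    · simp only [hf, Set.indicator_of_mem hvS, sub_self, abs_zero]
      exact mul_nonneg hA (hT0 v)
    · simp only [hf, hT, Set.indicator_of_notMem hvS, Set.indicator_of_mem (Set.mem_compl hvS),
        sub_zero, abs_mul]
      exact mul_le_mul_of_nonneg_right hv (abs_nonneg _)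
  -- Truncation destroys centring, but qⱼu has mean zero, so the mean of the truncated part is minus
  -- that of the tail and equally small.
  set c : Fin m → ℝ := fun j => ∫ v, f j v ∂ν with hc
  have hcle : ∀ j, |c j| ≤ A * τ := fun j => by
    have i1 := (hqu2 j).integrable one_le_two
    have i2 := (hfL j).integrable one_le_two
    have e : c j = -∫ v, (q j v * u v - f j v) ∂ν := by
      rw [integral_sub i1 i2, h0]; simp [hc]
    rw [e, abs_neg]
    calc _ ≤ ∫ v, |q j v * u v - f j v| ∂ν := abs_integral_le_integral_abs
      _ ≤ ∫ v, A * T v ∂ν := integral_mono_ae (i1.sub i2).abs (hTi.const_mul A) (hdiff j)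
      _ ≤ _ := by rw [integral_const_mul]; gcongr
  have hcb : ∀ j, |c j| ≤ A * B := fun j => by
    have := norm_integral_le_of_norm_le_const (μ := ν) (f := f j) (hfb j)
    simpa using this
  have hbern := h.measure_exists_sampleSum_le (f := fun j v => f j v - c j)
    (fun j => (hfm j).sub_const _) (b := 2 * A * B) (t := t) (s := s)
    (fun j => by
      filter_upwards [hfb j] with v hv
      calc |f j v - c j| ≤ |f j v| + |c j| := abs_sub _ _
        _ ≤ 2 * A * B := by linarith [hcb j])
    (fun j => by
      rw [integral_sub ((hfL j).integrable one_le_two) (integrable_const _)]; simp [hc])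
    ht htb
    (fun j => by
      refine (integral_sub_mean_sq_le (hfL j)).trans (le_trans ?_ (hs j))
      refine integral_mono (hfL j).integrable_sq (hqu2 j).integrable_sq fun v => ?_
      by_cases hvS : v ∈ S
      · simp only [hf, Set.indicator_of_mem hvS, le_refl]
      · simp only [hf, Set.indicator_of_notMem hvS]
        rw [zero_pow two_ne_zero]; positivity) n (n * x)
  have hmk : μ {ω | τ / η < sampleMean V n T ω} ≤ ENNReal.ofReal η := by
    have iT : Integrable (sampleMean V n T) μ := memLp_one_iff_integrable.1
      (h.memLp_sampleMean (memLp_one_iff_integrable.2 hTi) n)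
    have n0 : ∀ ω, 0 ≤ sampleMean V n T ω := fun ω =>
      div_nonneg (Finset.sum_nonneg fun _ _ => hT0 _) hn'.le
    have eT : ∫ ω, sampleMean V n T ω ∂μ ≤ τ := by
      simp only [sampleMean]
      rw [integral_div, h.integral_sampleSum hTm hTi, mul_div_cancel_left₀ _ hn'.ne']
      exact hTτ
    -- Markov's inequality at level τ/η ends with a division by τ; if τ = 0, the tail mean vanishes
    -- almost surely.
    rcases hτ0.eq_or_lt with hz | hpos
    · have hz' : ∫ ω, sampleMean V n T ω ∂μ = 0 :=
        le_antisymm (eT.trans hz.symm.le) (integral_nonneg n0)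
      have := (integral_eq_zero_iff_of_nonneg n0 iT).1 hz'
      have h3 : μ {ω | τ / η < sampleMean V n T ω} = 0 := by
        rw [← hz, zero_div]
        refine measure_mono_null (fun ω hω => ?_) (ae_iff.1 this)
        exact ne_of_gt hω
      rw [h3]; exact zero_le
    · have := mul_meas_ge_le_integral_of_nonneg (ae_of_all _ n0) iT (τ / η)
      rw [← ENNReal.ofReal_toReal (measure_ne_top μ _)]
      refine ENNReal.ofReal_le_ofReal ?_
      have h4 : μ.real {ω | τ / η < sampleMean V n T ω} ≤ μ.real {ω | τ / η ≤ sampleMean V n T ω} :=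
        measureReal_mono fun ω hω => by
          simp only [Set.mem_ofPred_eq] at hω ⊢; exact hω.le
      have h5 : τ / η * μ.real {ω | τ / η ≤ sampleMean V n T ω} ≤ τ := this.trans eT
      rw [div_mul_eq_mul_div, div_le_iff₀ hη] at h5
      exact h4.trans (le_of_mul_le_mul_left h5 hpos)
  have hall : ∀ᵐ ω ∂μ, ∀ i j, |q j (V i ω) * u (V i ω) - f j (V i ω)| ≤ A * T (V i ω) :=
    ae_all_iff.2 fun i => ae_all_iff.2 fun j => (h.law i).quasiMeasurePreserving.ae (hdiff j)
  refine le_trans ?_ (add_le_add hbern hmk)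
  refine le_trans (measure_mono_ae ?_) (measure_union_le _ _)
  filter_upwards [hall] with ω hω hgt
  by_contra hcon
  rw [show ({ω | ∃ j, n * x ≤ |sampleSum V n (fun v => f j v - c j) ω|} ∪
    {ω | τ / η < sampleMean V n T ω}) ω = (ω ∈ ({ω | ∃ j, n * x ≤ |sampleSum V n (fun v => f j v - c j) ω|} ∪
    {ω | τ / η < sampleMean V n T ω})) from rfl] at hcon
  simp only [Set.mem_union, Set.mem_ofPred_eq, not_or, not_exists, not_le, not_lt] at hcon
  obtain ⟨hc1, hc2⟩ := hcon
  refine absurd hgt (not_lt.2 ?_)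
  rw [pi_norm_le_iff_of_nonneg (by positivity)]
  intro j
  have k1 : |sampleMean V n (f j) ω - c j| ≤ x := by
    rw [sampleMean_sub_const hn, sampleMean, abs_div, abs_of_pos hn', div_le_iff₀ hn', mul_comm]
    exact (hc1 j).le
  have k2 : |sampleMean V n (fun v => q j v * u v) ω - sampleMean V n (f j) ω| ≤
      A * sampleMean V n T ω := by
    simp only [sampleMean, sampleSum]
    rw [← sub_div, ← Finset.sum_sub_distrib, abs_div, abs_of_pos hn', mul_div_assoc', Finset.mul_sum]
    gcongr
    exact (Finset.abs_sum_le_sum_abs _ _).trans (Finset.sum_le_sum fun i _ => hω i j)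
  have k3 : A * sampleMean V n T ω ≤ A * (τ / η) := by gcongr
  have e1 : sampleMean V n (fun v => q j v * u v) ω =
      (sampleMean V n (fun v => q j v * u v) ω - sampleMean V n (f j) ω)
        + (sampleMean V n (f j) ω - c j) + c j := by ring
  rw [Real.norm_eq_abs, e1]
  calc _ ≤ A * (τ / η) + x + A * τ := by
        refine (abs_add_three _ _ _).trans ?_
        linarith [hcle j]
    _ = _ := by ring

end Bernstein

/-! ### Deterministic linear algebra of two-stage least squares. -/

open Matrix

/-- If `Ŝ Δ - Ĝ p = a` and `Ŝ' p = β`, where `Ŝ` and `Ĝ` are close to `S` and `1` and `S` is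
bounded below by `s`, then `Δ` is controlled by `a` and `β`. -/
theorem saddle_stability {m k : ℕ} {S Sh : Matrix (Fin m) (Fin k) ℝ} {Gh : Matrix (Fin m) (Fin m) ℝ}
    {s : ℝ} (hs : 0 < s) (hS : ∀ c, s * eucl c ≤ eucl (S *ᵥ c))
    (hSh : ∀ c, eucl ((Sh - S) *ᵥ c) ≤ s / 2 * eucl c)
    (hGh : ∀ v, eucl ((Gh - 1) *ᵥ v) ≤ 1 / 2 * eucl v)
    {Δ : Fin k → ℝ} {p a : Fin m → ℝ} {β : Fin k → ℝ}
    (h1 : Sh *ᵥ Δ - Gh *ᵥ p = a) (h2 : Shᵀ *ᵥ p = β) :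
    eucl Δ ≤ 26 * (eucl a / s + eucl β / s ^ 2) := by
  have e1 : Gh *ᵥ p = p + (Gh - 1) *ᵥ p := by simp [Matrix.sub_mulVec]
  have e2 : S *ᵥ Δ = Sh *ᵥ Δ - (Sh - S) *ᵥ Δ := by simp [Matrix.sub_mulVec]
  have hlow : s / 2 * eucl Δ ≤ eucl (Sh *ᵥ Δ) := by
    have := eucl_sub_le (Sh *ᵥ Δ) ((Sh - S) *ᵥ Δ)
    rw [← e2] at this
    linarith [hS Δ, hSh Δ]
  have hup : eucl (Sh *ᵥ Δ) ≤ eucl a + 3 / 2 * eucl p := by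
    have : Sh *ᵥ Δ = a + Gh *ᵥ p := by rw [← h1]; simp
    rw [this]
    have k1 := eucl_add_le a (Gh *ᵥ p)
    have k2 := eucl_add_le p ((Gh - 1) *ᵥ p)
    rw [← e1] at k2
    linarith [hGh p]
  -- Energy estimate: pair the first equation with p and use the second to replace Ŝ'p by β; Ĝ has
  -- coercivity constant 1/2.
  have hen : 1 / 2 * eucl p ^ 2 ≤ eucl Δ * eucl β + eucl a * eucl p := by
    have k1 : p ⬝ᵥ (Gh *ᵥ p) = Δ ⬝ᵥ β - p ⬝ᵥ a := by
      rw [← h1, ← h2, dotProduct_sub, Matrix.mulVec_transpose, dotProduct_comm Δ,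
        ← Matrix.dotProduct_mulVec]
      ring
    have k2 : p ⬝ᵥ (Gh *ᵥ p) = eucl p ^ 2 + p ⬝ᵥ ((Gh - 1) *ᵥ p) := by
      rw [e1, dotProduct_add, eucl_sq_dot]
    have k3 := abs_le.1 (abs_dotProduct_le p ((Gh - 1) *ᵥ p))
    have k4 := mul_le_mul_of_nonneg_left (hGh p) (eucl_nonneg p)
    have k5 := abs_le.1 (abs_dotProduct_le Δ β)
    have k6 := abs_le.1 (abs_dotProduct_le p a)
    nlinarith
  set x := eucl p
  set A := eucl a
  set B := eucl β / s with hB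
  have hx0 : 0 ≤ x := eucl_nonneg p
  have hA0 : 0 ≤ A := eucl_nonneg a
  have hB0 : 0 ≤ B := div_nonneg (eucl_nonneg β) hs.le
  have hβ : eucl β = B * s := by rw [hB]; field_simp
  have hsD : s * eucl Δ ≤ 2 * A + 3 * x := by linarith
  have hq : x ^ 2 ≤ 2 * (2 * A + 3 * x) * B + 2 * A * x := by
    have : eucl Δ * eucl β = s * eucl Δ * B := by rw [hβ]; ring
    rw [this] at hen
    nlinarith
  -- Solve the quadratic inequality for x = |p|. Substituted into s|Δ| ≤ 2A + 3x this gives 2 + 3·8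
  -- = 26.
  have hx : x ≤ 8 * (A + B) := by
    by_contra hcon
    push Not at hcon
    nlinarith [mul_nonneg hA0 hB0, mul_nonneg hx0 hA0, mul_nonneg hx0 hB0]
  have e3 : 26 * (A / s + eucl β / s ^ 2) = 26 * (A + B) / s := by
    rw [hβ]; field_simp
  rw [e3, le_div_iff₀ hs]
  linarith

open scoped MatrixOrder in
-- Any factorisation G⁻¹ = R'R will do, since only the two identities are ever used; a symmetric
-- square root is not needed. The first identity is R'(RG) = 1 with its factors commuted.
theorem exists_whitening {m : ℕ} {G : Matrix (Fin m) (Fin m) ℝ} (hG : G.PosDef) :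
    ∃ R : Matrix (Fin m) (Fin m) ℝ, IsUnit R.det ∧ R * G * Rᵀ = 1 ∧ G⁻¹ = Rᵀ * R := by
  obtain ⟨R, hR⟩ := (CStarAlgebra.nonneg_iff_eq_star_mul_self (a := G⁻¹)).1 hG.inv.posSemidef.nonneg
  have hR' : G⁻¹ = Rᵀ * R := by simpa [Matrix.star_eq_conjTranspose] using hR
  have hGu : IsUnit G.det := (Matrix.isUnit_iff_isUnit_det _).1 hG.isUnit
  have hRu : IsUnit R.det := by
    have : IsUnit (Rᵀ * R).det := by rw [← hR']; exact (Matrix.isUnit_nonsing_inv_det_iff).2 hGu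
    rw [Matrix.det_mul] at this
    exact isUnit_of_mul_isUnit_right this
  refine ⟨R, hRu, ?_, hR'⟩
  have h1 : Rᵀ * R * G = 1 := by rw [← hR']; exact Matrix.nonsing_inv_mul _ hGu
  rw [Matrix.mul_assoc] at h1
  exact mul_eq_one_comm.1 h1

/-- For `S` bounded below by `s`, the matrix `(S'S)⁻¹S'` and its properties. -/
theorem leftInverse_props {m k : ℕ} {S : Matrix (Fin m) (Fin k) ℝ}
    {s : ℝ} (hs : 0 < s) (hS : ∀ c, s * eucl c ≤ eucl (S *ᵥ c)) :
    IsUnit (Sᵀ * S).det ∧ Sᵀ * (S * ((Sᵀ * S)⁻¹ * Sᵀ) - 1) = 0 ∧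
    (∀ v, eucl ((S * ((Sᵀ * S)⁻¹ * Sᵀ) - 1) *ᵥ v) ≤ eucl v) ∧
    ∀ v, eucl (((Sᵀ * S)⁻¹ * Sᵀ) *ᵥ v) ≤ eucl v / s := by
  have hu : IsUnit (Sᵀ * S) := by
    rw [← Matrix.mulVec_injective_iff_isUnit]
    refine (injective_iff_map_eq_zero (Matrix.mulVecLin (Sᵀ * S))).2 fun c hc => ?_
    have h1 : (Sᵀ * S) *ᵥ c = 0 := hc
    have h2 : eucl (S *ᵥ c) ^ 2 = 0 := by
      rw [eucl_sq_dot, dotProduct_mulVec, ← Matrix.mulVec_transpose, Matrix.mulVec_mulVec, h1,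
        zero_dotProduct]
    have h3 : eucl (S *ᵥ c) = 0 := pow_eq_zero_iff two_ne_zero |>.1 h2
    have h4 : eucl c = 0 := by
      have := hS c
      rw [h3] at this
      nlinarith [eucl_nonneg c]
    exact eucl_eq_zero.1 h4
  have hud := (Matrix.isUnit_iff_isUnit_det _).1 hu
  have h0 : Sᵀ * (S * ((Sᵀ * S)⁻¹ * Sᵀ) - 1) = 0 := by
    rw [Matrix.mul_sub, ← Matrix.mul_assoc, ← Matrix.mul_assoc, Matrix.mul_nonsing_inv _ hud]
    simp
  set N := (Sᵀ * S)⁻¹ * Sᵀ with hN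
  have horth : ∀ v, (S *ᵥ (N *ᵥ v)) ⬝ᵥ ((S * N - 1) *ᵥ v) = 0 := fun v => by
    rw [dotProduct_comm, dotProduct_mulVec, ← Matrix.mulVec_transpose, Matrix.mulVec_mulVec, h0]
    simp
  -- SN is the orthogonal projection onto the range of S; both remaining claims are Pythagoras for
  -- it.
  have hpyth : ∀ v, eucl v ^ 2 = eucl (S *ᵥ (N *ᵥ v)) ^ 2 + eucl ((S * N - 1) *ᵥ v) ^ 2 := fun v => by
    have e : v = S *ᵥ (N *ᵥ v) - (S * N - 1) *ᵥ v := by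
      simp [Matrix.sub_mulVec]
    conv_lhs => rw [e]
    have h2 : ((S * N - 1) *ᵥ v) ⬝ᵥ (S *ᵥ (N *ᵥ v)) = 0 := by rw [dotProduct_comm, horth]
    rw [eucl_sq_dot, eucl_sq_dot, eucl_sq_dot, dotProduct_sub, sub_dotProduct, sub_dotProduct,
      horth, h2]
    ring
  refine ⟨hud, h0, fun v => ?_, fun v => ?_⟩
  · refine (pow_le_pow_iff_left₀ (eucl_nonneg _) (eucl_nonneg _) two_ne_zero).1 ?_
    rw [hpyth v]; nlinarith [sq_nonneg (eucl (S *ᵥ (N *ᵥ v)))]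
  · rw [le_div_iff₀ hs, mul_comm]
    refine (hS _).trans ((pow_le_pow_iff_left₀ (eucl_nonneg _) (eucl_nonneg _) two_ne_zero).1 ?_)
    rw [hpyth v]; nlinarith [sq_nonneg (eucl ((S * N - 1) *ᵥ v))]

theorem eucl_transpose_mulVec_le {m k : ℕ} {N : Matrix (Fin k) (Fin m) ℝ} {C : ℝ}
    (hC : 0 ≤ C) (hN : ∀ v, eucl (N *ᵥ v) ≤ C * eucl v) (w : Fin k → ℝ) : eucl (Nᵀ *ᵥ w) ≤ C * eucl w := by
  have h1 : eucl (Nᵀ *ᵥ w) ^ 2 ≤ eucl w * (C * eucl (Nᵀ *ᵥ w)) := by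
    have : eucl (Nᵀ *ᵥ w) ^ 2 = w ⬝ᵥ (N *ᵥ (Nᵀ *ᵥ w)) := by
      rw [eucl_sq_dot, dotProduct_mulVec w, ← Matrix.mulVec_transpose N w]
    rw [this]
    exact (le_abs_self _).trans ((abs_dotProduct_le _ _).trans
      (mul_le_mul_of_nonneg_left (hN _) (eucl_nonneg _)))
  rcases (eucl_nonneg (Nᵀ *ᵥ w)).eq_or_lt with h | h
  · rw [← h]; exact mul_nonneg hC (eucl_nonneg w)
  · nlinarith

theorem IsGenInverse.eq_inv {ginv : ∀ m : ℕ, Matrix (Fin m) (Fin m) ℝ → Matrix (Fin m) (Fin m) ℝ}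
    (hg : IsGenInverse ginv) {m : ℕ} {A : Matrix (Fin m) (Fin m) ℝ} (hA : IsUnit A.det) :
    ginv m A = A⁻¹ := by
  have h := hg m A
  have h1 : A⁻¹ * (A * ginv m A * A) * A⁻¹ = A⁻¹ * A * A⁻¹ := by rw [h]
  rw [Matrix.nonsing_inv_mul _ hA, Matrix.one_mul, Matrix.mul_assoc, Matrix.mul_assoc,
    Matrix.mul_nonsing_inv _ hA, Matrix.mul_one, ← Matrix.mul_assoc, Matrix.nonsing_inv_mul _ hA,
    Matrix.one_mul] at h1
  exact h1

theorem lambdaMin_pos {m : ℕ} (hm : m ≠ 0) {G : Matrix (Fin m) (Fin m) ℝ} (hG : G.PosDef) :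
    0 < lambdaMin G := by
  have hne : (spectrum ℝ G).Nonempty :=
    ⟨_, hG.isHermitian.eigenvalues_mem_spectrum_real ⟨0, Nat.pos_of_ne_zero hm⟩⟩
  have hmem : lambdaMin G ∈ spectrum ℝ G := hne.csInf_mem (Matrix.finite_real_spectrum (A := G))
  rw [hG.isHermitian.spectrum_real_eq_range_eigenvalues] at hmem
  obtain ⟨i, hi⟩ := hmem
  rw [← hi]
  exact hG.eigenvalues_pos i

open scoped MatrixOrder Pointwise in
theorem lambdaMin_mul_le {m : ℕ} {G : Matrix (Fin m) (Fin m) ℝ} (hG : G.PosDef)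
    (z : Fin m → ℝ) : lambdaMin G * (z ⬝ᵥ z) ≤ z ⬝ᵥ (G *ᵥ z) := by
  have hpsd : (G - algebraMap ℝ (Matrix (Fin m) (Fin m) ℝ) (lambdaMin G)).PosSemidef := by
    rw [Matrix.posSemidef_iff_isHermitian_and_spectrum_nonneg]
    refine ⟨hG.isHermitian.sub ?_, ?_⟩
    · rw [Matrix.algebraMap_eq_diagonal]
      exact Matrix.isHermitian_diagonal _
    · rw [← spectrum.sub_singleton_eq]
      rintro x ⟨y, hy, r, hr, rfl⟩
      rw [Set.mem_singleton_iff] at hr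
      subst hr
      exact sub_nonneg.2 (csInf_le (Matrix.finite_real_spectrum (A := G)).bddBelow hy)
  have := hpsd.dotProduct_mulVec_nonneg z
  simp only [star_trivial, Matrix.sub_mulVec, dotProduct_sub, Algebra.algebraMap_eq_smul_one,
    Matrix.smul_mulVec, Matrix.one_mulVec, dotProduct_smul, smul_eq_mul] at this
  linarith

/-- A whitening matrix shrinks by at least the factor `λ_min^{-1/2}`. -/
theorem eucl_whitening_le {m : ℕ} (hm : m ≠ 0) {G R : Matrix (Fin m) (Fin m) ℝ} (hG : G.PosDef)
    (hR : R * G * Rᵀ = 1) (v : Fin m → ℝ) :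
    eucl (R *ᵥ v) ≤ (Real.sqrt (lambdaMin G))⁻¹ * eucl v := by
  have he := lambdaMin_pos hm hG
  have hs := Real.sqrt_pos.2 he
  have h1 : ∀ y, eucl (Rᵀ *ᵥ y) ≤ (Real.sqrt (lambdaMin G))⁻¹ * eucl y := fun y => by
    have k := lambdaMin_mul_le hG (Rᵀ *ᵥ y)
    have e : (Rᵀ *ᵥ y) ⬝ᵥ (G *ᵥ (Rᵀ *ᵥ y)) = y ⬝ᵥ y := by
      rw [Matrix.mulVec_transpose, ← Matrix.dotProduct_mulVec, ← Matrix.mulVec_transpose,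
        Matrix.mulVec_mulVec, Matrix.mulVec_mulVec, hR, Matrix.one_mulVec]
    rw [e, ← eucl_sq_dot, ← eucl_sq_dot] at k
    rw [← div_eq_inv_mul, le_div_iff₀ hs]
    refine (pow_le_pow_iff_left₀ (by have := eucl_nonneg (Rᵀ *ᵥ y); positivity)
      (eucl_nonneg _) two_ne_zero).1 ?_
    rw [mul_pow, Real.sq_sqrt he.le]
    linarith
  have := eucl_transpose_mulVec_le (inv_nonneg.2 hs.le) h1 v
  simpa using this

/-- The normal equations of two-stage least squares in whitened coordinates: with `Ĝ` coercive and
`Ŝ` injective, the coefficients `γ` of the estimator solve a saddle point system. -/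
theorem tsls_normal_equations
    {ginv : ∀ m : ℕ, Matrix (Fin m) (Fin m) ℝ → Matrix (Fin m) (Fin m) ℝ}
    (hg : IsGenInverse ginv) {n J K : ℕ} {P : Matrix (Fin n) (Fin J) ℝ}
    {B : Matrix (Fin n) (Fin K) ℝ} {Rb : Matrix (Fin K) (Fin K) ℝ} {Rp : Matrix (Fin J) (Fin J) ℝ}
    (hRb : IsUnit Rb.det) (hRp : IsUnit Rp.det) {Sh : Matrix (Fin K) (Fin J) ℝ}
    {Gh : Matrix (Fin K) (Fin K) ℝ} (hSh : Sh = (n : ℝ)⁻¹ • (Rb * Bᵀ * P * Rpᵀ))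
    (hGh : Gh = (n : ℝ)⁻¹ • (Rb * Bᵀ * B * Rbᵀ))
    (hco : ∀ v, 1 / 2 * eucl v ^ 2 ≤ v ⬝ᵥ (Gh *ᵥ v)) (hinj : ∀ c, Sh *ᵥ c = 0 → c = 0)
    (Y : Fin n → ℝ) :
    ∃ (c : Fin J → ℝ) (q : Fin K → ℝ),
      ginv J (Pᵀ * B * ginv K (Bᵀ * B) * Bᵀ * P) *ᵥ ((Pᵀ * B * ginv K (Bᵀ * B) * Bᵀ) *ᵥ Y)
        = Rpᵀ *ᵥ c ∧
      Sh *ᵥ c - Gh *ᵥ q = (n : ℝ)⁻¹ • (Rb *ᵥ (Bᵀ *ᵥ Y)) ∧ Shᵀ *ᵥ q = 0 := by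
  have hRbT : IsUnit Rbᵀ.det := by rwa [Matrix.det_transpose]
  have hRpT : IsUnit Rpᵀ.det := by rwa [Matrix.det_transpose]
  have hGu : IsUnit Gh.det := by
    rw [← Matrix.isUnit_iff_isUnit_det, ← Matrix.mulVec_injective_iff_isUnit]
    refine (injective_iff_map_eq_zero (Matrix.mulVecLin Gh)).2 fun v hv => ?_
    have h1 : Gh *ᵥ v = 0 := hv
    have h2 := hco v
    rw [h1, dotProduct_zero] at h2
    have h3 : eucl v ^ 2 = 0 := le_antisymm (by linarith) (sq_nonneg _)
    exact eucl_eq_zero.1 (pow_eq_zero_iff two_ne_zero |>.1 h3)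
  have hBB : IsUnit (Bᵀ * B).det := by
    have h1 : Gh.det = ((n : ℝ)⁻¹) ^ K * (Rb.det * (Bᵀ * B).det * Rbᵀ.det) := by
      rw [hGh, Matrix.det_smul, Fintype.card_fin, Matrix.mul_assoc Rb, Matrix.det_mul,
        Matrix.det_mul]
    rw [h1] at hGu
    exact isUnit_of_mul_isUnit_right (isUnit_of_mul_isUnit_left (isUnit_of_mul_isUnit_right hGu))
  rw [hg.eq_inv hBB]
  set D := (Bᵀ * B)⁻¹ with hD
  set A := Pᵀ * B * D * Bᵀ with hA
  -- the dual vector attached to a residual `e`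
  have hq : ∀ e : Fin n → ℝ,
      Gh *ᵥ (Rbᵀ⁻¹ *ᵥ (D *ᵥ (Bᵀ *ᵥ e))) = (n : ℝ)⁻¹ • (Rb *ᵥ (Bᵀ *ᵥ e)) ∧
      Shᵀ *ᵥ (Rbᵀ⁻¹ *ᵥ (D *ᵥ (Bᵀ *ᵥ e))) = (n : ℝ)⁻¹ • (Rp *ᵥ (A *ᵥ e)) := by
    intro e
    constructor
    · rw [hGh]
      simp only [Matrix.smul_mul, Matrix.smul_mulVec, Matrix.mulVec_mulVec]
      congr 2
      calc Rb * Bᵀ * B * Rbᵀ * (Rbᵀ⁻¹ * (D * Bᵀ)) = Rb * Bᵀ * B * (Rbᵀ * Rbᵀ⁻¹) * D * Bᵀ := by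
            simp only [Matrix.mul_assoc]
        _ = Rb * ((Bᵀ * B) * D) * Bᵀ := by
            rw [Matrix.mul_nonsing_inv _ hRbT]; simp only [Matrix.mul_assoc, Matrix.one_mul]
        _ = Rb * Bᵀ := by rw [hD, Matrix.mul_nonsing_inv _ hBB, Matrix.mul_one]
    · rw [hSh, hA]
      simp only [Matrix.transpose_smul, Matrix.smul_mul, Matrix.smul_mulVec, Matrix.mulVec_mulVec,
        Matrix.transpose_mul, Matrix.transpose_transpose]
      congr 2
      calc Rp * (Pᵀ * (B * Rbᵀ)) * (Rbᵀ⁻¹ * (D * Bᵀ)) = Rp * (Pᵀ * (B * (Rbᵀ * Rbᵀ⁻¹))) * D * Bᵀ := by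
            simp only [Matrix.mul_assoc]
        _ = _ := by
            rw [Matrix.mul_nonsing_inv _ hRbT]; simp only [Matrix.mul_assoc, Matrix.mul_one]
  have hPx : ∀ c, Sh *ᵥ c = (n : ℝ)⁻¹ • (Rb *ᵥ (Bᵀ *ᵥ (P *ᵥ (Rpᵀ *ᵥ c)))) := fun c => by
    rw [hSh]; simp only [Matrix.smul_mulVec, Matrix.mulVec_mulVec, Matrix.mul_assoc]
  have hsurj : ∀ x, ∃ c, x = Rpᵀ *ᵥ c := fun x =>
    ⟨Rpᵀ⁻¹ *ᵥ x, by rw [Matrix.mulVec_mulVec, Matrix.mul_nonsing_inv _ hRpT, Matrix.one_mulVec]⟩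
  -- If APx = 0, the dual vector q of the residual Px satisfies Ŝ'q = 0 and Ĝq = Ŝc. Coercivity then
  -- forces q = 0, hence Ŝc = 0 and c = 0. So both generalised inverses are true inverses here.
  have hAP : IsUnit (A * P).det := by
    rw [← Matrix.isUnit_iff_isUnit_det, ← Matrix.mulVec_injective_iff_isUnit]
    refine (injective_iff_map_eq_zero (Matrix.mulVecLin (A * P))).2 fun x hx => ?_
    have hx' : A *ᵥ (P *ᵥ x) = 0 := by rw [Matrix.mulVec_mulVec]; exact hx
    obtain ⟨c, rfl⟩ := hsurj x
    obtain ⟨h1, h2⟩ := hq (P *ᵥ (Rpᵀ *ᵥ c))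
    rw [hx', Matrix.mulVec_zero, smul_zero] at h2
    rw [← hPx] at h1
    set q := Rbᵀ⁻¹ *ᵥ (D *ᵥ (Bᵀ *ᵥ (P *ᵥ (Rpᵀ *ᵥ c))))
    have h3 := hco q
    rw [h1, dotProduct_mulVec, ← Matrix.mulVec_transpose, h2, zero_dotProduct] at h3
    have h4 : eucl q ^ 2 = 0 := le_antisymm (by linarith) (sq_nonneg _)
    have h5 : q = 0 := eucl_eq_zero.1 (pow_eq_zero_iff two_ne_zero |>.1 h4)
    rw [h5, Matrix.mulVec_zero] at h1
    rw [hinj c h1.symm, Matrix.mulVec_zero]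
  rw [hg.eq_inv hAP]
  set γ := (A * P)⁻¹ *ᵥ (A *ᵥ Y) with hγ
  have hγ' : A *ᵥ (P *ᵥ γ - Y) = 0 := by
    rw [Matrix.mulVec_sub, Matrix.mulVec_mulVec, hγ, Matrix.mulVec_mulVec,
      Matrix.mul_nonsing_inv _ hAP, Matrix.one_mulVec, sub_self]
  obtain ⟨c, hc⟩ := hsurj γ
  obtain ⟨h1, h2⟩ := hq (P *ᵥ γ - Y)
  refine ⟨c, Rbᵀ⁻¹ *ᵥ (D *ᵥ (Bᵀ *ᵥ (P *ᵥ γ - Y))), hc, ?_, ?_⟩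
  · rw [h1, hPx, ← hc, Matrix.mulVec_sub, Matrix.mulVec_sub, smul_sub, sub_sub_cancel]
  · rw [h2, hγ', Matrix.mulVec_zero, smul_zero]

open Matrix

/-- Deterministic bound for the estimation error of two-stage least squares. -/
theorem tsls_error_le {m k : ℕ} {S Sh : Matrix (Fin m) (Fin k) ℝ} {Gh : Matrix (Fin m) (Fin m) ℝ}
    {s : ℝ} (hs : 0 < s) (hS : ∀ c, s * eucl c ≤ eucl (S *ᵥ c))
    (hSh : ∀ c, eucl ((Sh - S) *ᵥ c) ≤ s / 2 * eucl c)
    (hGh : ∀ v, eucl ((Gh - 1) *ᵥ v) ≤ 1 / 2 * eucl v)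
    {d : Fin k → ℝ} {q ρ ρh ν : Fin m → ℝ} (h1 : Sh *ᵥ d - Gh *ᵥ q = ρh + ν)
    (h2 : Shᵀ *ᵥ q = 0) {N : Matrix (Fin k) (Fin m) ℝ} {N' : Matrix (Fin m) (Fin m) ℝ}
    (hN' : N' = S * N - 1) (hN0 : Sᵀ * N' = 0) :
    eucl (d - N *ᵥ (ν + ρ)) ≤ 26 * ((eucl (ρh - ρ) + eucl ((Sh - S) *ᵥ (N *ᵥ ρ))
      + eucl ((Sh - S) *ᵥ (N *ᵥ ν)) + eucl ((Gh - 1) *ᵥ (N' *ᵥ ρ))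
      + eucl ((Gh - 1) *ᵥ (N' *ᵥ ν))) / s
      + (eucl ((Shᵀ - Sᵀ) *ᵥ (N' *ᵥ ρ)) + eucl ((Shᵀ - Sᵀ) *ᵥ (N' *ᵥ ν))) / s ^ 2) := by
  -- For v = ν + ρ the pair (Nv, N'v) solves the population system SΔ − p = v, S'p = 0. Subtracting
  -- it leaves a perturbed saddle point system whose data contain only matrix fluctuations and ρ̂ −
  -- ρ.
  have e1 : Sh *ᵥ (d - N *ᵥ (ν + ρ)) - Gh *ᵥ (q - N' *ᵥ (ν + ρ)) =
      (ρh - ρ) - ((Sh - S) *ᵥ (N *ᵥ ρ)) - ((Sh - S) *ᵥ (N *ᵥ ν)) + ((Gh - 1) *ᵥ (N' *ᵥ ρ))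
        + ((Gh - 1) *ᵥ (N' *ᵥ ν)) := by
    have k1 : N' *ᵥ (ν + ρ) = S *ᵥ (N *ᵥ (ν + ρ)) - (ν + ρ) := by
      rw [hN', Matrix.sub_mulVec, Matrix.mulVec_mulVec, Matrix.one_mulVec]
    have k2 : Sh *ᵥ (d - N *ᵥ (ν + ρ)) - Gh *ᵥ (q - N' *ᵥ (ν + ρ)) =
        (ρh + ν) - Sh *ᵥ (N *ᵥ (ν + ρ)) + Gh *ᵥ (N' *ᵥ (ν + ρ)) := by
      rw [← h1, Matrix.mulVec_sub, Matrix.mulVec_sub]; abel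
    have k3 : ((Sh - S) *ᵥ (N *ᵥ ρ)) + ((Sh - S) *ᵥ (N *ᵥ ν)) =
        Sh *ᵥ (N *ᵥ (ν + ρ)) - S *ᵥ (N *ᵥ (ν + ρ)) := by
      simp only [Matrix.sub_mulVec, Matrix.mulVec_add]; abel
    have k4 : ((Gh - 1) *ᵥ (N' *ᵥ ρ)) + ((Gh - 1) *ᵥ (N' *ᵥ ν)) =
        Gh *ᵥ (N' *ᵥ (ν + ρ)) - N' *ᵥ (ν + ρ) := by
      simp only [Matrix.sub_mulVec, Matrix.mulVec_add, Matrix.one_mulVec]; abel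
    rw [k2, sub_sub, k3, add_assoc _ _ ((Gh - 1) *ᵥ (N' *ᵥ ν)), k4, k1]
    abel
  have e2 : Shᵀ *ᵥ (q - N' *ᵥ (ν + ρ)) =
      -(((Shᵀ - Sᵀ) *ᵥ (N' *ᵥ ρ)) + ((Shᵀ - Sᵀ) *ᵥ (N' *ᵥ ν))) := by
    have k : ∀ x, Sᵀ *ᵥ (N' *ᵥ x) = 0 := fun x => by
      rw [Matrix.mulVec_mulVec, hN0, Matrix.zero_mulVec]
    rw [Matrix.mulVec_sub, h2]
    simp only [Matrix.sub_mulVec, Matrix.mulVec_add, k]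
    abel
  have key := saddle_stability hs hS hSh hGh e1 e2
  refine key.trans ?_
  rw [eucl_neg]
  have b1 := eucl_add_le ((ρh - ρ) - ((Sh - S) *ᵥ (N *ᵥ ρ)) - ((Sh - S) *ᵥ (N *ᵥ ν))
    + ((Gh - 1) *ᵥ (N' *ᵥ ρ))) ((Gh - 1) *ᵥ (N' *ᵥ ν))
  have b2 := eucl_add_le ((ρh - ρ) - ((Sh - S) *ᵥ (N *ᵥ ρ)) - ((Sh - S) *ᵥ (N *ᵥ ν)))
    ((Gh - 1) *ᵥ (N' *ᵥ ρ))
  have b3 := eucl_sub_le ((ρh - ρ) - ((Sh - S) *ᵥ (N *ᵥ ρ))) ((Sh - S) *ᵥ (N *ᵥ ν))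
  have b4 := eucl_sub_le (ρh - ρ) ((Sh - S) *ᵥ (N *ᵥ ρ))
  have b5 := eucl_add_le ((Shᵀ - Sᵀ) *ᵥ (N' *ᵥ ρ)) ((Shᵀ - Sᵀ) *ᵥ (N' *ᵥ ν))
  gcongr
  linarith

/-! ### Calculus of orders in probability. -/

namespace IsBigOInProb

variable {Ω : Type*} [MeasurableSpace Ω] {μ : Measure Ω} {Z Z' : ℕ → Ω → ℝ} {r r' : ℕ → ℝ}

theorem add (h : IsBigOInProb μ Z r) (h' : IsBigOInProb μ Z' r) :
    IsBigOInProb μ (fun n ω => Z n ω + Z' n ω) r := by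
  intro ε hε
  obtain ⟨C, hC, h1⟩ := h (ε / 2) (half_pos hε)
  obtain ⟨C', hC', h2⟩ := h' (ε / 2) (half_pos hε)
  refine ⟨C + C', add_pos hC hC', ?_⟩
  filter_upwards [h1, h2] with n hn1 hn2
  calc _ ≤ μ ({ω | C * r n < |Z n ω|} ∪ {ω | C' * r n < |Z' n ω|}) := by
        refine measure_mono fun ω hω => ?_
        by_contra hcon
        simp only [Set.mem_union, Set.mem_ofPred_eq, not_or, not_lt] at hcon hω
        linarith [abs_add_le (Z n ω) (Z' n ω), add_mul C C' (r n)]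
    _ ≤ ENNReal.ofReal (ε / 2) + ENNReal.ofReal (ε / 2) :=
        (measure_union_le _ _).trans (add_le_add hn1 hn2)
    _ = ENNReal.ofReal ε := by
        rw [← ENNReal.ofReal_add (by positivity) (by positivity), add_halves]

theorem of_rate_le (h : IsBigOInProb μ Z r) {c : ℝ} (hc : 0 < c)
    (hr : ∀ᶠ n in atTop, r n ≤ c * r' n) : IsBigOInProb μ Z r' := by
  intro ε hε
  obtain ⟨C, hC, h1⟩ := h ε hε
  refine ⟨C * c, mul_pos hC hc, ?_⟩
  filter_upwards [h1, hr] with n hn1 hn2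
  refine le_trans (measure_mono fun ω hω => ?_) hn1
  simp only [Set.mem_ofPred_eq] at hω ⊢
  calc C * r n ≤ C * (c * r' n) := by gcongr
    _ < _ := by rwa [← mul_assoc]

theorem const_mul (h : IsBigOInProb μ Z r) {a : ℕ → ℝ} (ha : ∀ᶠ n in atTop, 0 ≤ a n) :
    IsBigOInProb μ (fun n ω => a n * Z n ω) fun n => a n * r n := by
  intro ε hε
  obtain ⟨C, hC, h1⟩ := h ε hε
  refine ⟨C, hC, ?_⟩
  filter_upwards [h1, ha] with n hn1 han
  refine le_trans (measure_mono fun ω hω => ?_) hn1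
  simp only [Set.mem_ofPred_eq, abs_mul, abs_of_nonneg han] at hω ⊢
  by_contra hcon
  push Not at hcon
  have := mul_le_mul_of_nonneg_left hcon han
  linarith

/-- Domination outside events of vanishing probability. -/
theorem of_le (h : IsBigOInProb μ Z r) {B : ℕ → Set Ω}
    (hB : Tendsto (fun n => μ (B n)) atTop (nhds 0))
    (hZ : ∀ᶠ n in atTop, ∀ᵐ ω ∂μ, ω ∉ B n → |Z' n ω| ≤ |Z n ω|) : IsBigOInProb μ Z' r := by
  intro ε hε
  obtain ⟨C, hC, h1⟩ := h (ε / 2) (half_pos hε)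
  refine ⟨C, hC, ?_⟩
  have hB' : ∀ᶠ n in atTop, μ (B n) ≤ ENNReal.ofReal (ε / 2) :=
    (hB.eventually_lt_const (by simpa using hε)).mono fun n hn => hn.le
  filter_upwards [h1, hB', hZ] with n hn1 hn2 hn3
  calc _ ≤ μ ({ω | C * r n < |Z n ω|} ∪ B n) := by
        refine measure_mono_ae ?_
        filter_upwards [hn3] with ω hω hlt
        have hlt' : C * r n < |Z' n ω| := hlt
        by_cases hb : ω ∈ B n
        · exact Or.inr hb
        · exact Or.inl (lt_of_lt_of_le hlt' (hω hb))
    _ ≤ ENNReal.ofReal (ε / 2) + ENNReal.ofReal (ε / 2) :=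
        (measure_union_le _ _).trans (add_le_add hn1 hn2)
    _ = ENNReal.ofReal ε := by
        rw [← ENNReal.ofReal_add (by positivity) (by positivity), add_halves]

theorem of_deterministic {r : ℕ → ℝ} {z : ℕ → ℝ} {c : ℝ} (hc : 0 < c)
    (hz : ∀ᶠ n in atTop, |z n| ≤ c * r n) : IsBigOInProb μ (fun n _ => z n) r := by
  intro ε _
  refine ⟨c, hc, ?_⟩
  filter_upwards [hz] with n hn
  simp [not_lt.2 hn]

theorem tendsto_measure (h : IsBigOInProb μ Z r) {a : ℕ → ℝ} (ha : ∀ᶠ n in atTop, 0 ≤ a n)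
    (har : Tendsto (fun n => a n * r n) atTop (nhds 0)) {η : ℝ} (hη : 0 < η) :
    Tendsto (fun n => μ {ω | η < a n * |Z n ω|}) atTop (nhds 0) := by
  rw [ENNReal.tendsto_nhds_zero]
  intro ε hε
  rcases eq_or_ne ε ⊤ with rfl | hε'
  · simp
  obtain ⟨C, hC, h1⟩ := h ε.toReal (ENNReal.toReal_pos hε.ne' hε')
  rw [ENNReal.ofReal_toReal hε'] at h1
  have h2 : ∀ᶠ n in atTop, C * (a n * r n) < η :=
    (by simpa using har.const_mul C : Tendsto (fun n => C * (a n * r n)) atTop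
      (nhds 0)).eventually_lt_const hη
  filter_upwards [h1, h2, ha] with n hn1 hn2 han
  refine le_trans (measure_mono fun ω hω => ?_) hn1
  simp only [Set.mem_ofPred_eq] at hω ⊢
  by_contra hcon
  push Not at hcon
  have := mul_le_mul_of_nonneg_left hcon han
  linarith

/-- Markov's inequality. -/
theorem of_sq [IsProbabilityMeasure μ] {c : ℝ} (hc : 0 ≤ c) (hr : ∀ n, 0 ≤ r n)
    (hZ : ∀ᶠ n in atTop, Integrable (fun ω => Z n ω ^ 2) μ ∧ ∫ ω, Z n ω ^ 2 ∂μ ≤ c * r n ^ 2) :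
    IsBigOInProb μ Z r := by
  intro ε hε
  refine ⟨1 + c / ε, by positivity, ?_⟩
  filter_upwards [hZ] with n hn
  obtain ⟨hi, hle⟩ := hn
  have hC1 : c ≤ (1 + c / ε) ^ 2 * ε := by
    have : c = c / ε * ε := by field_simp
    have h0 : 0 ≤ c / ε := by positivity
    nlinarith [mul_nonneg (mul_nonneg h0 h0) hε.le]
  set C := 1 + c / ε
  have hsub : {ω | C * r n < |Z n ω|} ⊆ {ω | (C * r n) ^ 2 < Z n ω ^ 2} := fun ω hω => by
    simp only [Set.mem_ofPred_eq] at hω ⊢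
    rw [← sq_abs (Z n ω)]
    exact pow_lt_pow_left₀ hω (mul_nonneg (by positivity) (hr n)) two_ne_zero
  refine (measure_mono hsub).trans ?_
  -- For a zero rate Markov's inequality is void, but then the second moment vanishes and so does Z
  -- almost surely.
  rcases (hr n).eq_or_lt with h0 | hpos
  · have hz : ∫ ω, Z n ω ^ 2 ∂μ = 0 :=
      le_antisymm (by rw [← h0] at hle; simpa using hle) (integral_nonneg fun _ => sq_nonneg _)
    have := (integral_eq_zero_iff_of_nonneg (fun _ => sq_nonneg _) hi).1 hz
    have h3 : μ {ω | (C * r n) ^ 2 < Z n ω ^ 2} = 0 := by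
      refine measure_mono_null (fun ω hω => ?_) (ae_iff.1 this)
      simp only [Set.mem_ofPred_eq, ← h0] at hω ⊢
      intro hz0
      rw [show Z n ω ^ 2 = 0 from hz0] at hω
      simp at hω
    rw [h3]; exact zero_le
  · have hm := mul_meas_ge_le_integral_of_nonneg (μ := μ) (ae_of_all _ fun ω => sq_nonneg (Z n ω)) hi
      ((C * r n) ^ 2)
    rw [← ENNReal.ofReal_toReal (measure_ne_top μ _)]
    refine ENNReal.ofReal_le_ofReal ?_
    have h4 : μ.real {ω | (C * r n) ^ 2 < Z n ω ^ 2} ≤ μ.real {ω | (C * r n) ^ 2 ≤ Z n ω ^ 2} :=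
      measureReal_mono fun ω hω => by
        simp only [Set.mem_ofPred_eq] at hω ⊢; exact hω.le
    have hCr : 0 < (C * r n) ^ 2 := by positivity
    refine h4.trans (le_of_mul_le_mul_left ?_ hCr)
    calc _ ≤ c * r n ^ 2 := hm.trans hle
      _ ≤ C ^ 2 * ε * r n ^ 2 := by gcongr
      _ = _ := by ring

end IsBigOInProb

/-! ### Whitened bases, suprema over a set and L² projections. -/

section Whiten

variable {α : Type*} {m : ℕ}

/-- The functions `R φ` for a square matrix `R`. -/
def whiten (R : Matrix (Fin m) (Fin m) ℝ) (φ : Fin m → α → ℝ) (k : Fin m) (x : α) : ℝ :=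
  (R *ᵥ fun j => φ j x) k

theorem linComb_transpose_mulVec (R : Matrix (Fin m) (Fin m) ℝ) (φ : Fin m → α → ℝ)
    (c : Fin m → ℝ) (x : α) : linComb φ (Rᵀ *ᵥ c) x = ∑ j, whiten R φ j x * c j := by
  have : linComb φ (Rᵀ *ᵥ c) x = (fun j => φ j x) ⬝ᵥ (Rᵀ *ᵥ c) := rfl
  rw [this, Matrix.dotProduct_mulVec, Matrix.vecMul_transpose]
  rfl

theorem linComb_eq_whiten {R : Matrix (Fin m) (Fin m) ℝ} (hR : IsUnit R.det) (φ : Fin m → α → ℝ)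
    (c : Fin m → ℝ) (x : α) : linComb φ c x = ∑ j, whiten R φ j x * (Rᵀ⁻¹ *ᵥ c) j := by
  rw [← linComb_transpose_mulVec, Matrix.mulVec_mulVec, Matrix.mul_nonsing_inv, Matrix.one_mulVec]
  rwa [Matrix.det_transpose]

theorem mem_sieveSpace_iff {φ : Fin m → α → ℝ} {h : α → ℝ} :
    h ∈ sieveSpace φ ↔ ∃ c, h = linComb φ c := by
  rw [sieveSpace, Submodule.mem_span_range_iff_exists_fun]
  constructor
  · rintro ⟨c, rfl⟩
    exact ⟨c, by ext x; simp [linComb, mul_comm]⟩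
  · rintro ⟨c, rfl⟩
    exact ⟨c, by ext x; simp [linComb, mul_comm]⟩

theorem BoundedOn.mul {s : Set α} {f g : α → ℝ} (hf : BoundedOn s f) (hg : BoundedOn s g) :
    BoundedOn s fun x => f x * g x := by
  obtain ⟨C, hC⟩ := hf
  obtain ⟨D, hD⟩ := hg
  refine ⟨C * D, fun x hx => ?_⟩
  rw [abs_mul]
  exact mul_le_mul (hC x hx) (hD x hx) (abs_nonneg _) ((abs_nonneg _).trans (hC x hx))

theorem BoundedOn.sub {s : Set α} {f g : α → ℝ} (hf : BoundedOn s f) (hg : BoundedOn s g) :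
    BoundedOn s (f - g) := by
  obtain ⟨C, hC⟩ := hf
  obtain ⟨D, hD⟩ := hg
  exact ⟨C + D, fun x hx => (abs_sub _ _).trans (add_le_add (hC x hx) (hD x hx))⟩

theorem BoundedOn.mul_const {s : Set α} {f : α → ℝ} (hf : BoundedOn s f) (c : ℝ) :
    BoundedOn s fun x => f x * c :=
  hf.mul ⟨|c|, fun _ _ => le_rfl⟩

theorem BoundedOn.sum {s : Set α} {ι : Type*} (t : Finset ι) {f : ι → α → ℝ}
    (hf : ∀ i, BoundedOn s (f i)) : BoundedOn s fun x => ∑ i ∈ t, f i x := by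
  choose C hC using hf
  exact ⟨∑ i ∈ t, C i, fun x hx => (Finset.abs_sum_le_sum_abs _ _).trans
    (Finset.sum_le_sum fun i _ => hC i x hx)⟩

theorem BoundedOn.linComb {s : Set α} {φ : Fin m → α → ℝ} (hφ : ∀ j, BoundedOn s (φ j))
    (c : Fin m → ℝ) : BoundedOn s (linComb φ c) :=
  BoundedOn.sum _ fun j => (hφ j).mul_const (c j)

theorem BoundedOn.bddAbove_range {s : Set α} {f : α → ℝ} (hf : BoundedOn s f) :
    BddAbove (Set.range fun x : s => |f x|) := by
  obtain ⟨C, hC⟩ := hf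
  exact ⟨C, by rintro _ ⟨x, rfl⟩; exact hC x x.2⟩

theorem BoundedOn.abs_le_supNorm {s : Set α} {f : α → ℝ} (hf : BoundedOn s f) {x : α} (hx : x ∈ s) :
    |f x| ≤ supNorm s f :=
  le_ciSup hf.bddAbove_range ⟨x, hx⟩

theorem supNorm_nonneg (s : Set α) (f : α → ℝ) : 0 ≤ supNorm s f :=
  Real.iSup_nonneg fun _ => abs_nonneg _

theorem supNorm_le {s : Set α} {f : α → ℝ} {C : ℝ} (hC : 0 ≤ C) (h : ∀ x ∈ s, |f x| ≤ C) :
    supNorm s f ≤ C :=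
  Real.iSup_le (fun x => h x x.2) hC

theorem BoundedOn.sum_abs_le_xiSup {s : Set α} {φ : Fin m → α → ℝ} (hφ : ∀ j, BoundedOn s (φ j))
    {x : α} (hx : x ∈ s) : ∑ j, |φ j x| ≤ xiSup s φ := by
  choose C hC using hφ
  refine le_ciSup (f := fun x : s => ∑ j, |φ j x|) ⟨∑ j, C j, ?_⟩ ⟨x, hx⟩
  rintro _ ⟨x, rfl⟩
  exact Finset.sum_le_sum fun j _ => hC j x x.2

variable [MeasurableSpace α] {lam : Measure α}

/-- The quadratic form of G⁻¹ = R'R is the squared length of the whitened vector, for any such R.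
Boundedness of the basis matters: an unbounded real supremum would default to 0. -/
theorem eucl_whiten_le_zetaSup {s : Set α} {φ : Fin m → α → ℝ} (hφ : ∀ j, BoundedOn s (φ j))
    {R : Matrix (Fin m) (Fin m) ℝ} (hR : (gramMat lam φ)⁻¹ = Rᵀ * R) {x : α} (hx : x ∈ s) :
    eucl (fun j => whiten R φ j x) ≤ zetaSup lam s φ := by
  have e : ∀ x, Real.sqrt ((fun j => φ j x) ⬝ᵥ ((gramMat lam φ)⁻¹ *ᵥ fun j => φ j x)) =
      eucl (fun j => whiten R φ j x) := fun x => by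
    rw [hR, ← Matrix.mulVec_mulVec, Matrix.dotProduct_mulVec, Matrix.vecMul_transpose]
    rw [← Real.sqrt_sq (eucl_nonneg fun j => whiten R φ j x), eucl_sq_dot]
    rfl
  have hb : BoundedOn s fun x => ∑ j, whiten R φ j x ^ 2 := by
    refine BoundedOn.sum _ fun j => ?_
    have : BoundedOn s (whiten R φ j) := by
      have := BoundedOn.linComb hφ (R j)
      refine ⟨this.choose, fun x hx => ?_⟩
      have h2 := this.choose_spec x hx
      simpa [linComb, whiten, Matrix.mulVec, dotProduct, mul_comm] using h2
    simpa [sq] using this.mul this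
  obtain ⟨C, hC⟩ := hb
  unfold zetaSup
  simp_rw [e]
  refine le_ciSup (f := fun x : s => eucl (fun j => whiten R φ j (x : α)))
    ⟨Real.sqrt C, ?_⟩ ⟨x, hx⟩
  rintro _ ⟨y, rfl⟩
  simp only [eucl_eq_sqrt]
  exact Real.sqrt_le_sqrt ((le_abs_self _).trans (hC y y.2))

theorem zetaSup_nonneg (s : Set α) (φ : Fin m → α → ℝ) : 0 ≤ zetaSup lam s φ :=
  Real.iSup_nonneg fun _ => Real.sqrt_nonneg _

theorem BoundedOn.memLp [IsProbabilityMeasure lam] {s : Set α} {f : α → ℝ} (hf : BoundedOn s f)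
    (hm : Measurable f) (hs : ∀ᵐ x ∂lam, x ∈ s) (p : ENNReal) : MemLp f p lam := by
  obtain ⟨C, hC⟩ := hf
  exact MemLp.of_bound hm.aestronglyMeasurable C (hs.mono fun x hx => hC x hx)

theorem measurable_whiten {φ : Fin m → α → ℝ} (hφ : ∀ j, Measurable (φ j))
    (R : Matrix (Fin m) (Fin m) ℝ) (k : Fin m) : Measurable (whiten R φ k) := by
  change Measurable fun x => ∑ j, R k j * φ j x
  exact Finset.measurable_fun_sum _ fun j _ => (hφ j).const_mul _

theorem isBddOrtho_whiten {φ : Fin m → α → ℝ} (hm : ∀ j, Measurable (φ j))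
    (hL : ∀ j, MemLp (φ j) 2 lam) {R : Matrix (Fin m) (Fin m) ℝ}
    (hR1 : R * gramMat lam φ * Rᵀ = 1) {ζ : ℝ}
    (hζ : ∀ᵐ x ∂lam, eucl (fun j => whiten R φ j x) ≤ ζ) : IsBddOrtho lam (whiten R φ) ζ := by
  refine ⟨measurable_whiten hm R, ?_, fun a b => ?_⟩
  · filter_upwards [hζ] with x hx
    rw [← eucl_sq]
    exact pow_le_pow_left₀ (eucl_nonneg _) hx 2
  · have hi : ∀ j k, Integrable (fun x => (R a j * R b k) * (φ j x * φ k x)) lam := fun j k =>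
      ((hL j).integrable_mul (hL k)).const_mul _
    have e : ∀ x, whiten R φ a x * whiten R φ b x =
        ∑ j, ∑ k, (R a j * R b k) * (φ j x * φ k x) := fun x => by
      simp only [whiten, Matrix.mulVec, dotProduct, Finset.sum_mul_sum]
      exact Finset.sum_congr rfl fun _ _ => Finset.sum_congr rfl fun _ _ => by ring
    simp_rw [e]
    rw [integral_finsetSum _ fun j _ => integrable_finsetSum _ fun k _ => hi j k]
    have h1 := congrFun (congrFun hR1 a) b
    rw [Matrix.one_apply] at h1
    rw [← h1, Matrix.mul_apply]
    simp_rw [Matrix.mul_apply, Finset.sum_mul]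
    rw [Finset.sum_comm]
    refine Finset.sum_congr rfl fun j _ => ?_
    rw [integral_finsetSum _ fun k _ => hi j k]
    refine Finset.sum_congr rfl fun k _ => ?_
    rw [integral_const_mul, gramMat, Matrix.of_apply, Matrix.transpose_apply]
    ring

theorem IsBddOrtho.comp {𝒱 : Type*} [MeasurableSpace 𝒱] {ν : Measure 𝒱} {φ : Fin m → α → ℝ}
    {ζ : ℝ} (h : IsBddOrtho lam φ ζ) {π : 𝒱 → α} (hπ : MeasurePreserving π ν lam) :
    IsBddOrtho ν (fun a v => φ a (π v)) ζ := by
  refine ⟨fun a => (h.measurable a).comp hπ.measurable, hπ.quasiMeasurePreserving.ae h.bdd,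
    fun a b => ?_⟩
  rw [← h.ortho a b, ← hπ.map_eq, integral_map hπ.measurable.aemeasurable]
  exact ((h.measurable a).mul (h.measurable b)).aestronglyMeasurable

/-- Integrate ∑ φₐ² ≤ ζ²; orthonormality makes the left side equal to m. -/
theorem IsBddOrtho.card_le [IsProbabilityMeasure lam] {φ : Fin m → α → ℝ} {ζ : ℝ}
    (h : IsBddOrtho lam φ ζ) : (m : ℝ) ≤ ζ ^ 2 := by
  have e : ∫ x, ∑ a, φ a x ^ 2 ∂lam = m := by
    rw [integral_finsetSum _ fun a _ => (h.memLp a 2).integrable_sq]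
    have : ∀ a, ∫ x, φ a x ^ 2 ∂lam = 1 := fun a => by simpa [sq] using h.ortho a a
    simp [this]
  rw [← e]
  calc _ ≤ ∫ _x, ζ ^ 2 ∂lam := integral_mono_ae
        (integrable_finsetSum _ fun a _ => (h.memLp a 2).integrable_sq) (integrable_const _) h.bdd
    _ = _ := by simp

theorem l2Proj_eq_whiten {φ : Fin m → α → ℝ} {R : Matrix (Fin m) (Fin m) ℝ}
    (hR : (gramMat lam φ)⁻¹ = Rᵀ * R) {h : α → ℝ} (hi : ∀ j, Integrable (fun x => φ j x * h x) lam)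
    (x : α) : l2Proj lam φ h x = ∑ j, whiten R φ j x * ∫ y, whiten R φ j y * h y ∂lam := by
  rw [l2Proj, hR, ← Matrix.mulVec_mulVec, linComb_transpose_mulVec]
  refine Finset.sum_congr rfl fun j _ => ?_
  congr 1
  simp only [whiten, Matrix.mulVec, dotProduct, Finset.sum_mul, mul_assoc]
  rw [integral_finsetSum _ fun k _ => (hi k).const_mul _]
  simp [integral_const_mul]

theorem l2Proj_self {φ : Fin m → α → ℝ} (hG : (gramMat lam φ).PosDef)
    (hi : ∀ j k, Integrable (fun x => φ j x * φ k x) lam) (c : Fin m → ℝ) :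
    l2Proj lam φ (linComb φ c) = linComb φ c := by
  have e : (fun j => ∫ x, φ j x * linComb φ c x ∂lam) = gramMat lam φ *ᵥ c := by
    ext j
    simp only [linComb, Finset.mul_sum, ← mul_assoc]
    rw [integral_finsetSum _ fun k _ => (hi j k).mul_const _]
    simp [gramMat, Matrix.mulVec, dotProduct, integral_mul_const]
  rw [l2Proj, e, Matrix.mulVec_mulVec, Matrix.nonsing_inv_mul, Matrix.one_mulVec]
  exact (Matrix.isUnit_iff_isUnit_det _).1 hG.isUnit

theorem l2Proj_sub {φ : Fin m → α → ℝ} {f g : α → ℝ}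
    (hf : ∀ j, Integrable (fun x => φ j x * f x) lam)
    (hg : ∀ j, Integrable (fun x => φ j x * g x) lam) :
    l2Proj lam φ (f - g) = l2Proj lam φ f - l2Proj lam φ g := by
  have e : (fun j => ∫ x, φ j x * (f - g) x ∂lam) =
      (fun j => ∫ x, φ j x * f x ∂lam) - fun j => ∫ x, φ j x * g x ∂lam := by
    ext j
    simp only [Pi.sub_apply, mul_sub]
    rw [integral_sub (hf j) (hg j)]
  rw [l2Proj, e, Matrix.mulVec_sub]
  ext x
  simp [l2Proj, linComb, mul_sub, Finset.sum_sub_distrib]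

end Whiten

theorem l2Norm_nonneg {α : Type*} [MeasurableSpace α] (lam : Measure α) (f : α → ℝ) :
    0 ≤ l2Norm lam f := Real.sqrt_nonneg _

theorem l2Norm_sq {α : Type*} [MeasurableSpace α] (lam : Measure α) (f : α → ℝ) :
    l2Norm lam f ^ 2 = ∫ x, f x ^ 2 ∂lam :=
  Real.sq_sqrt (integral_nonneg fun _ => sq_nonneg _)

/-- Cauchy–Schwarz, from the discriminant of the nonnegative quadratic t ↦ ∫ (tf + g)². -/
theorem integral_mul_le_l2Norm {α : Type*} [MeasurableSpace α] {lam : Measure α} {f g : α → ℝ}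
    (hf : MemLp f 2 lam) (hg : MemLp g 2 lam) :
    ∫ x, f x * g x ∂lam ≤ l2Norm lam f * l2Norm lam g := by
  have hfg : Integrable (fun x => f x * g x) lam := hf.integrable_mul hg
  have key : ∀ t : ℝ, 0 ≤ (∫ x, f x ^ 2 ∂lam) * (t * t) + (2 * ∫ x, f x * g x ∂lam) * t
      + ∫ x, g x ^ 2 ∂lam := fun t => by
    have h0 : 0 ≤ ∫ x, (t * f x + g x) ^ 2 ∂lam := integral_nonneg fun _ => sq_nonneg _
    have e : ∀ x, (t * f x + g x) ^ 2 = t ^ 2 * f x ^ 2 + 2 * t * (f x * g x) + g x ^ 2 :=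
      fun x => by ring
    have i1 : Integrable (fun x => t ^ 2 * f x ^ 2) lam := hf.integrable_sq.const_mul _
    have i2 : Integrable (fun x => 2 * t * (f x * g x)) lam := hfg.const_mul _
    simp_rw [e] at h0
    rw [integral_add (by fun_prop) hg.integrable_sq, integral_add i1 i2, integral_const_mul,
      integral_const_mul] at h0
    linarith
  have hd := discrim_le_zero key
  rw [discrim] at hd
  refine le_of_sq_le_sq ?_ (mul_nonneg (l2Norm_nonneg _ _) (l2Norm_nonneg _ _))
  rw [mul_pow, l2Norm_sq, l2Norm_sq]
  nlinarith

theorem l2Norm_sub_le {α : Type*} [MeasurableSpace α] {lam : Measure α} {f g : α → ℝ}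
    (hf : MemLp f 2 lam) (hg : MemLp g 2 lam) :
    l2Norm lam (fun x => f x - g x) ≤ l2Norm lam f + l2Norm lam g := by
  have hfg : Integrable (fun x => 2 * (f x * g x)) lam := (hf.integrable_mul hg).const_mul 2
  refine le_of_sq_le_sq ?_ (add_nonneg (l2Norm_nonneg _ _) (l2Norm_nonneg _ _))
  have e : ∀ x, (f x - g x) ^ 2 = f x ^ 2 - 2 * (f x * g x) + g x ^ 2 := fun x => by ring
  have hc := integral_mul_le_l2Norm (hf.const_mul (-1)) hg
  have e1 : l2Norm lam (fun x => -1 * f x) = l2Norm lam f := by simp [l2Norm]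
  rw [e1] at hc
  simp only [neg_mul, one_mul] at hc
  rw [integral_neg] at hc
  rw [add_sq, l2Norm_sq, l2Norm_sq, l2Norm_sq]
  simp_rw [e]
  rw [integral_add (by have := hf.integrable_sq; fun_prop) hg.integrable_sq,
    integral_sub hf.integrable_sq hfg, integral_const_mul]
  linarith

/-! ### The conditional expectation operator. -/

namespace NPIV

variable {Ω : Type*} [MeasurableSpace Ω] {d dw : ℕ} {M : NPIV Ω d dw}

instance : IsProbabilityMeasure (M.μ) := M.prob

theorem IsModel.isProbabilityMeasure_lawX (h : M.IsModel) : IsProbabilityMeasure M.lawX :=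
  Measure.isProbabilityMeasure_map (h.measurable_X 0).aemeasurable

theorem IsModel.isProbabilityMeasure_lawW (h : M.IsModel) : IsProbabilityMeasure M.lawW :=
  Measure.isProbabilityMeasure_map (h.measurable_W 0).aemeasurable

section CondOp

variable {h : EuclideanSpace ℝ (Fin d) → ℝ}

theorem stronglyMeasurable_T (hh : Measurable h) : StronglyMeasurable (M.T h) := by
  unfold T
  exact hh.stronglyMeasurable.comp_measurable measurable_snd |>.integral_condDistrib

theorem IsModel.T_ae_eq (hM : M.IsModel) (hh : Measurable h) (hi : Integrable h M.lawX) :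
    M.μ[fun ω => h (M.X 0 ω) | MeasurableSpace.comap (M.W 0) inferInstance] =ᵐ[M.μ]
      fun ω => M.T h (M.W 0 ω) :=
  condExp_ae_eq_integral_condDistrib (hM.measurable_W 0) (hM.measurable_X 0).aemeasurable
    hh.stronglyMeasurable (hi.comp_measurable (hM.measurable_X 0))

theorem IsModel.memLp_T (hM : M.IsModel) (hh : Measurable h) (hh2 : MemLp h 2 M.lawX) :
    MemLp (M.T h) 2 M.lawW := by
  have := hM.isProbabilityMeasure_lawX
  rw [lawW, memLp_map_measure_iff (stronglyMeasurable_T hh).aestronglyMeasurable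
    (hM.measurable_W 0).aemeasurable]
  have h1 : MemLp (fun ω => h (M.X 0 ω)) 2 M.μ := hh2.comp_measurePreserving
    ⟨hM.measurable_X 0, rfl⟩
  exact (h1.condExp one_le_two (m := MeasurableSpace.comap (M.W 0) inferInstance)).ae_eq
    (hM.T_ae_eq hh (hh2.integrable one_le_two))

/-- `E[g(W) (T h)(W)] = E[g(W) h(X)]`. -/
theorem IsModel.integral_mul_T (hM : M.IsModel) (hh : Measurable h) (hh2 : MemLp h 2 M.lawX)
    {g : EuclideanSpace ℝ (Fin dw) → ℝ} (hg : StronglyMeasurable g) (hg2 : MemLp g 2 M.lawW) :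
    ∫ w, g w * M.T h w ∂M.lawW = ∫ ω, g (M.W 0 ω) * h (M.X 0 ω) ∂M.μ := by
  have := hM.isProbabilityMeasure_lawX
  have h1 : MemLp (fun ω => h (M.X 0 ω)) 2 M.μ := hh2.comp_measurePreserving
    ⟨hM.measurable_X 0, rfl⟩
  have h2 : MemLp (fun ω => g (M.W 0 ω)) 2 M.μ := hg2.comp_measurePreserving
    ⟨hM.measurable_W 0, rfl⟩
  have hgT : StronglyMeasurable fun w => g w * M.T h w := hg.mul (stronglyMeasurable_T hh)
  rw [lawW, integral_map (hM.measurable_W 0).aemeasurable hgT.aestronglyMeasurable]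
  have hgm : StronglyMeasurable[MeasurableSpace.comap (M.W 0) inferInstance]
      fun ω => g (M.W 0 ω) := hg.comp_measurable (comap_measurable _)
  have key := condExp_mul_of_stronglyMeasurable_left hgm (h2.integrable_mul h1)
    (h1.integrable one_le_two)
  rw [← integral_condExp (hM.measurable_W 0).comap_le
    (f := fun ω => g (M.W 0 ω) * h (M.X 0 ω))]
  refine integral_congr_ae ?_
  filter_upwards [key, hM.T_ae_eq hh (hh2.integrable one_le_two)] with ω e1 e2
  rw [← e2]
  exact e1.symm

/-- By the tower property ‖Th‖² = E[(Th)(W)h(X)], and Cauchy–Schwarz cancels one factor ‖Th‖. -/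
theorem IsModel.normW_T_le (hM : M.IsModel) (hh : Measurable h) (hh2 : MemLp h 2 M.lawX) :
    M.normW (M.T h) ≤ M.normX h := by
  have hT := hM.memLp_T hh hh2
  have e := hM.integral_mul_T hh hh2 (stronglyMeasurable_T hh) hT
  have hm1 : MeasurePreserving (M.X 0) M.μ M.lawX := ⟨hM.measurable_X 0, rfl⟩
  have hm2 : MeasurePreserving (M.W 0) M.μ M.lawW := ⟨hM.measurable_W 0, rfl⟩
  have hc := integral_mul_le_l2Norm (hT.comp_measurePreserving hm2)
    (hh2.comp_measurePreserving hm1)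
  have n1 : l2Norm M.μ (M.T h ∘ M.W 0) = M.normW (M.T h) := by
    unfold normW l2Norm lawW
    have hT2 : StronglyMeasurable fun w => M.T h w ^ 2 := (stronglyMeasurable_T hh).pow 2
    rw [integral_map (hM.measurable_W 0).aemeasurable hT2.aestronglyMeasurable]
    rfl
  have n2 : l2Norm M.μ (h ∘ M.X 0) = M.normX h := by
    unfold normX l2Norm lawX
    rw [integral_map (hM.measurable_X 0).aemeasurable (hh.pow_const 2).aestronglyMeasurable]
    rfl
  rw [n1, n2] at hc
  have e2 : M.normW (M.T h) ^ 2 ≤ M.normW (M.T h) * M.normX h := by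
    rw [normW, l2Norm_sq]
    simp_rw [sq]
    rw [e]
    exact hc
  rcases (l2Norm_nonneg M.lawW (M.T h)).eq_or_lt with h0 | h0
  · rw [normW, ← h0]; exact l2Norm_nonneg _ _
  · have h0' : 0 < M.normW (M.T h) := h0
    nlinarith

end CondOp

end NPIV

/-! ### Full rank, the measure of ill-posedness and the singular values of S. -/

theorem mulVec_injective_of_rank {m k : ℕ} {A : Matrix (Fin m) (Fin k) ℝ} (hA : A.rank = k) :
    Function.Injective A.mulVec := by
  have h1 := LinearMap.finrank_range_add_finrank_ker A.mulVecLin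
  have h2 : Module.finrank ℝ (LinearMap.range A.mulVecLin) = k := hA
  rw [h2, Module.finrank_pi, Fintype.card_fin, Nat.add_eq_left, Submodule.finrank_eq_zero] at h1
  exact LinearMap.ker_eq_bot.1 h1

/-- A qualitative constant without control in n. It serves to show that the supremum defining τ is
finite; the quantitative bound 1/(2τ) comes afterwards. -/
theorem exists_lower_bound {m k : ℕ} (hk : k ≠ 0) {A : Matrix (Fin m) (Fin k) ℝ}
    (hA : Function.Injective A.mulVec) : ∃ s, 0 < s ∧ ∀ c, s * eucl c ≤ eucl (A *ᵥ c) := by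
  have hp : (Aᵀ * A).PosDef := by
    have := Matrix.PosDef.conjTranspose_mul_self A hA
    rwa [Matrix.conjTranspose_eq_transpose_of_trivial] at this
  have h0 := lambdaMin_pos hk hp
  refine ⟨Real.sqrt (lambdaMin (Aᵀ * A)), Real.sqrt_pos.2 h0, fun c => ?_⟩
  refine le_of_sq_le_sq ?_ (eucl_nonneg _)
  rw [mul_pow, Real.sq_sqrt h0.le, eucl_sq_dot, eucl_sq_dot]
  have := lambdaMin_mul_le hp c
  rwa [← Matrix.mulVec_mulVec, Matrix.dotProduct_mulVec, Matrix.vecMul_transpose] at this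

namespace NPIV

variable {Ω : Type*} [MeasurableSpace Ω] {d dw : ℕ} (M : NPIV Ω d dw)

/-- The space of observations `(X, Y, W)`. -/
abbrev Obs (d dw : ℕ) : Type := EuclideanSpace ℝ (Fin d) × ℝ × EuclideanSpace ℝ (Fin dw)

/-- The `i`-th observation `(Xᵢ, Yᵢ, Wᵢ)`. -/
def obs (i : ℕ) (ω : Ω) : Obs d dw := (M.X i ω, M.Y i ω, M.W i ω)

/-- law of an observation -/
noncomputable def lawObs : Measure (Obs d dw) := M.μ.map (M.obs 0)

/-- The functions `R b^K(W)` of an observation. -/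
def instr {K : ℕ} (R : Matrix (Fin K) (Fin K) ℝ) (k : Fin K) (v : Obs d dw) : ℝ :=
  whiten R (M.b K) k v.2.2

/-- The functions `R ψ^J(X)` of an observation. -/
def regr {J : ℕ} (R : Matrix (Fin J) (Fin J) ℝ) (j : Fin J) (v : Obs d dw) : ℝ :=
  whiten R (M.ψ J) j v.1

variable {M}

theorem IsModel.measurable_obs (h : M.IsModel) (i : ℕ) : Measurable (M.obs i) :=
  (h.measurable_X i).prodMk ((h.measurable_Y i).prodMk (h.measurable_W i))

theorem IsModel.isSample (h : M.IsModel) : IsSample M.μ M.lawObs M.obs :=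
  ⟨fun i => ⟨h.measurable_obs i, (h.ident i).map_eq⟩, h.indep⟩

theorem IsModel.isProbabilityMeasure_lawObs (h : M.IsModel) : IsProbabilityMeasure M.lawObs :=
  Measure.isProbabilityMeasure_map (h.measurable_obs 0).aemeasurable

theorem IsModel.measurePreserving_fst (h : M.IsModel) :
    MeasurePreserving (fun v : Obs d dw => v.1) M.lawObs M.lawX :=
  ⟨measurable_fst, by rw [lawObs, Measure.map_map measurable_fst (h.measurable_obs 0)]; rfl⟩

theorem IsModel.measurePreserving_snd (h : M.IsModel) :
    MeasurePreserving (fun v : Obs d dw => v.2.2) M.lawObs M.lawW :=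
  ⟨by fun_prop, by rw [lawObs, Measure.map_map (by fun_prop) (h.measurable_obs 0)]; rfl⟩

theorem RegressorDensity.mem_XX (h : M.RegressorDensity) : ∀ᵐ x ∂M.lawX, x ∈ M.XX := by
  obtain ⟨⟨lo, hi, -, hX⟩, f, c, C, -, -, -, hlaw⟩ := h
  rw [hlaw]
  refine (withDensity_absolutelyContinuous _ _).ae_le ?_
  refine ae_restrict_mem ?_
  rw [hX]
  have : {x : EuclideanSpace ℝ (Fin d) | ∀ k, x k ∈ Set.Icc (lo k) (hi k)} =
      ⋂ k, (fun x : EuclideanSpace ℝ (Fin d) => x k) ⁻¹' Set.Icc (lo k) (hi k) := by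
    ext x; simp
  rw [this]
  exact MeasurableSet.iInter fun k => (by fun_prop : Measurable
    fun x : EuclideanSpace ℝ (Fin d) => x k) measurableSet_Icc

theorem IsModel.mem_WW_ae (h : M.IsModel) {P : EuclideanSpace ℝ (Fin dw) → Prop}
    (hP : MeasurableSet {w | P w}) (hW : ∀ w ∈ M.WW, P w) : ∀ᵐ w ∂M.lawW, P w := by
  rw [lawW, ae_map_iff (h.measurable_W 0).aemeasurable hP]
  filter_upwards [h.mem_WW 0] with ω hω using hW _ hω

end NPIV

section IllPosed

variable {Ω : Type*} [MeasurableSpace Ω] {d dw : ℕ} {M : NPIV Ω d dw} {J K : ℕ} {ζ : ℝ}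
  {Rb : Matrix (Fin K) (Fin K) ℝ} {Rp : Matrix (Fin J) (Fin J) ℝ}

namespace NPIV

/-- The function `c ↦ ∑ χ_j c_j` of the regressor, for whitened sieve functions `χ`. -/
def sieveFun (M : NPIV Ω d dw) (Rp : Matrix (Fin J) (Fin J) ℝ) (c : Fin J → ℝ) :
    EuclideanSpace ℝ (Fin d) → ℝ := fun x => ∑ j, whiten Rp (M.ψ J) j x * c j

theorem sieveFun_eq (c : Fin J → ℝ) : M.sieveFun Rp c = linComb (M.ψ J) (Rpᵀ *ᵥ c) := by
  ext x; rw [linComb_transpose_mulVec]; rfl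

theorem mem_Psi_iff (hRp : IsUnit Rp.det) {h : EuclideanSpace ℝ (Fin d) → ℝ} :
    h ∈ M.Psi J ↔ ∃ c, h = M.sieveFun Rp c := by
  rw [Psi, mem_sieveSpace_iff]
  constructor
  · rintro ⟨c, rfl⟩
    exact ⟨Rpᵀ⁻¹ *ᵥ c, funext fun x => linComb_eq_whiten hRp _ _ _⟩
  · rintro ⟨c, rfl⟩
    exact ⟨_, sieveFun_eq c⟩

variable (hM : M.IsModel) (hχ : IsBddOrtho M.lawX (whiten Rp (M.ψ J)) ζ)
  (hφ : IsBddOrtho M.lawW (whiten Rb (M.b K)) ζ)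

include hχ in
theorem measurable_sieveFun (c : Fin J → ℝ) : Measurable (M.sieveFun Rp c) := hχ.measurable_lin c

include hM hχ in
theorem memLp_sieveFun (c : Fin J → ℝ) : MemLp (M.sieveFun Rp c) 2 M.lawX :=
  have := hM.isProbabilityMeasure_lawX
  hχ.memLp_lin c 2

include hM hχ in
theorem normX_sieveFun (c : Fin J → ℝ) : M.normX (M.sieveFun Rp c) = eucl c := by
  have := hM.isProbabilityMeasure_lawX
  rw [normX, l2Norm, eucl_eq_sqrt, ← hχ.integral_lin_sq c]
  rfl

include hM hφ in
theorem integral_instr_mul {h : EuclideanSpace ℝ (Fin d) → ℝ} (hh : Measurable h)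
    (hh2 : MemLp h 2 M.lawX) (k : Fin K) :
    ∫ v, M.instr Rb k v * h v.1 ∂M.lawObs = ∫ w, whiten Rb (M.b K) k w * M.T h w ∂M.lawW := by
  have := hM.isProbabilityMeasure_lawW
  rw [hM.integral_mul_T hh hh2 (hφ.measurable k).stronglyMeasurable (hφ.memLp k 2), lawObs,
    integral_map (hM.measurable_obs 0).aemeasurable]
  · rfl
  · exact (((hφ.measurable k).comp (by fun_prop : Measurable fun v : Obs d dw => v.2.2)).mul
      (hh.comp measurable_fst)).aestronglyMeasurable

include hM hφ hχ in
theorem crossMean_instr_regr_mulVec (c : Fin J → ℝ) (k : Fin K) :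
    (crossMean M.lawObs (M.instr Rb) (M.regr Rp) *ᵥ c) k =
      ∫ w, whiten Rb (M.b K) k w * M.T (M.sieveFun Rp c) w ∂M.lawW := by
  have := hM.isProbabilityMeasure_lawObs
  have h1 : IsBddOrtho M.lawObs (M.instr Rb) ζ := hφ.comp hM.measurePreserving_snd
  have h2 : IsBddOrtho M.lawObs (M.regr Rp) ζ := hχ.comp hM.measurePreserving_fst
  rw [h1.crossMean_mulVec h2, ← integral_instr_mul hM hφ (measurable_sieveFun hχ c)
    (memLp_sieveFun hM hχ c)]
  rfl

include hM hφ hχ in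
-- Sc lists the coefficients of Th with respect to the orthonormal instruments, h being the sieve
-- function of c; this is Bessel's inequality.
theorem eucl_crossMean_le_normW (c : Fin J → ℝ) :
    eucl (crossMean M.lawObs (M.instr Rb) (M.regr Rp) *ᵥ c) ≤ M.normW (M.T (M.sieveFun Rp c)) := by
  have := hM.isProbabilityMeasure_lawW
  refine le_of_sq_le_sq ?_ (l2Norm_nonneg _ _)
  rw [normW, l2Norm_sq, eucl_sq]
  simp_rw [crossMean_instr_regr_mulVec hM hχ hφ]
  exact hφ.bessel (hM.memLp_T (measurable_sieveFun hχ c) (memLp_sieveFun hM hχ c))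

include hM hφ in
theorem normW_projW (hR : (gramMat M.lawW (M.b K))⁻¹ = Rbᵀ * Rb)
    (hb : ∀ k, MemLp (M.b K k) 2 M.lawW)
    {g : EuclideanSpace ℝ (Fin dw) → ℝ} (hg : MemLp g 2 M.lawW) :
    MemLp (M.projW K g) 2 M.lawW ∧
    M.normW (M.projW K g) = eucl fun k => ∫ w, whiten Rb (M.b K) k w * g w ∂M.lawW := by
  have := hM.isProbabilityMeasure_lawW
  have e : M.projW K g = fun w => ∑ k, whiten Rb (M.b K) k w *
      ∫ w', whiten Rb (M.b K) k w' * g w' ∂M.lawW :=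
    funext fun w => l2Proj_eq_whiten hR (fun k => (hb k).integrable_mul hg) w
  rw [e]
  refine ⟨hφ.memLp_lin _ 2, ?_⟩
  rw [normW, l2Norm, hφ.integral_lin_sq, eucl_eq_sqrt]

include hM hφ hχ in
/-- The sieve measure of ill-posedness and the smallest singular value of the whitened `S`. -/
theorem tau_bounds (hJ : J ≠ 0) (hRp : IsUnit Rp.det)
    (hinj : Function.Injective (crossMean M.lawObs (M.instr Rb) (M.regr Rp)).mulVec) :
    1 ≤ M.tau J ∧ ∀ c, eucl c ≤ M.tau J * M.normW (M.T (M.sieveFun Rp c)) := by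
  have := hM.isProbabilityMeasure_lawX
  obtain ⟨s, hs, hlow⟩ := exists_lower_bound hJ hinj
  have hlow' : ∀ c, s * eucl c ≤ M.normW (M.T (M.sieveFun Rp c)) := fun c =>
    (hlow c).trans (eucl_crossMean_le_normW hM hχ hφ c)
  -- Without this the real supremum τ would be the default 0. The bound 1/s rests on full column
  -- rank.
  have hbdd : BddAbove (Set.range fun h : {h : EuclideanSpace ℝ (Fin d) → ℝ //
      h ∈ M.Psi J ∧ M.normX h ≠ 0} => M.normX h / M.normW (M.T h)) := by
    refine ⟨s⁻¹, ?_⟩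
    rintro _ ⟨⟨h, hh, hh0⟩, rfl⟩
    obtain ⟨c, rfl⟩ := (mem_Psi_iff hRp).1 hh
    simp only
    rw [normX_sieveFun hM hχ] at hh0 ⊢
    have hpos : 0 < eucl c := lt_of_le_of_ne (eucl_nonneg c) (Ne.symm hh0)
    have hT : 0 < M.normW (M.T (M.sieveFun Rp c)) := lt_of_lt_of_le (by positivity) (hlow' c)
    rw [div_le_iff₀ hT, ← div_eq_inv_mul, le_div_iff₀ hs, mul_comm]
    exact hlow' c
  have hle : ∀ c, eucl c ≠ 0 → eucl c / M.normW (M.T (M.sieveFun Rp c)) ≤ M.tau J := by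
    intro c hc
    have := le_ciSup hbdd ⟨M.sieveFun Rp c, (mem_Psi_iff hRp).2 ⟨c, rfl⟩, by
      rwa [normX_sieveFun hM hχ]⟩
    simp only [normX_sieveFun hM hχ] at this
    exact this
  have hpos : ∀ c, eucl c ≠ 0 → 0 < M.normW (M.T (M.sieveFun Rp c)) := fun c hc =>
    lt_of_lt_of_le (mul_pos hs (lt_of_le_of_ne (eucl_nonneg c) (Ne.symm hc))) (hlow' c)
  constructor
  -- Any unit vector is a witness for 1 ≤ τ, because T is a contraction.
  · set c : Fin J → ℝ := Pi.single ⟨0, Nat.pos_of_ne_zero hJ⟩ 1 with hc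
    have h1 : eucl c = 1 := by
      rw [eucl_eq_sqrt]; simp [hc, Pi.single_apply]
    have h2 := hle c (by rw [h1]; exact one_ne_zero)
    have h3 := hM.normW_T_le (measurable_sieveFun hχ c) (memLp_sieveFun hM hχ c)
    rw [normX_sieveFun hM hχ, h1] at h3
    refine le_trans ?_ h2
    rw [h1, le_div_iff₀ (hpos c (by rw [h1]; exact one_ne_zero))]
    simpa using h3
  · intro c
    by_cases hc : eucl c = 0
    · rw [hc]
      refine mul_nonneg ?_ (l2Norm_nonneg _ _)
      exact Real.iSup_nonneg fun h => div_nonneg (l2Norm_nonneg _ _) (l2Norm_nonneg _ _)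
    · have := hle c hc
      rwa [div_le_iff₀ (hpos c hc)] at this

include hM hφ hχ in
-- |Sc| is the norm of Π_K Th. For ‖h‖ = 1 one has ‖Th‖ ≥ 1/τ, and projecting loses at most half of
-- that; homogeneity gives the rest.
theorem eucl_crossMean_ge (hRp : IsUnit Rp.det)
    (hR : (gramMat M.lawW (M.b K))⁻¹ = Rbᵀ * Rb) (hb : ∀ k, MemLp (M.b K k) 2 M.lawW)
    (hτ : 1 ≤ M.tau J) (hτ' : ∀ c, eucl c ≤ M.tau J * M.normW (M.T (M.sieveFun Rp c)))
    (hD : (⨆ h : {h : EuclideanSpace ℝ (Fin d) → ℝ // h ∈ M.Psi J ∧ M.normX h = 1},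
        M.normW (M.projW K (M.T h) - M.T h)) ≤ 1 / 2 * (M.tau J)⁻¹) (c : Fin J → ℝ) :
    1 / (2 * M.tau J) * eucl c ≤ eucl (crossMean M.lawObs (M.instr Rb) (M.regr Rp) *ᵥ c) := by
  have := hM.isProbabilityMeasure_lawW
  set S := crossMean M.lawObs (M.instr Rb) (M.regr Rp) with hS
  have hT2 : ∀ c, MemLp (M.T (M.sieveFun Rp c)) 2 M.lawW := fun c =>
    hM.memLp_T (measurable_sieveFun hχ c) (memLp_sieveFun hM hχ c)
  have hproj : ∀ c, MemLp (M.projW K (M.T (M.sieveFun Rp c))) 2 M.lawW ∧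
      M.normW (M.projW K (M.T (M.sieveFun Rp c))) = eucl (S *ᵥ c) := fun c => by
    obtain ⟨h1, h2⟩ := normW_projW hM hφ hR hb (hT2 c)
    refine ⟨h1, h2.trans ?_⟩
    congr 1
    ext k
    rw [hS, crossMean_instr_regr_mulVec hM hχ hφ]
  have hunit : ∀ c, eucl c = 1 → 1 / (2 * M.tau J) ≤ eucl (S *ᵥ c) := by
    intro c hc
    have hbdd : BddAbove (Set.range fun h : {h : EuclideanSpace ℝ (Fin d) → ℝ //
        h ∈ M.Psi J ∧ M.normX h = 1} => M.normW (M.projW K (M.T h) - M.T h)) := by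
      refine ⟨1 + 1, ?_⟩
      rintro _ ⟨⟨h, hh, hh1⟩, rfl⟩
      obtain ⟨c', rfl⟩ := (mem_Psi_iff hRp).1 hh
      have h3 := hM.normW_T_le (measurable_sieveFun hχ c') (memLp_sieveFun hM hχ c')
      rw [hh1] at h3
      refine (l2Norm_sub_le (hproj c').1 (hT2 c')).trans (add_le_add ?_ h3)
      exact (hproj c').2.le.trans ((eucl_crossMean_le_normW hM hχ hφ c').trans h3)
    have h1 := (le_ciSup hbdd ⟨M.sieveFun Rp c, (mem_Psi_iff hRp).2 ⟨c, rfl⟩, by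
      rw [normX_sieveFun hM hχ, hc]⟩).trans hD
    have h2 := l2Norm_sub_le (hproj c).1 ((hproj c).1.sub (hT2 c))
    have e : (fun x => M.projW K (M.T (M.sieveFun Rp c)) x -
        (M.projW K (M.T (M.sieveFun Rp c)) - M.T (M.sieveFun Rp c)) x) =
        M.T (M.sieveFun Rp c) := by ext x; simp
    rw [e] at h2
    have h3 : M.normW (M.T (M.sieveFun Rp c)) ≤ eucl (S *ᵥ c) + 1 / 2 * (M.tau J)⁻¹ := by
      rw [← (hproj c).2]
      exact h2.trans (add_le_add le_rfl h1)
    have h4 := hτ' c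
    rw [hc] at h4
    have h5 : (M.tau J)⁻¹ ≤ M.normW (M.T (M.sieveFun Rp c)) := by
      rw [inv_le_iff_one_le_mul₀ (by linarith), mul_comm]; exact h4
    have h6 : 1 / (2 * M.tau J) = 1 / 2 * (M.tau J)⁻¹ := by field_simp
    rw [h6]; linarith
  by_cases hc : eucl c = 0
  · rw [hc, mul_zero]; exact eucl_nonneg _
  · have hpos : 0 < eucl c := lt_of_le_of_ne (eucl_nonneg c) (Ne.symm hc)
    have h1 := hunit ((eucl c)⁻¹ • c) (by
      rw [eucl_smul, abs_of_pos (inv_pos.2 hpos), inv_mul_cancel₀ hc])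
    rw [Matrix.mulVec_smul, eucl_smul, abs_of_pos (inv_pos.2 hpos), ← div_eq_inv_mul,
      le_div_iff₀ hpos] at h1
    exact h1

end NPIV

end IllPosed

/-! ### Bounds for the sieves and moments of the residual. -/

theorem measurable_eucl {α : Type*} [MeasurableSpace α] {m : ℕ} {f : Fin m → α → ℝ}
    (hf : ∀ j, Measurable (f j)) : Measurable fun x => eucl fun j => f j x := by
  simp_rw [eucl_eq_sqrt]
  exact (Finset.measurable_fun_sum _ fun j _ => (hf j).pow_const 2).sqrt

namespace NPIV

variable {Ω : Type*} [MeasurableSpace Ω] {d dw : ℕ} {M : NPIV Ω d dw} {J K : ℕ} {ζ : ℝ}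
  {Rb : Matrix (Fin K) (Fin K) ℝ} {Rp : Matrix (Fin J) (Fin J) ℝ}

theorem IsModel.memLp_basisX (hM : M.IsModel) (hd : M.RegressorDensity)
    (h : IsBasisArray M.lawX M.XX M.ψ) (j : Fin J) (p : ENNReal) : MemLp (M.ψ J j) p M.lawX :=
  have := hM.isProbabilityMeasure_lawX
  (h.bounded J j).memLp (h.measurable J j) hd.mem_XX p

theorem IsModel.memLp_basisW (hM : M.IsModel)
    (h : IsBasisArray M.lawW M.WW M.b) (k : Fin K) (p : ENNReal) : MemLp (M.b K k) p M.lawW := by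
  have := hM.isProbabilityMeasure_lawW
  obtain ⟨C, hC⟩ := h.bounded K k
  exact MemLp.of_bound (h.measurable K k).aestronglyMeasurable C
    (hM.mem_WW_ae (measurableSet_le (h.measurable K k).abs measurable_const) hC)

theorem IsModel.isBddOrtho_X (hM : M.IsModel) (hd : M.RegressorDensity)
    (h : IsBasisArray M.lawX M.XX M.ψ) (hR1 : Rp * gramMat M.lawX (M.ψ J) * Rpᵀ = 1)
    (hR : (gramMat M.lawX (M.ψ J))⁻¹ = Rpᵀ * Rp) :
    IsBddOrtho M.lawX (whiten Rp (M.ψ J)) (M.zeta J K) :=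
  isBddOrtho_whiten (h.measurable J) (fun j => hM.memLp_basisX hd h j 2) hR1
    (hd.mem_XX.mono fun _ hx =>
      (eucl_whiten_le_zetaSup (h.bounded J) hR hx).trans (le_max_right _ _))

theorem IsModel.isBddOrtho_W (hM : M.IsModel)
    (h : IsBasisArray M.lawW M.WW M.b) (hR1 : Rb * gramMat M.lawW (M.b K) * Rbᵀ = 1)
    (hR : (gramMat M.lawW (M.b K))⁻¹ = Rbᵀ * Rb) :
    IsBddOrtho M.lawW (whiten Rb (M.b K)) (M.zeta J K) :=
  isBddOrtho_whiten (h.measurable K) (fun j => hM.memLp_basisW h j 2) hR1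
    (hM.mem_WW_ae (measurableSet_le (measurable_eucl (measurable_whiten (h.measurable K) Rb))
      measurable_const) fun _ hx =>
      (eucl_whiten_le_zetaSup (h.bounded K) hR hx).trans (le_max_left _ _))

/-- `J ≤ ξ² / e`. -/
theorem IsModel.card_le_xi (hM : M.IsModel) (hd : M.RegressorDensity)
    (h : IsBasisArray M.lawX M.XX M.ψ) (hJ : J ≠ 0)
    (hR1 : Rp * gramMat M.lawX (M.ψ J) * Rpᵀ = 1) :
    Real.sqrt J ≤ M.xi J / Real.sqrt (M.e J) := by
  have := hM.isProbabilityMeasure_lawX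
  have he : 0 < M.e J := lambdaMin_pos hJ (h.posDef J)
  have hxi : 0 ≤ M.xi J := Real.iSup_nonneg fun _ => Finset.sum_nonneg fun _ _ => abs_nonneg _
  -- The whitened sieve has length at most ξ/√e, since whitening scales by at most e^(-1/2) and the
  -- ℓ² norm is below the ℓ¹ norm; then count dimensions with `card_le`.
  have key : IsBddOrtho M.lawX (whiten Rp (M.ψ J)) (M.xi J / Real.sqrt (M.e J)) := by
    refine isBddOrtho_whiten (h.measurable J) (fun j => hM.memLp_basisX hd h j 2) hR1
      (hd.mem_XX.mono fun x hx => ?_)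
    have h1 := eucl_whitening_le hJ (h.posDef J) hR1 fun j => M.ψ J j x
    have h2 : eucl (fun j => M.ψ J j x) ≤ M.xi J := by
      refine le_trans ?_ (BoundedOn.sum_abs_le_xiSup (h.bounded J) hx)
      rw [eucl_eq_sqrt]
      refine Real.sqrt_le_iff.2 ⟨Finset.sum_nonneg fun _ _ => abs_nonneg _, ?_⟩
      calc ∑ j, M.ψ J j x ^ 2 = ∑ j, |M.ψ J j x| ^ 2 := by simp
        _ ≤ _ := Finset.sum_sq_le_sq_sum_of_nonneg fun _ _ => abs_nonneg _
    refine h1.trans ?_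
    rw [div_eq_inv_mul]
    exact mul_le_mul_of_nonneg_left h2 (inv_nonneg.2 (Real.sqrt_nonneg _))
  rw [← Real.sqrt_sq (div_nonneg hxi (Real.sqrt_nonneg (M.e J)))]
  exact Real.sqrt_le_sqrt key.card_le

/-- The residual as a function of an observation. -/
def resid (M : NPIV Ω d dw) (v : Obs d dw) : ℝ := v.2.1 - M.h₀ v.1

theorem IsModel.measurable_resid (hM : M.IsModel) : Measurable M.resid :=
  (by fun_prop : Measurable fun v : Obs d dw => v.2.1).sub
    (hM.measurable_h₀.comp measurable_fst)

theorem IsModel.integrable_resid_rpow (hM : M.IsModel) {δ : ℝ} (h : M.ResidualMoments δ) :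
    Integrable (fun v => |M.resid v| ^ (2 + δ)) M.lawObs := by
  have hm : Measurable fun v => |M.resid v| ^ (2 + δ) := hM.measurable_resid.abs.pow_const _
  rw [lawObs, integrable_map_measure hm.aestronglyMeasurable (hM.measurable_obs 0).aemeasurable]
  exact h.moment

/-- From u² ≤ 1 + |u|^(2+δ). -/
theorem IsModel.memLp_resid (hM : M.IsModel) {δ : ℝ} (h : M.ResidualMoments δ) :
    MemLp M.resid 2 M.lawObs := by
  have := hM.isProbabilityMeasure_lawObs
  refine (memLp_two_iff_integrable_sq hM.measurable_resid.aestronglyMeasurable).2 ?_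
  refine ((integrable_const 1).add (hM.integrable_resid_rpow h)).mono'
    (hM.measurable_resid.pow_const 2).aestronglyMeasurable (ae_of_all _ fun v => ?_)
  rw [Real.norm_eq_abs, abs_of_nonneg (sq_nonneg _), ← sq_abs]
  simp only [Pi.add_apply]
  have hδ := h.delta_pos
  rcases le_total (|M.resid v|) 1 with h1 | h1
  · have : 0 ≤ |M.resid v| ^ (2 + δ) := by positivity
    have := pow_le_one₀ (n := 2) (abs_nonneg (M.resid v)) h1
    linarith
  · have : |M.resid v| ^ (2 : ℝ) ≤ |M.resid v| ^ (2 + δ) :=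
      Real.rpow_le_rpow_of_exponent_le h1 (by linarith)
    rw [Real.rpow_two] at this
    linarith

theorem IsModel.integral_mul_resid (hM : M.IsModel) {δ : ℝ} (h : M.ResidualMoments δ)
    {f : EuclideanSpace ℝ (Fin dw) → ℝ} (hf : Measurable f) (hf2 : MemLp f 2 M.lawW) :
    ∫ v, f v.2.2 * M.resid v ∂M.lawObs = 0 := by
  have hmf : Measurable fun v : Obs d dw => f v.2.2 * M.resid v :=
    (hf.comp (by fun_prop)).mul hM.measurable_resid
  rw [lawObs, integral_map (hM.measurable_obs 0).aemeasurable hmf.aestronglyMeasurable]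
  have e : (fun ω => f (M.obs 0 ω).2.2 * M.resid (M.obs 0 ω)) =
      (fun ω => f (M.W 0 ω)) * M.u 0 := rfl
  rw [e]
  have hfW : MemLp (fun ω => f (M.W 0 ω)) 2 M.μ := hf2.comp_measurePreserving
    ⟨hM.measurable_W 0, rfl⟩
  have hu : MemLp (M.u 0) 2 M.μ := (hM.memLp_resid h).comp_measurePreserving
    (hM.isSample.law 0)
  have hgm : StronglyMeasurable[MeasurableSpace.comap (M.W 0) inferInstance]
      fun ω => f (M.W 0 ω) := hf.stronglyMeasurable.comp_measurable (comap_measurable _)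
  have key := condExp_mul_of_stronglyMeasurable_left hgm (hfW.integrable_mul hu)
    (hu.integrable one_le_two)
  rw [← integral_condExp (hM.measurable_W 0).comap_le]
  refine (integral_congr_ae (g := fun _ => (0 : ℝ)) ?_).trans (by simp)
  filter_upwards [key, hM.exog 0] with ω e1 e2
  rw [e1]
  simp [e2]

theorem IsModel.integral_mul_resid_sq_le (hM : M.IsModel) {δ : ℝ} (h : M.ResidualMoments δ) :
    ∃ s : ℝ, 1 ≤ s ∧ ∀ f : EuclideanSpace ℝ (Fin dw) → ℝ, Measurable f → (∀ w, 0 ≤ f w) →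
      (∃ C, ∀ᵐ w ∂M.lawW, f w ≤ C) →
      ∫ v, f v.2.2 * M.resid v ^ 2 ∂M.lawObs ≤ s * ∫ w, f w ∂M.lawW := by
  obtain ⟨s, hs⟩ := h.condVar
  -- A variance bound of at least 1 allows it to be multiplied in or divided out freely in later
  -- estimates.
  refine ⟨max s 1, le_max_right _ _, fun f hf hf0 ⟨C, hC⟩ => ?_⟩
  have := hM.isProbabilityMeasure_lawW
  have hmf : Measurable fun v : Obs d dw => f v.2.2 * M.resid v ^ 2 :=
    (hf.comp (by fun_prop)).mul (hM.measurable_resid.pow_const 2)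
  rw [lawObs, integral_map (hM.measurable_obs 0).aemeasurable hmf.aestronglyMeasurable, lawW,
    integral_map (hM.measurable_W 0).aemeasurable hf.aestronglyMeasurable]
  have e : (fun ω => f (M.obs 0 ω).2.2 * M.resid (M.obs 0 ω) ^ 2) =
      (fun ω => f (M.W 0 ω)) * fun ω => M.u 0 ω ^ 2 := rfl
  rw [e]
  have hC' : ∀ᵐ ω ∂M.μ, |f (M.W 0 ω)| ≤ C := by
    have h1 : MeasurePreserving (M.W 0) M.μ M.lawW := ⟨hM.measurable_W 0, rfl⟩
    filter_upwards [h1.quasiMeasurePreserving.ae hC] with ω hω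
    rwa [abs_of_nonneg (hf0 _)]
  have hfm : Measurable fun ω => f (M.W 0 ω) := hf.comp (hM.measurable_W 0)
  have hu : MemLp (M.u 0) 2 M.μ := (hM.memLp_resid h).comp_measurePreserving
    (hM.isSample.law 0)
  have hfi : Integrable (fun ω => f (M.W 0 ω)) M.μ :=
    Integrable.of_bound hfm.aestronglyMeasurable C hC'
  have hgm : StronglyMeasurable[MeasurableSpace.comap (M.W 0) inferInstance]
      fun ω => f (M.W 0 ω) := hf.stronglyMeasurable.comp_measurable (comap_measurable _)
  have hfu : Integrable ((fun ω => f (M.W 0 ω)) * fun ω => M.u 0 ω ^ 2) M.μ :=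
    memLp_one_iff_integrable.1 (memLp_bdd_mul hfm hC' (memLp_one_iff_integrable.2 hu.integrable_sq))
  have key := condExp_mul_of_stronglyMeasurable_left hgm hfu hu.integrable_sq
  rw [← integral_condExp (hM.measurable_W 0).comap_le, ← integral_const_mul]
  refine integral_mono_ae integrable_condExp (hfi.const_mul _) ?_
  filter_upwards [key, hs] with ω e1 e2
  rw [e1]
  simp only [Pi.mul_apply]
  rw [mul_comm]
  exact mul_le_mul_of_nonneg_right (e2.trans (le_max_left _ _)) (hf0 _)

end NPIV

/-! ### The noise vector and its images under matrix fluctuations. -/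

namespace NPIV

variable {Ω : Type*} [MeasurableSpace Ω] {d dw : ℕ} {M : NPIV Ω d dw} {J K : ℕ} {ζ : ℝ}
  {Rb : Matrix (Fin K) (Fin K) ℝ} {Rp : Matrix (Fin J) (Fin J) ℝ}

/-- The conditional second moment of the residual given the instrument is at most `s`, in
integrated form. -/
def CondVarLE (M : NPIV Ω d dw) (s : ℝ) : Prop :=
  ∀ f : EuclideanSpace ℝ (Fin dw) → ℝ, Measurable f → (∃ C, ∀ᵐ w ∂M.lawW, |f w| ≤ C) →
    ∫ v, (f v.2.2 * M.resid v) ^ 2 ∂M.lawObs ≤ s * ∫ w, f w ^ 2 ∂M.lawW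

theorem IsModel.exists_condVarLE (hM : M.IsModel) {δ : ℝ} (h : M.ResidualMoments δ) :
    ∃ s : ℝ, 1 ≤ s ∧ M.CondVarLE s := by
  obtain ⟨s, hs1, hs⟩ := hM.integral_mul_resid_sq_le h
  refine ⟨s, hs1, fun f hf ⟨C, hC⟩ => ?_⟩
  simp_rw [mul_pow]
  refine hs (fun w => f w ^ 2) (hf.pow_const 2) (fun _ => sq_nonneg _) ⟨C ^ 2, ?_⟩
  filter_upwards [hC] with w hw
  exact sq_le_sq' (by linarith [abs_le.1 hw]) (abs_le.1 hw).2

/-- The vector `n⁻¹ ∑ R b^K(Wᵢ) uᵢ`. -/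
noncomputable def noise (M : NPIV Ω d dw) (Rb : Matrix (Fin K) (Fin K) ℝ) (n : ℕ) (ω : Ω) :
    Fin K → ℝ :=
  fun k => sampleMean M.obs n (fun v => M.instr Rb k v * M.resid v) ω

theorem mulVec_noise {p : ℕ} (N : Matrix (Fin p) (Fin K) ℝ) (n : ℕ) (ω : Ω) :
    N *ᵥ M.noise Rb n ω = fun l =>
      sampleMean M.obs n (fun v => (∑ k, M.instr Rb k v * N l k) * M.resid v) ω := by
  ext l
  have e : (fun v => (∑ k, M.instr Rb k v * N l k) * M.resid v) =
      fun v => ∑ k, (M.instr Rb k v * M.resid v) * N l k := by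
    ext v; rw [Finset.sum_mul]; exact Finset.sum_congr rfl fun k _ => by ring
  rw [e, sampleMean_sum, Matrix.mulVec, dotProduct]
  refine Finset.sum_congr rfl fun k _ => ?_
  rw [sampleMean_mul_const, noise, mul_comm]

section

variable (hM : M.IsModel) {δ : ℝ} (hu : M.ResidualMoments δ)
  (hφ : IsBddOrtho M.lawW (whiten Rb (M.b K)) ζ) {s : ℝ} (hs : M.CondVarLE s)

theorem _root_.IsBddOrtho.exists_abs_lin_le {𝒱 : Type*} [MeasurableSpace 𝒱] {ν : Measure 𝒱} {m : ℕ}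
    {φ : Fin m → 𝒱 → ℝ} {ζ : ℝ} (h : IsBddOrtho ν φ ζ) (w : Fin m → ℝ) :
    ∀ᵐ v ∂ν, |∑ a, φ a v * w a| ≤ |ζ| * eucl w := by
  filter_upwards [h.bdd] with v hv
  refine (abs_dotProduct_le (fun a => φ a v) w).trans
    (mul_le_mul_of_nonneg_right ?_ (eucl_nonneg _))
  refine abs_le_of_sq_le_sq' ?_ (abs_nonneg _) |>.2
  rwa [eucl_sq, sq_abs]

include hM hφ hu in
theorem instr_lin_mul_resid (w : Fin K → ℝ) :
    Measurable (fun v => (∑ k, M.instr Rb k v * w k) * M.resid v) ∧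
    MemLp (fun v => (∑ k, M.instr Rb k v * w k) * M.resid v) 2 M.lawObs ∧
    ∫ v, (∑ k, M.instr Rb k v * w k) * M.resid v ∂M.lawObs = 0 := by
  have := hM.isProbabilityMeasure_lawW
  have h1 : IsBddOrtho M.lawObs (M.instr Rb) ζ := hφ.comp hM.measurePreserving_snd
  exact ⟨(h1.measurable_lin w).mul hM.measurable_resid,
    memLp_bdd_mul (h1.measurable_lin w) (h1.exists_abs_lin_le w) (hM.memLp_resid hu),
    hM.integral_mul_resid hu (hφ.measurable_lin w) (hφ.memLp_lin w 2)⟩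

include hM hφ hs in
theorem integral_instr_lin_mul_resid_sq_le (w : Fin K → ℝ) :
    ∫ v, ((∑ k, M.instr Rb k v * w k) * M.resid v) ^ 2 ∂M.lawObs ≤ s * eucl w ^ 2 := by
  have := hM.isProbabilityMeasure_lawW
  have := hs _ (hφ.measurable_lin w) ⟨_, hφ.exists_abs_lin_le w⟩
  rwa [hφ.integral_lin_sq w, ← eucl_sq] at this

/-- The squared Frobenius norm is computed by columns instead: each column is the image of a unit
vector, and there are K of them. -/
theorem sum_eucl_row_sq_le {p : ℕ} {N : Matrix (Fin p) (Fin K) ℝ} {C : ℝ}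
    (hN : ∀ x, eucl (N *ᵥ x) ≤ C * eucl x) : ∑ l, eucl (N l) ^ 2 ≤ C ^ 2 * K := by
  simp_rw [eucl_sq]
  rw [Finset.sum_comm]
  have : ∀ k : Fin K, ∑ l, N l k ^ 2 ≤ C ^ 2 := fun k => by
    have h := hN (Pi.single k 1)
    have h1 : eucl (Pi.single k (1 : ℝ)) = 1 := by
      rw [eucl_eq_sqrt]; simp [Pi.single_apply]
    rw [h1, mul_one, Matrix.mulVec_single_one] at h
    have := pow_le_pow_left₀ (eucl_nonneg _) h 2
    rwa [eucl_sq] at this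
  refine (Finset.sum_le_sum fun k _ => this k).trans ?_
  simp [mul_comm]

include hM hφ hs hu in
/-- The image of the noise vector under the fluctuation of a cross moment matrix. -/
theorem integral_crossSample_noise_le {m p : ℕ} {φ : Fin m → Obs d dw → ℝ}
    {χ : Fin p → Obs d dw → ℝ} (h1 : IsBddOrtho M.lawObs φ ζ) (h2 : IsBddOrtho M.lawObs χ ζ)
    {N : Matrix (Fin p) (Fin K) ℝ} {C : ℝ} (hN : ∀ x, eucl (N *ᵥ x) ≤ C * eucl x) (hs0 : 0 ≤ s)
    (hκ : ∑ a, (∫ v, φ a v * ((∑ l, χ l v * ∑ k, M.instr Rb k v * N l k) * M.resid v) ∂M.lawObs) ^ 2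
      ≤ s * ∫ v, (∑ l, χ l v * ∑ k, M.instr Rb k v * N l k) ^ 2 ∂M.lawObs)
    {n : ℕ} (hn : n ≠ 0) (hζ : 1 ≤ ζ ^ 2) (hζn : ζ ^ 2 ≤ n) :
    Integrable (fun ω => eucl ((crossSample M.obs n φ χ ω - crossMean M.lawObs φ χ) *ᵥ
      (N *ᵥ M.noise Rb n ω)) ^ 2) M.μ ∧
    ∫ ω, eucl ((crossSample M.obs n φ χ ω - crossMean M.lawObs φ χ) *ᵥ
      (N *ᵥ M.noise Rb n ω)) ^ 2 ∂M.μ ≤ 24 * s * (ζ * C * Real.sqrt K / n) ^ 2 := by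
  have := hM.isProbabilityMeasure_lawObs
  have h3 : IsBddOrtho M.lawObs (M.instr Rb) ζ := hφ.comp hM.measurePreserving_snd
  have hg := fun l => instr_lin_mul_resid hM hu hφ (N l)
  obtain ⟨i1, i2⟩ := hM.isSample.integral_eucl_crossSample_mulVec_mean_le h1 h2
    (fun l => (hg l).1) (fun l => (hg l).2.1) (fun l => (hg l).2.2) hn
  simp_rw [mulVec_noise]
  refine ⟨i1, i2.trans ?_⟩
  have e1 : ∑ l, ∫ v, ((∑ k, M.instr Rb k v * N l k) * M.resid v) ^ 2 ∂M.lawObs ≤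
      s * (C ^ 2 * K) := by
    refine (Finset.sum_le_sum fun l _ =>
      integral_instr_lin_mul_resid_sq_le hM hφ hs (N l)).trans ?_
    rw [← Finset.mul_sum]
    exact mul_le_mul_of_nonneg_left (sum_eucl_row_sq_le hN) hs0
  have e2 : ∫ v, (∑ l, χ l v * ∑ k, M.instr Rb k v * N l k) ^ 2 ∂M.lawObs ≤
      ζ ^ 2 * (C ^ 2 * K) := by
    have hi : ∀ l, Integrable (fun v => (∑ k, M.instr Rb k v * N l k) ^ 2) M.lawObs := fun l =>
      (h3.memLp_lin (N l) 2).integrable_sq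
    calc _ ≤ ∫ v, ζ ^ 2 * ∑ l, (∑ k, M.instr Rb k v * N l k) ^ 2 ∂M.lawObs := by
          refine integral_mono_of_nonneg (ae_of_all _ fun v => sq_nonneg _)
            ((integrable_finsetSum _ fun l _ => hi l).const_mul _) ?_
          filter_upwards [h2.bdd] with v hv
          exact (Finset.sum_mul_sq_le_sq_mul_sq _ _ _).trans
            (mul_le_mul_of_nonneg_right hv (Finset.sum_nonneg fun _ _ => sq_nonneg _))
      _ = ζ ^ 2 * ∑ l, eucl (N l) ^ 2 := by
          rw [integral_const_mul, integral_finsetSum _ fun l _ => hi l]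
          simp_rw [h3.integral_lin_sq, eucl_sq]
      _ ≤ _ := mul_le_mul_of_nonneg_left (sum_eucl_row_sq_le hN) (sq_nonneg _)
  -- The mean of the diagonal pairs i = j. `hκ` is the only input that depends on which of the two
  -- systems consists of instruments.
  have e3 : ∑ a, (∫ v, φ a v * ∑ l, χ l v * ((∑ k, M.instr Rb k v * N l k) * M.resid v)
      ∂M.lawObs) ^ 2 ≤ s * (ζ ^ 2 * (C ^ 2 * K)) := by
    refine le_trans (le_of_eq ?_) (hκ.trans (mul_le_mul_of_nonneg_left e2 hs0))
    refine Finset.sum_congr rfl fun a _ => ?_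
    congr 2; ext v
    rw [Finset.sum_mul]
    congr 1
    exact Finset.sum_congr rfl fun l _ => by ring
  have hn0 : (0 : ℝ) < n := by positivity
  have hK : (0 : ℝ) ≤ s * (C ^ 2 * K) := by positivity
  -- Here 1 ≤ ζ² ≤ n lets the third-order term be absorbed by ζ²/n². The constant 24 of the
  -- conclusion is 20 from here plus 4 from the diagonal mean.
  have e4 : 4 * (ζ ^ 2 / (n : ℝ) ^ 2 + 2 * (ζ ^ 4 + 1) / n ^ 3) ≤ 20 * (ζ ^ 2 / n ^ 2) := by
    have a1 : (ζ ^ 4 + 1) / (n : ℝ) ^ 3 ≤ 2 * (ζ ^ 2 / n ^ 2) := by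
      have : 2 * (ζ ^ 2 / (n : ℝ) ^ 2) = 2 * (ζ ^ 2 * n) / n ^ 3 := by field_simp
      rw [this]
      refine div_le_div_of_nonneg_right ?_ (by positivity)
      nlinarith
    have : 2 * (ζ ^ 4 + 1) / (n : ℝ) ^ 3 = 2 * ((ζ ^ 4 + 1) / (n : ℝ) ^ 3) := by ring
    rw [this]; linarith
  have e5 : (0 : ℝ) ≤ 4 * (ζ ^ 2 / (n : ℝ) ^ 2 + 2 * (ζ ^ 4 + 1) / n ^ 3) := by positivity
  have e6 : (0 : ℝ) ≤ 4 / (n : ℝ) ^ 2 := by positivity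
  refine (add_le_add (mul_le_mul_of_nonneg_left e1 e5) (mul_le_mul_of_nonneg_left e3 e6)).trans ?_
  have e7 := mul_le_mul_of_nonneg_right e4 hK
  refine (add_le_add e7 le_rfl).trans (le_of_eq ?_)
  rw [div_pow, mul_pow, mul_pow, Real.sq_sqrt (Nat.cast_nonneg K)]
  ring

include hM hφ hs hu in
-- `F` may depend on X, so the conditional variance bound does not apply to Fu. By duality, ∑ wₐ² =
-- E[F·(∑ b̃ₐwₐ)u], and after Cauchy–Schwarz the bound is applied to the function ∑ b̃ₐwₐ of W.
theorem sum_integral_instr_mul_sq_le (hs0 : 0 ≤ s) {F : Obs d dw → ℝ} (hF : Measurable F) {B : ℝ}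
    (hB : ∀ᵐ v ∂M.lawObs, |F v| ≤ B) :
    ∑ a, (∫ v, M.instr Rb a v * (F v * M.resid v) ∂M.lawObs) ^ 2 ≤
      s * ∫ v, F v ^ 2 ∂M.lawObs := by
  have := hM.isProbabilityMeasure_lawObs
  have h3 : IsBddOrtho M.lawObs (M.instr Rb) ζ := hφ.comp hM.measurePreserving_snd
  set w : Fin K → ℝ := fun a => ∫ v, M.instr Rb a v * (F v * M.resid v) ∂M.lawObs with hw
  have hF2 : MemLp F 2 M.lawObs := MemLp.of_bound hF.aestronglyMeasurable B hB
  have hFu : MemLp (fun v => F v * M.resid v) 2 M.lawObs :=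
    memLp_bdd_mul hF hB (hM.memLp_resid hu)
  have hg := instr_lin_mul_resid hM hu hφ w
  have e1 : ∑ a, w a ^ 2 = ∫ v, F v * ((∑ k, M.instr Rb k v * w k) * M.resid v) ∂M.lawObs := by
    have : ∀ v, F v * ((∑ k, M.instr Rb k v * w k) * M.resid v) =
        ∑ k, (M.instr Rb k v * (F v * M.resid v)) * w k := fun v => by
      rw [Finset.sum_mul, Finset.mul_sum]; exact Finset.sum_congr rfl fun k _ => by ring
    simp_rw [this]
    have hi : ∀ k, Integrable (fun v => (M.instr Rb k v * (F v * M.resid v)) * w k) M.lawObs :=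
      fun k => ((h3.memLp k 2).integrable_mul hFu).mul_const _
    rw [integral_finsetSum _ fun k _ => hi k]
    refine Finset.sum_congr rfl fun k _ => ?_
    rw [integral_mul_const, sq]
  have e2 := integral_mul_le_l2Norm hF2 hg.2.1
  have e3 : l2Norm M.lawObs (fun v => (∑ k, M.instr Rb k v * w k) * M.resid v) ^ 2 ≤
      s * ∑ a, w a ^ 2 := by
    rw [l2Norm_sq, ← eucl_sq]; exact integral_instr_lin_mul_resid_sq_le hM hφ hs w
  have e4 := l2Norm_sq M.lawObs F
  set q := ∑ a, w a ^ 2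
  have hq : 0 ≤ q := Finset.sum_nonneg fun _ _ => sq_nonneg _
  rw [← e4]
  rcases hq.eq_or_lt with h0 | h0
  · rw [← h0]; positivity
  · have e5 : q ≤ l2Norm M.lawObs F *
        l2Norm M.lawObs (fun v => (∑ k, M.instr Rb k v * w k) * M.resid v) := by
      rw [e1]; exact e2
    have e6 : q ^ 2 ≤ l2Norm M.lawObs F ^ 2 * (s * q) := by
      refine (pow_le_pow_left₀ h0.le e5 2).trans ?_
      rw [mul_pow]
      exact mul_le_mul_of_nonneg_left e3 (sq_nonneg _)
    by_contra hc
    push Not at hc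
    nlinarith

include hM hs hu in
-- The counterpart in which φ is arbitrary and the multiplier depends on W only: Bessel's
-- inequality, then the conditional variance bound for f(W)u.
theorem sum_integral_mul_resid_sq_le {m : ℕ} {φ : Fin m → Obs d dw → ℝ} {ζ : ℝ}
    (h1 : IsBddOrtho M.lawObs φ ζ) {f : EuclideanSpace ℝ (Fin dw) → ℝ} (hf : Measurable f) {B : ℝ}
    (hB : ∀ᵐ w ∂M.lawW, |f w| ≤ B) :
    ∑ a, (∫ v, φ a v * (f v.2.2 * M.resid v) ∂M.lawObs) ^ 2 ≤
      s * ∫ v, f v.2.2 ^ 2 ∂M.lawObs := by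
  have := hM.isProbabilityMeasure_lawObs
  have hp := hM.measurePreserving_snd
  have hfu : MemLp (fun v => f v.2.2 * M.resid v) 2 M.lawObs :=
    memLp_bdd_mul (hf.comp (by fun_prop)) (hp.quasiMeasurePreserving.ae hB)
      (hM.memLp_resid hu)
  refine (h1.bessel hfu).trans ((hs f hf ⟨B, hB⟩).trans (le_of_eq ?_))
  rw [← hp.map_eq, integral_map hp.measurable.aemeasurable (hf.pow_const 2).aestronglyMeasurable]

end

end NPIV

/-! ### Population and sample objects in whitened coordinates. -/

/-- Two-stage least squares is equivariant under a change of basis on either side. With G⁻¹ = R'R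
the weighting matrix disappears and the plain left inverse (S'S)⁻¹S' remains. -/
theorem tsls_coeff_eq {m k : ℕ} {A : Matrix (Fin m) (Fin k) ℝ} {Rb : Matrix (Fin m) (Fin m) ℝ}
    {Rp : Matrix (Fin k) (Fin k) ℝ} (hRp : IsUnit Rp.det) {S : Matrix (Fin m) (Fin k) ℝ}
    (hS : S = Rb * A * Rpᵀ) (hu : IsUnit (Sᵀ * S).det) (v : Fin m → ℝ) :
    (Aᵀ * (Rbᵀ * Rb) * A)⁻¹ *ᵥ ((Aᵀ * (Rbᵀ * Rb)) *ᵥ v) =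
      Rpᵀ *ᵥ (((Sᵀ * S)⁻¹ * Sᵀ) *ᵥ (Rb *ᵥ v)) := by
  have e1 : Rp * (Aᵀ * Rbᵀ) = Sᵀ := by
    rw [hS, Matrix.transpose_mul, Matrix.transpose_mul, Matrix.transpose_transpose]
  have e2 : Aᵀ * Rbᵀ = Rp⁻¹ * Sᵀ := by
    rw [← e1, ← Matrix.mul_assoc, Matrix.nonsing_inv_mul _ hRp, Matrix.one_mul]
  have e3 : Aᵀ * (Rbᵀ * Rb) * A * (Rpᵀ * (Sᵀ * S)⁻¹ * Rp) = 1 := by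
    calc _ = (Aᵀ * Rbᵀ) * (Rb * A * Rpᵀ) * (Sᵀ * S)⁻¹ * Rp := by simp only [Matrix.mul_assoc]
      _ = Rp⁻¹ * ((Sᵀ * S) * (Sᵀ * S)⁻¹) * Rp := by
          rw [← hS, e2]; simp only [Matrix.mul_assoc]
      _ = 1 := by
          rw [Matrix.mul_nonsing_inv _ hu, Matrix.mul_one, Matrix.nonsing_inv_mul _ hRp]
  rw [Matrix.inv_eq_right_inv e3, Matrix.mulVec_mulVec, Matrix.mulVec_mulVec, Matrix.mulVec_mulVec]
  congr 1
  rw [← e1]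
  simp only [Matrix.mul_assoc]

/-- `R φ` are orthonormal functions with the same span as `φ`. -/
structure IsWhitening {α : Type*} [MeasurableSpace α] (ν : Measure α) {m : ℕ} (φ : Fin m → α → ℝ)
    (R : Matrix (Fin m) (Fin m) ℝ) : Prop where
  isUnit : IsUnit R.det
  eq_one : R * gramMat ν φ * Rᵀ = 1
  inv_eq : (gramMat ν φ)⁻¹ = Rᵀ * R

namespace NPIV

variable {Ω : Type*} [MeasurableSpace Ω] {d dw : ℕ} {M : NPIV Ω d dw} {J K : ℕ} {ζ : ℝ}
  {Rb : Matrix (Fin K) (Fin K) ℝ} {Rp : Matrix (Fin J) (Fin J) ℝ}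

/-- The coefficients of `Π_J h` with respect to the whitened basis. -/
noncomputable def coeffX (M : NPIV Ω d dw) (Rp : Matrix (Fin J) (Fin J) ℝ)
    (h : EuclideanSpace ℝ (Fin d) → ℝ) (j : Fin J) : ℝ :=
  ∫ x, whiten Rp (M.ψ J) j x * h x ∂M.lawX

/-- The vector `E[R b^K(W) h(X)]`. -/
noncomputable def coeffW (M : NPIV Ω d dw) (Rb : Matrix (Fin K) (Fin K) ℝ)
    (h : EuclideanSpace ℝ (Fin d) → ℝ) (k : Fin K) : ℝ :=
  ∫ v, M.instr Rb k v * h v.1 ∂M.lawObs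

/-- The matrix `E[R b^K(W) (R' ψ^J(X))']`. -/
noncomputable abbrev crossW (M : NPIV Ω d dw) (Rb : Matrix (Fin K) (Fin K) ℝ)
    (Rp : Matrix (Fin J) (Fin J) ℝ) : Matrix (Fin K) (Fin J) ℝ :=
  crossMean M.lawObs (M.instr Rb) (M.regr Rp)

/-- The left inverse `(S'S)⁻¹S'`. -/
noncomputable def leftInv {m k : ℕ} (S : Matrix (Fin m) (Fin k) ℝ) : Matrix (Fin k) (Fin m) ℝ :=
  (Sᵀ * S)⁻¹ * Sᵀ

section

variable (hM : M.IsModel) (hd : M.RegressorDensity)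

theorem IsModel.memLp_instrBasis (hM : M.IsModel) (h : IsBasisArray M.lawW M.WW M.b) (k : Fin K) :
    MemLp (fun v : Obs d dw => M.b K k v.2.2) 2 M.lawObs :=
  (hM.memLp_basisW h k 2).comp_measurePreserving hM.measurePreserving_snd

include hd in
theorem IsModel.memLp_regrBasis (hM : M.IsModel) (h : IsBasisArray M.lawX M.XX M.ψ) (j : Fin J) :
    MemLp (fun v : Obs d dw => M.ψ J j v.1) 2 M.lawObs :=
  (hM.memLp_basisX hd h j 2).comp_measurePreserving hM.measurePreserving_fst

include hM in
theorem integral_obs {f : Obs d dw → ℝ} (hf : Measurable f) :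
    ∫ v, f v ∂M.lawObs = ∫ ω, f (M.obs 0 ω) ∂M.μ := by
  rw [lawObs, integral_map (hM.measurable_obs 0).aemeasurable hf.aestronglyMeasurable]

include hM hd in
theorem crossW_eq (hX : IsBasisArray M.lawX M.XX M.ψ) (hW : IsBasisArray M.lawW M.WW M.b) :
    M.crossW Rb Rp = Rb * M.S J K * Rpᵀ := by
  have hi : ∀ k j, Integrable (fun v : Obs d dw => M.b K k v.2.2 * M.ψ J j v.1) M.lawObs :=
    fun k j => (hM.memLp_instrBasis hW k).integrable_mul (hM.memLp_regrBasis hd hX j)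
  have hS : ∀ k j, M.S J K k j = ∫ v, M.b K k v.2.2 * M.ψ J j v.1 ∂M.lawObs := fun k j => by
    have hm : Measurable fun v : Obs d dw => M.b K k v.2.2 * M.ψ J j v.1 :=
      ((hW.measurable K k).comp (by fun_prop)).mul ((hX.measurable J j).comp measurable_fst)
    exact (integral_obs hM hm).symm
  ext a b
  have e : ∀ v, M.instr Rb a v * M.regr Rp b v =
      ∑ j, ∑ k, (Rb a k * Rp b j) * (M.b K k v.2.2 * M.ψ J j v.1) := fun v => by
    simp only [instr, regr, whiten, Matrix.mulVec, dotProduct, Finset.sum_mul_sum]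
    rw [Finset.sum_comm]
    exact Finset.sum_congr rfl fun _ _ => Finset.sum_congr rfl fun _ _ => by ring
  rw [crossW, crossMean, Matrix.of_apply]
  simp_rw [e]
  rw [integral_finsetSum _ fun j _ => integrable_finsetSum _ fun k _ => (hi k j).const_mul _,
    Matrix.mul_apply]
  refine Finset.sum_congr rfl fun j _ => ?_
  rw [integral_finsetSum _ fun k _ => (hi k j).const_mul _, Matrix.mul_apply, Finset.sum_mul]
  refine Finset.sum_congr rfl fun k _ => ?_
  rw [integral_const_mul, hS, Matrix.transpose_apply]
  ring

include hM hd in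
theorem crossW_injective (hX : IsBasisArray M.lawX M.XX M.ψ) (hW : IsBasisArray M.lawW M.WW M.b)
    (hb : IsWhitening M.lawW (M.b K) Rb) (hp : IsWhitening M.lawX (M.ψ J) Rp)
    (hr : (M.S J K).rank = J) : Function.Injective (M.crossW Rb Rp).mulVec := by
  apply mulVec_injective_of_rank
  rw [crossW_eq hM hd hX hW, Matrix.rank_mul_eq_left_of_isUnit_det,
    Matrix.rank_mul_eq_right_of_isUnit_det _ _ hb.isUnit, hr]
  rw [Matrix.det_transpose]; exact hp.isUnit

include hM hd in
theorem Q_eq (hX : IsBasisArray M.lawX M.XX M.ψ) (hW : IsBasisArray M.lawW M.WW M.b)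
    (hb : IsWhitening M.lawW (M.b K) Rb) (hp : IsWhitening M.lawX (M.ψ J) Rp)
    (hu : IsUnit ((M.crossW Rb Rp)ᵀ * M.crossW Rb Rp).det)
    {h : EuclideanSpace ℝ (Fin d) → ℝ} (hh : Measurable h) (hh2 : MemLp h 2 M.lawX) :
    M.Q J K h = M.sieveFun Rp (leftInv (M.crossW Rb Rp) *ᵥ M.coeffW Rb h) := by
  have e : Rb *ᵥ (fun k => ∫ ω, M.b K k (M.W 0 ω) * h (M.X 0 ω) ∂M.μ) = M.coeffW Rb h := by
    have hm : ∀ k, ∫ ω, M.b K k (M.W 0 ω) * h (M.X 0 ω) ∂M.μ =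
        ∫ v, M.b K k v.2.2 * h v.1 ∂M.lawObs := fun k => by
      have hm : Measurable fun v : Obs d dw => M.b K k v.2.2 * h v.1 :=
        ((hW.measurable K k).comp (by fun_prop)).mul (hh.comp measurable_fst)
      exact (integral_obs hM hm).symm
    have hi : ∀ k, Integrable (fun v : Obs d dw => M.b K k v.2.2 * h v.1) M.lawObs := fun k =>
      (hM.memLp_instrBasis hW k).integrable_mul
        (hh2.comp_measurePreserving hM.measurePreserving_fst)
    ext a
    simp only [coeffW, instr, whiten, Matrix.mulVec, dotProduct, Finset.sum_mul, mul_assoc, hm]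
    rw [integral_finsetSum _ fun k _ => (hi k).const_mul _]
    simp [integral_const_mul]
  rw [sieveFun_eq, leftInv, ← e, ← tsls_coeff_eq hp.isUnit (crossW_eq hM hd hX hW) hu, Q, hb.inv_eq]

include hM hd in
theorem projX_eq (hX : IsBasisArray M.lawX M.XX M.ψ) (hp : IsWhitening M.lawX (M.ψ J) Rp)
    {h : EuclideanSpace ℝ (Fin d) → ℝ} (hh2 : MemLp h 2 M.lawX) :
    M.projX J h = M.sieveFun Rp (M.coeffX Rp h) :=
  funext fun x => l2Proj_eq_whiten hp.inv_eq
    (fun j => (hM.memLp_basisX hd hX j 2).integrable_mul hh2) x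

variable (hχ : IsBddOrtho M.lawX (whiten Rp (M.ψ J)) ζ)
  (hφ : IsBddOrtho M.lawW (whiten Rb (M.b K)) ζ)

include hM hχ hφ in
theorem coeffW_sub_sieveFun {h : EuclideanSpace ℝ (Fin d) → ℝ} (hh2 : MemLp h 2 M.lawX)
    (c : Fin J → ℝ) :
    M.coeffW Rb (h - M.sieveFun Rp c) = M.coeffW Rb h - M.crossW Rb Rp *ᵥ c := by
  have := hM.isProbabilityMeasure_lawObs
  have h1 : IsBddOrtho M.lawObs (M.instr Rb) ζ := hφ.comp hM.measurePreserving_snd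
  have h2 : IsBddOrtho M.lawObs (M.regr Rp) ζ := hχ.comp hM.measurePreserving_fst
  ext k
  rw [Pi.sub_apply, h1.crossMean_mulVec h2]
  simp only [coeffW, Pi.sub_apply, mul_sub]
  rw [integral_sub]
  · rfl
  · exact (h1.memLp k 2).integrable_mul (hh2.comp_measurePreserving hM.measurePreserving_fst)
  · exact (h1.memLp k 2).integrable_mul (h2.memLp_lin c 2)

include hM hd hχ hφ in
/-- `Q_J h - Π_J h = Q_J (h - Π_J h)`. -/
theorem Q_sub_projX (hX : IsBasisArray M.lawX M.XX M.ψ) (hW : IsBasisArray M.lawW M.WW M.b)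
    (hb : IsWhitening M.lawW (M.b K) Rb) (hp : IsWhitening M.lawX (M.ψ J) Rp)
    (hu : IsUnit ((M.crossW Rb Rp)ᵀ * M.crossW Rb Rp).det)
    {h : EuclideanSpace ℝ (Fin d) → ℝ} (hh : Measurable h) (hh2 : MemLp h 2 M.lawX) :
    M.Q J K h - M.projX J h =
      M.sieveFun Rp (leftInv (M.crossW Rb Rp) *ᵥ M.coeffW Rb (h - M.projX J h)) := by
  rw [Q_eq hM hd hX hW hb hp hu hh hh2, projX_eq hM hd hX hp hh2,
    coeffW_sub_sieveFun hM hχ hφ hh2, Matrix.mulVec_sub, Matrix.mulVec_mulVec,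
    show leftInv (M.crossW Rb Rp) * M.crossW Rb Rp = 1 by
      rw [leftInv, Matrix.mul_assoc, Matrix.nonsing_inv_mul _ hu], Matrix.one_mulVec]
  ext x
  simp [sieveFun, mul_sub, Finset.sum_sub_distrib]

include hM hφ in
theorem eucl_coeffW_le {h : EuclideanSpace ℝ (Fin d) → ℝ} (hh : Measurable h)
    (hh2 : MemLp h 2 M.lawX) : eucl (M.coeffW Rb h) ≤ M.normW (M.T h) := by
  have := hM.isProbabilityMeasure_lawW
  refine le_of_sq_le_sq ?_ (l2Norm_nonneg _ _)
  rw [normW, l2Norm_sq, eucl_sq]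
  simp_rw [coeffW, integral_instr_mul hM hφ hh hh2]
  exact hφ.bessel (hM.memLp_T hh hh2)

include hM hd in
theorem normX_le_supNorm {h : EuclideanSpace ℝ (Fin d) → ℝ}
    (hb : BoundedOn M.XX h) : M.normX h ≤ supNorm M.XX h := by
  have := hM.isProbabilityMeasure_lawX
  refine le_of_sq_le_sq ?_ (supNorm_nonneg _ _)
  rw [normX, l2Norm_sq]
  calc ∫ x, h x ^ 2 ∂M.lawX ≤ ∫ _x, supNorm M.XX h ^ 2 ∂M.lawX := by
        refine integral_mono_of_nonneg (ae_of_all _ fun _ => sq_nonneg _) (integrable_const _) ?_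
        filter_upwards [hd.mem_XX] with x hx
        rw [← sq_abs (h x)]
        exact pow_le_pow_left₀ (abs_nonneg _) (hb.abs_le_supNorm hx) 2
    _ = _ := by simp

end

section Sample

theorem crossSample_instr_regr (n : ℕ) (ω : Ω) :
    crossSample M.obs n (M.instr Rb) (M.regr Rp) ω =
      (n : ℝ)⁻¹ • (Rb * (M.designW n K ω)ᵀ * M.designX n J ω * Rpᵀ) := by
  ext a b
  rw [Matrix.mul_assoc, Matrix.smul_apply, Matrix.mul_apply, crossSample, Matrix.of_apply,
    sampleMean, sampleSum, Finset.sum_range, smul_eq_mul, div_eq_inv_mul]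
  congr 1
  refine Finset.sum_congr rfl fun i _ => ?_
  congr 1
  simp [regr, whiten, Matrix.mul_apply, Matrix.mulVec, dotProduct, designX, obs, mul_comm]

theorem crossSample_instr_instr (n : ℕ) (ω : Ω) :
    crossSample M.obs n (M.instr Rb) (M.instr Rb) ω =
      (n : ℝ)⁻¹ • (Rb * (M.designW n K ω)ᵀ * M.designW n K ω * Rbᵀ) := by
  ext a b
  rw [Matrix.mul_assoc, Matrix.smul_apply, Matrix.mul_apply, crossSample, Matrix.of_apply,
    sampleMean, sampleSum, Finset.sum_range, smul_eq_mul, div_eq_inv_mul]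
  congr 1
  refine Finset.sum_congr rfl fun i _ => ?_
  congr 1
  simp [instr, whiten, Matrix.mul_apply, Matrix.mulVec, dotProduct, designW, obs, mul_comm]

theorem sampleMean_instr_mul_response (n : ℕ) (ω : Ω) :
    (n : ℝ)⁻¹ • (Rb *ᵥ ((M.designW n K ω)ᵀ *ᵥ fun i : Fin n => M.Y i ω)) =
      fun k => sampleMean M.obs n (fun v => M.instr Rb k v * v.2.1) ω := by
  ext a
  rw [Matrix.mulVec_mulVec, Pi.smul_apply, sampleMean, sampleSum, Finset.sum_range, smul_eq_mul,
    div_eq_inv_mul]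
  rfl

/-- Expansion of the coefficient vector of the estimator around that of the projection. -/
theorem hHat_expansion {ginv : ∀ m : ℕ, Matrix (Fin m) (Fin m) ℝ → Matrix (Fin m) (Fin m) ℝ}
    (hg : IsGenInverse ginv) (hRb : IsUnit Rb.det) (hRp : IsUnit Rp.det) {s : ℝ} (hs : 0 < s)
    (hS : ∀ c, s * eucl c ≤ eucl (M.crossW Rb Rp *ᵥ c)) {n : ℕ} {ω : Ω}
    (hSh : ∀ c, eucl ((crossSample M.obs n (M.instr Rb) (M.regr Rp) ω - M.crossW Rb Rp) *ᵥ c)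
      ≤ s / 2 * eucl c)
    (hGh : ∀ v, eucl ((crossSample M.obs n (M.instr Rb) (M.instr Rb) ω - 1) *ᵥ v)
      ≤ 1 / 2 * eucl v) (c₀ : Fin J → ℝ) {ρh : Fin K → ℝ}
    (hρh : ρh = fun k => sampleMean M.obs n
      (fun v => M.instr Rb k v * (M.h₀ - M.sieveFun Rp c₀) v.1) ω) :
    ∃ (c : Fin J → ℝ) (q : Fin K → ℝ), M.hHat ginv n J K ω = M.sieveFun Rp c ∧
      crossSample M.obs n (M.instr Rb) (M.regr Rp) ω *ᵥ (c - c₀) -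
        crossSample M.obs n (M.instr Rb) (M.instr Rb) ω *ᵥ q = ρh + M.noise Rb n ω ∧
      (crossSample M.obs n (M.instr Rb) (M.regr Rp) ω)ᵀ *ᵥ q = 0 := by
  -- A perturbation of the identity of norm at most 1/2 has coercivity constant at least 1/2.
  have hco : ∀ v : Fin K → ℝ, 1 / 2 * eucl v ^ 2 ≤
      v ⬝ᵥ (crossSample M.obs n (M.instr Rb) (M.instr Rb) ω *ᵥ v) := by
    intro v
    have e : v ⬝ᵥ (crossSample M.obs n (M.instr Rb) (M.instr Rb) ω *ᵥ v) =
        eucl v ^ 2 + v ⬝ᵥ ((crossSample M.obs n (M.instr Rb) (M.instr Rb) ω - 1) *ᵥ v) := by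
      rw [Matrix.sub_mulVec, Matrix.one_mulVec, dotProduct_sub, eucl_sq_dot]; ring
    have h1 := abs_dotProduct_le v
      ((crossSample M.obs n (M.instr Rb) (M.instr Rb) ω - 1) *ᵥ v)
    have h2 := mul_le_mul_of_nonneg_left (hGh v) (eucl_nonneg v)
    have h3 := neg_le_of_abs_le h1
    rw [e]; nlinarith
  have hinj : ∀ c, crossSample M.obs n (M.instr Rb) (M.regr Rp) ω *ᵥ c = 0 → c = 0 := by
    intro c hc
    have h1 := hSh c
    rw [Matrix.sub_mulVec, hc, zero_sub, eucl_neg] at h1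
    have h2 := hS c
    have h3 : s / 2 * eucl c ≤ 0 := by linarith
    have h4 := eucl_nonneg c
    exact eucl_eq_zero.1 (le_antisymm (by nlinarith) h4)
  obtain ⟨c, q, h1, h2, h3⟩ := tsls_normal_equations hg hRb hRp
    (crossSample_instr_regr (M := M) (Rb := Rb) (Rp := Rp) n ω)
    (crossSample_instr_instr (M := M) (Rb := Rb) n ω) hco hinj (fun i : Fin n => M.Y i ω)
  refine ⟨c, q, ?_, ?_, h3⟩
  · rw [sieveFun_eq, ← h1]; rfl
  · rw [sampleMean_instr_mul_response] at h2
    -- Y minus the sieve function of c₀ is (h₀ minus that function) plus u, which splits the right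
    -- side into `ρh` and the noise.
    rw [Matrix.mulVec_sub, sub_right_comm, h2, hρh]
    ext k
    rw [Pi.sub_apply, crossSample_mulVec]
    simp only [Pi.add_apply, noise, sampleMean, sampleSum, Pi.sub_apply, resid]
    rw [← sub_div, ← add_div, ← Finset.sum_sub_distrib, ← Finset.sum_add_distrib]
    congr 1
    refine Finset.sum_congr rfl fun i _ => ?_
    simp only [sieveFun, regr]
    ring

end Sample

end NPIV

/-! ### Second moment domination. -/

section SqDominated

variable {Ω : Type*} [MeasurableSpace Ω] {μ : Measure Ω} {Z Z' : Ω → ℝ} {b b' : ℝ}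

/-- The (outer) second moment of `Z` is at most `b²`. -/
def SqDominated (μ : Measure Ω) (Z : Ω → ℝ) (b : ℝ) : Prop :=
  ∃ G : Ω → ℝ, (∀ ω, Z ω ^ 2 ≤ G ω) ∧ Integrable G μ ∧ ∫ ω, G ω ∂μ ≤ b ^ 2

namespace SqDominated

theorem of_integrable (h : Integrable (fun ω => Z ω ^ 2) μ) (hb : ∫ ω, Z ω ^ 2 ∂μ ≤ b ^ 2) :
    SqDominated μ Z b := ⟨_, fun _ => le_rfl, h, hb⟩

theorem mono (h : SqDominated μ Z b) (hb : 0 ≤ b) (hbb : b ≤ b') : SqDominated μ Z b' := by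
  obtain ⟨G, h1, h2, h3⟩ := h
  exact ⟨G, h1, h2, h3.trans (pow_le_pow_left₀ hb hbb 2)⟩

theorem const_mul (h : SqDominated μ Z b) (a : ℝ) : SqDominated μ (fun ω => a * Z ω) (a * b) := by
  obtain ⟨G, h1, h2, h3⟩ := h
  refine ⟨fun ω => a ^ 2 * G ω, fun ω => ?_, h2.const_mul _, ?_⟩
  · rw [mul_pow]; exact mul_le_mul_of_nonneg_left (h1 ω) (sq_nonneg a)
  · rw [integral_const_mul, mul_pow]; exact mul_le_mul_of_nonneg_left h3 (sq_nonneg a)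

theorem add (h : SqDominated μ Z b) (h' : SqDominated μ Z' b') (hb : 0 ≤ b) (hb' : 0 ≤ b') :
    SqDominated μ (fun ω => Z ω + Z' ω) (2 * (b + b')) := by
  obtain ⟨G, h1, h2, h3⟩ := h
  obtain ⟨G', h1', h2', h3'⟩ := h'
  refine ⟨fun ω => 2 * G ω + 2 * G' ω, fun ω => ?_, (h2.const_mul 2).add (h2'.const_mul 2), ?_⟩
  · nlinarith [h1 ω, h1' ω, sq_nonneg (Z ω - Z' ω)]
  · rw [integral_add (h2.const_mul 2) (h2'.const_mul 2), integral_const_mul, integral_const_mul]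
    nlinarith [mul_nonneg hb hb']

end SqDominated

theorem IsBigOInProb.of_sqDominated [IsProbabilityMeasure μ] {Z : ℕ → Ω → ℝ} {r : ℕ → ℝ} {c : ℝ}
    (hr : ∀ n, 0 ≤ r n) (h : ∀ᶠ n in atTop, SqDominated μ (Z n) (c * r n)) :
    IsBigOInProb μ Z r := by
  have : ∀ n, ∃ G : Ω → ℝ, SqDominated μ (Z n) (c * r n) → (∀ ω, Z n ω ^ 2 ≤ G ω) ∧
      Integrable G μ ∧ ∫ ω, G ω ∂μ ≤ (c * r n) ^ 2 := fun n => by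
    by_cases hn : SqDominated μ (Z n) (c * r n)
    · obtain ⟨G, hG⟩ := hn
      exact ⟨G, fun _ => hG⟩
    · exact ⟨0, fun h => absurd h hn⟩
  choose G hG using this
  have key : IsBigOInProb μ (fun n ω => Real.sqrt (G n ω)) r := by
    refine IsBigOInProb.of_sq (sq_nonneg c) hr (h.mono fun n hn => ?_)
    obtain ⟨h1, h2, h3⟩ := hG n hn
    have e : (fun ω => Real.sqrt (G n ω) ^ 2) = G n :=
      funext fun ω => Real.sq_sqrt ((sq_nonneg _).trans (h1 ω))
    rw [e, ← mul_pow]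
    exact ⟨h2, h3⟩
  refine key.of_le (B := fun _ => ∅) (by simp) (h.mono fun n hn => ae_of_all _ fun ω _ => ?_)
  rw [abs_of_nonneg (Real.sqrt_nonneg _)]
  exact Real.abs_le_sqrt ((hG n hn).1 ω)

end SqDominated

theorem crossSample_transpose {Ω 𝒱 : Type*} {V : ℕ → Ω → 𝒱} {m k : ℕ} (φ : Fin m → 𝒱 → ℝ)
    (χ : Fin k → 𝒱 → ℝ) (n : ℕ) (ω : Ω) :
    (crossSample V n φ χ ω)ᵀ = crossSample V n χ φ ω := by
  ext a b
  simp [crossSample, mul_comm]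

theorem IsBddOrtho.exists_abs_bilin_le {𝒱 : Type*} [MeasurableSpace 𝒱] {ν : Measure 𝒱} {m k : ℕ}
    {χ : Fin m → 𝒱 → ℝ} {φ : Fin k → 𝒱 → ℝ} {ζ : ℝ} (h1 : IsBddOrtho ν χ ζ)
    (h2 : IsBddOrtho ν φ ζ) (N : Matrix (Fin m) (Fin k) ℝ) :
    Measurable (fun v => ∑ l, χ l v * ∑ k, φ k v * N l k) ∧
    ∀ᵐ v ∂ν, |∑ l, χ l v * ∑ k, φ k v * N l k| ≤ ∑ l, |ζ| * (|ζ| * eucl (N l)) := by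
  refine ⟨Finset.measurable_fun_sum _ fun l _ => (h1.measurable l).mul (h2.measurable_lin (N l)), ?_⟩
  filter_upwards [ae_all_iff.2 h1.abs_le, ae_all_iff.2 fun l => h2.exists_abs_lin_le (N l)]
    with v hv hv'
  refine (Finset.abs_sum_le_sum_abs _ _).trans (Finset.sum_le_sum fun l _ => ?_)
  rw [abs_mul]
  exact mul_le_mul (hv l) (hv' l) (abs_nonneg _) (abs_nonneg _)

/-! ### Deterministic decomposition of the uniform error. -/

namespace NPIV

variable {Ω : Type*} [MeasurableSpace Ω] {d dw : ℕ} {M : NPIV Ω d dw} {J K : ℕ}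
  {Rb : Matrix (Fin K) (Fin K) ℝ} {Rp : Matrix (Fin J) (Fin J) ℝ}

/-- Population properties of the whitened sieves. -/
structure IsRegular (M : NPIV Ω d dw) {J K : ℕ} (Rb : Matrix (Fin K) (Fin K) ℝ)
    (Rp : Matrix (Fin J) (Fin J) ℝ) : Prop where
  basisX : IsBasisArray M.lawX M.XX M.ψ
  basisW : IsBasisArray M.lawW M.WW M.b
  whitenX : IsWhitening M.lawX (M.ψ J) Rp
  whitenW : IsWhitening M.lawW (M.b K) Rb
  orthoX : IsBddOrtho M.lawX (whiten Rp (M.ψ J)) (M.zeta J K)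
  orthoW : IsBddOrtho M.lawW (whiten Rb (M.b K)) (M.zeta J K)
  one_le_tau : 1 ≤ M.tau J
  one_le_zeta : 1 ≤ M.zeta J K
  lower : ∀ c, 1 / (2 * M.tau J) * eucl c ≤ eucl (M.crossW Rb Rp *ᵥ c)

namespace IsRegular

variable (h : M.IsRegular Rb Rp)

include h

theorem s_pos : 0 < 1 / (2 * M.tau J) := by have := h.one_le_tau; positivity

theorem eucl_leftInv_le (v : Fin K → ℝ) :
    eucl (leftInv (M.crossW Rb Rp) *ᵥ v) ≤ 2 * M.tau J * eucl v := by
  refine ((leftInverse_props h.s_pos h.lower).2.2.2 v).trans (le_of_eq ?_)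
  have := h.one_le_tau
  field_simp

/-- Used for the remainder, whose Euclidean size is small enough to pay the factor ζ. -/
theorem abs_sieveFun_le_zeta (c : Fin J → ℝ) {x : EuclideanSpace ℝ (Fin d)} (hx : x ∈ M.XX) :
    |M.sieveFun Rp c x| ≤ M.zeta J K * eucl c := by
  refine (abs_dotProduct_le (fun j => whiten Rp (M.ψ J) j x) c).trans
    (mul_le_mul_of_nonneg_right ?_ (eucl_nonneg _))
  exact (eucl_whiten_le_zetaSup (h.basisX.bounded J) h.whitenX.inv_eq hx).trans (le_max_right _ _)

/-- Used for the leading noise: ℓ¹–ℓ^∞ duality in the original basis reduces the supremum over x to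
a maximum over J coordinates, at the price of a logarithm. -/
theorem abs_sieveFun_le_xi (c : Fin J → ℝ) {x : EuclideanSpace ℝ (Fin d)} (hx : x ∈ M.XX) :
    |M.sieveFun Rp c x| ≤ M.xi J * ‖Rpᵀ *ᵥ c‖ := by
  rw [sieveFun_eq]
  calc |∑ j, M.ψ J j x * (Rpᵀ *ᵥ c) j| ≤ ∑ j, |M.ψ J j x| * ‖Rpᵀ *ᵥ c‖ := by
        refine (Finset.abs_sum_le_sum_abs _ _).trans (Finset.sum_le_sum fun j _ => ?_)
        rw [abs_mul]
        exact mul_le_mul_of_nonneg_left (norm_le_pi_norm (Rpᵀ *ᵥ c) j) (abs_nonneg _)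
    _ ≤ _ := by
        rw [← Finset.sum_mul]
        exact mul_le_mul_of_nonneg_right
          (BoundedOn.sum_abs_le_xiSup (h.basisX.bounded J) hx) (norm_nonneg _)

end IsRegular

/-- The higher order part of the estimation error. -/
noncomputable def remainder (M : NPIV Ω d dw) (Rb : Matrix (Fin K) (Fin K) ℝ)
    (Rp : Matrix (Fin J) (Fin J) ℝ) (n : ℕ) (r : EuclideanSpace ℝ (Fin d) → ℝ) (ω : Ω) : ℝ :=
  let S := M.crossW Rb Rp
  let N := leftInv S
  let N' := S * N - 1
  let D := crossSample M.obs n (M.instr Rb) (M.regr Rp) ω - crossMean M.lawObs (M.instr Rb) (M.regr Rp)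
  let D' := crossSample M.obs n (M.regr Rp) (M.instr Rb) ω - crossMean M.lawObs (M.regr Rp) (M.instr Rb)
  let E := crossSample M.obs n (M.instr Rb) (M.instr Rb) ω - crossMean M.lawObs (M.instr Rb) (M.instr Rb)
  let ρ := M.coeffW Rb r
  let ν := M.noise Rb n ω
  let τ := M.tau J
  let ζ := M.zeta J K
  52 * ζ * τ * eucl (fun k => sampleMean M.obs n (fun v => M.instr Rb k v * r v.1) ω - ρ k) +
  (52 * ζ * τ * eucl (D *ᵥ (N *ᵥ ρ)) +
  (52 * ζ * τ * eucl (D *ᵥ (N *ᵥ ν)) +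
  (52 * ζ * τ * eucl (E *ᵥ (N' *ᵥ ρ)) +
  (52 * ζ * τ * eucl (E *ᵥ (N' *ᵥ ν)) +
  (104 * ζ * τ ^ 2 * eucl (D' *ᵥ (N' *ᵥ ρ)) +
  104 * ζ * τ ^ 2 * eucl (D' *ᵥ (N' *ᵥ ν)))))))

section

variable (hM : M.IsModel) (hd : M.RegressorDensity) (h : M.IsRegular Rb Rp)

include hM hd h in
/-- Deterministic bound for the uniform estimation error when the empirical matrices are close to
their population counterparts. -/
theorem supNorm_hHat_sub_le
    {ginv : ∀ m : ℕ, Matrix (Fin m) (Fin m) ℝ → Matrix (Fin m) (Fin m) ℝ} (hg : IsGenInverse ginv)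
    (hh : Measurable M.h₀) (hhb : BoundedOn M.XX M.h₀) {n : ℕ} {ω : Ω}
    (hSh : ∀ c, eucl ((crossSample M.obs n (M.instr Rb) (M.regr Rp) ω - M.crossW Rb Rp) *ᵥ c)
      ≤ 1 / (2 * M.tau J) / 2 * eucl c)
    (hGh : ∀ v, eucl ((crossSample M.obs n (M.instr Rb) (M.instr Rb) ω -
      crossMean M.lawObs (M.instr Rb) (M.instr Rb)) *ᵥ v) ≤ 1 / 2 * eucl v) :
    supNorm M.XX (M.hHat ginv n J K ω - M.h₀) ≤ supNorm M.XX (M.h₀ - M.projX J M.h₀) +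
      supNorm M.XX (M.Q J K M.h₀ - M.projX J M.h₀) +
      M.xi J * ‖Rpᵀ *ᵥ (leftInv (M.crossW Rb Rp) *ᵥ M.noise Rb n ω)‖ +
      M.remainder Rb Rp n (M.h₀ - M.projX J M.h₀) ω := by
  have := hM.isProbabilityMeasure_lawX
  have := hM.isProbabilityMeasure_lawObs
  have hL : MemLp M.h₀ 2 M.lawX := hhb.memLp hh hd.mem_XX 2
  have hI : IsBddOrtho M.lawObs (M.instr Rb) (M.zeta J K) := h.orthoW.comp hM.measurePreserving_snd
  have hproj := projX_eq hM hd h.basisX h.whitenX hL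
  obtain ⟨hu, hN0, hN1, hN2⟩ := leftInverse_props h.s_pos h.lower
  have hQ := Q_sub_projX hM hd h.orthoX h.orthoW h.basisX h.basisW h.whitenW h.whitenX hu hh hL
  set r := M.h₀ - M.projX J M.h₀ with hr
  set c₀ := M.coeffX Rp M.h₀ with hc₀
  have hGh' := hGh
  rw [hI.crossMean_self] at hGh'
  obtain ⟨c, q, e1, e2, e3⟩ := hHat_expansion hg h.whitenW.isUnit h.whitenX.isUnit h.s_pos
    h.lower hSh hGh' c₀ rfl
  rw [← hproj, ← hr] at e2
  have key := tsls_error_le h.s_pos h.lower hSh hGh' e2 e3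
    (N := leftInv (M.crossW Rb Rp)) (ρ := M.coeffW Rb r) rfl hN0
  set e := c - c₀ - leftInv (M.crossW Rb Rp) *ᵥ (M.noise Rb n ω + M.coeffW Rb r) with he
  -- With s = 1/(2τ) the constant 26 of `tsls_error_le` becomes 26·2τ = 52τ for the terms over s and
  -- 26·4τ² = 104τ² for those over s².
  have hrem : M.zeta J K * eucl e ≤ M.remainder Rb Rp n r ω := by
    have hζ : 0 ≤ M.zeta J K := zero_le_one.trans h.one_le_zeta
    refine (mul_le_mul_of_nonneg_left key hζ).trans (le_of_eq ?_)
    have hτ := h.one_le_tau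
    rw [crossSample_transpose, crossMean_transpose]
    simp only [remainder]
    rw [hI.crossMean_self]
    have e0 : ∀ x y : Fin K → ℝ, x - y = fun k => x k - y k := fun _ _ => rfl
    rw [e0]
    field_simp
    ring
  have hcb : BoundedOn M.XX r := hhb.sub (hproj ▸ by
    rw [sieveFun_eq]; exact BoundedOn.linComb (h.basisX.bounded J) _)
  have hQb : BoundedOn M.XX (M.Q J K M.h₀ - M.projX J M.h₀) := by
    rw [hQ, sieveFun_eq]; exact BoundedOn.linComb (h.basisX.bounded J) _
  have hxi : 0 ≤ M.xi J := Real.iSup_nonneg fun _ => Finset.sum_nonneg fun _ _ => abs_nonneg _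
  refine supNorm_le ?_ fun x hx => ?_
  · have h1 := supNorm_nonneg M.XX r
    have h2 := supNorm_nonneg M.XX (M.Q J K M.h₀ - M.projX J M.h₀)
    have h3 : 0 ≤ M.remainder Rb Rp n r ω :=
      (mul_nonneg (zero_le_one.trans h.one_le_zeta) (eucl_nonneg e)).trans hrem
    have h4 := mul_nonneg hxi (norm_nonneg (Rpᵀ *ᵥ (leftInv (M.crossW Rb Rp) *ᵥ M.noise Rb n ω)))
    linarith
  -- The ρ part of the linearised error is exactly Q_J h₀ − Π_J h₀, by `Q_sub_projX`.
  have hdec : (M.hHat ginv n J K ω - M.h₀) x = -(r x) + (M.Q J K M.h₀ - M.projX J M.h₀) x +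
      M.sieveFun Rp (leftInv (M.crossW Rb Rp) *ᵥ M.noise Rb n ω) x + M.sieveFun Rp e x := by
    have h1 : c = c₀ + leftInv (M.crossW Rb Rp) *ᵥ M.coeffW Rb r +
        leftInv (M.crossW Rb Rp) *ᵥ M.noise Rb n ω + e := by
      rw [he, Matrix.mulVec_add]; abel
    have h2 : ∀ a b : Fin J → ℝ, M.sieveFun Rp (a + b) x = M.sieveFun Rp a x + M.sieveFun Rp b x :=
      fun a b => by simp [sieveFun, mul_add, Finset.sum_add_distrib]
    rw [hQ, Pi.sub_apply, e1, h1, h2, h2, h2, hr, Pi.sub_apply, hproj]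
    ring
  rw [hdec]
  refine (abs_add_le _ _).trans (add_le_add ((abs_add_le _ _).trans (add_le_add
    ((abs_add_le _ _).trans (add_le_add ?_ ?_)) ?_)) ?_)
  · rw [abs_neg]; exact hcb.abs_le_supNorm hx
  · exact hQb.abs_le_supNorm hx
  · exact h.abs_sieveFun_le_xi _ hx
  · exact (h.abs_sieveFun_le_zeta e hx).trans hrem

end

end NPIV

/-- Each addition sends a bound x to 2(b + x); starting from b, six steps give 4, 10, 22, 46, 94 and
190 times b. -/
theorem SqDominated.sum_seven {Ω : Type*} [MeasurableSpace Ω] {μ : Measure Ω}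
    {Z₁ Z₂ Z₃ Z₄ Z₅ Z₆ Z₇ : Ω → ℝ} {b : ℝ} (hb : 0 ≤ b) (h₁ : SqDominated μ Z₁ b)
    (h₂ : SqDominated μ Z₂ b) (h₃ : SqDominated μ Z₃ b) (h₄ : SqDominated μ Z₄ b)
    (h₅ : SqDominated μ Z₅ b) (h₆ : SqDominated μ Z₆ b) (h₇ : SqDominated μ Z₇ b) :
    SqDominated μ (fun ω => Z₁ ω + (Z₂ ω + (Z₃ ω + (Z₄ ω + (Z₅ ω + (Z₆ ω + Z₇ ω))))))
      (190 * b) := by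
  have key := h₁.add (h₂.add (h₃.add (h₄.add (h₅.add (h₆.add h₇ hb hb) hb (by positivity)) hb
    (by positivity)) hb (by positivity)) hb (by positivity)) hb (by positivity)
  exact key.mono (by positivity) (le_of_eq (by ring))

/-! ### Second moment of the remainder. -/

namespace NPIV

variable {Ω : Type*} [MeasurableSpace Ω] {d dw : ℕ} {M : NPIV Ω d dw} {J K : ℕ}
  {Rb : Matrix (Fin K) (Fin K) ℝ} {Rp : Matrix (Fin J) (Fin J) ℝ}

section

variable (hM : M.IsModel) (h : M.IsRegular Rb Rp) {δ : ℝ} (hu : M.ResidualMoments δ)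
  {σ : ℝ} (hσ : 1 ≤ σ) (hs : M.CondVarLE σ)

include hM h hu hσ hs

theorem sqDominated_noise_regr {p : ℕ} {φ : Fin p → Obs d dw → ℝ}
    (h1 : IsBddOrtho M.lawObs φ (M.zeta J K)) {N : Matrix (Fin K) (Fin K) ℝ} {C : ℝ}
    (hN : ∀ x, eucl (N *ᵥ x) ≤ C * eucl x) {n : ℕ} (hn : n ≠ 0) (hζn : M.zeta J K ^ 2 ≤ n) :
    SqDominated M.μ (fun ω => eucl ((crossSample M.obs n φ (M.instr Rb) ω -
      crossMean M.lawObs φ (M.instr Rb)) *ᵥ (N *ᵥ M.noise Rb n ω)))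
      (24 * σ * (M.zeta J K * C * Real.sqrt K / n)) := by
  have hI : IsBddOrtho M.lawObs (M.instr Rb) (M.zeta J K) := h.orthoW.comp hM.measurePreserving_snd
  have hb := h.orthoW.exists_abs_bilin_le h.orthoW N
  obtain ⟨i1, i2⟩ := integral_crossSample_noise_le hM hu h.orthoW hs h1 hI hN
    (zero_le_one.trans hσ) (sum_integral_mul_resid_sq_le hM hu hs h1 hb.1 hb.2) hn
    (one_le_pow₀ h.one_le_zeta) hζn
  refine .of_integrable i1 (i2.trans ?_)
  rw [mul_pow (24 * σ)]
  exact mul_le_mul_of_nonneg_right (by nlinarith) (sq_nonneg _)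

theorem sqDominated_noise_instr {p : ℕ} {χ : Fin p → Obs d dw → ℝ}
    (h1 : IsBddOrtho M.lawObs χ (M.zeta J K)) {N : Matrix (Fin p) (Fin K) ℝ} {C : ℝ}
    (hN : ∀ x, eucl (N *ᵥ x) ≤ C * eucl x) {n : ℕ} (hn : n ≠ 0) (hζn : M.zeta J K ^ 2 ≤ n) :
    SqDominated M.μ (fun ω => eucl ((crossSample M.obs n (M.instr Rb) χ ω -
      crossMean M.lawObs (M.instr Rb) χ) *ᵥ (N *ᵥ M.noise Rb n ω)))
      (24 * σ * (M.zeta J K * C * Real.sqrt K / n)) := by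
  have hI : IsBddOrtho M.lawObs (M.instr Rb) (M.zeta J K) := h.orthoW.comp hM.measurePreserving_snd
  have hb := h1.exists_abs_bilin_le hI N
  have hσ0 := zero_le_one.trans hσ
  obtain ⟨i1, i2⟩ := integral_crossSample_noise_le hM hu h.orthoW hs hI h1 hN
    hσ0 (sum_integral_instr_mul_sq_le hM hu h.orthoW hs hσ0 hb.1 hb.2) hn
    (one_le_pow₀ h.one_le_zeta) hζn
  refine .of_integrable i1 (i2.trans ?_)
  rw [mul_pow (24 * σ)]
  exact mul_le_mul_of_nonneg_right (by nlinarith) (sq_nonneg _)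

omit h hu hσ hs in
theorem sqDominated_crossSample_sub {p q : ℕ} {φ : Fin p → Obs d dw → ℝ} {χ : Fin q → Obs d dw → ℝ}
    (h1 : IsBddOrtho M.lawObs φ (M.zeta J K)) (h2 : IsBddOrtho M.lawObs χ (M.zeta J K))
    {w : Fin q → ℝ} {n : ℕ} (hn : n ≠ 0) :
    SqDominated M.μ (fun ω => eucl ((crossSample M.obs n φ χ ω - crossMean M.lawObs φ χ) *ᵥ w))
      (M.zeta J K * eucl w / Real.sqrt n) := by
  have := hM.isProbabilityMeasure_lawObs
  obtain ⟨i1, i2⟩ := hM.isSample.integral_eucl_crossSample_sub_le h1 h2 w hn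
  refine .of_integrable i1 (i2.trans (le_of_eq ?_))
  rw [div_pow, mul_pow, Real.sq_sqrt (Nat.cast_nonneg n)]

/-- Every summand carries τζ·ζ/√n, which is at most D: one ζ from the sup-norm, one ζ/√n from a
fluctuation and one τ from stability. What is left is, up to constants, one of ‖r‖, |ρ|, τ|ρ|,
√(K/n) and τ√(K/n). Since |ρ| ≤ ‖Tr‖, `hT` controls the terms with ρ. -/
theorem sqDominated_remainder {r : EuclideanSpace ℝ (Fin d) → ℝ} (hr : Measurable r)
    (hr2 : MemLp r 2 M.lawX) {n : ℕ} (hn : n ≠ 0) (hζn : M.zeta J K ^ 2 ≤ n) {D C : ℝ}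
    (hD : M.tau J * M.zeta J K ^ 2 / Real.sqrt n ≤ D) (hC : 1 ≤ C)
    (hT : M.tau J * M.normW (M.T r) ≤ C * M.normX r) :
    SqDominated M.μ (M.remainder Rb Rp n r)
      (190 * (2496 * σ * D * C) * (M.normX r + M.tau J * Real.sqrt K / Real.sqrt n)) := by
  have := hM.isProbabilityMeasure_lawObs
  have hI : IsBddOrtho M.lawObs (M.instr Rb) (M.zeta J K) := h.orthoW.comp hM.measurePreserving_snd
  have hR : IsBddOrtho M.lawObs (M.regr Rp) (M.zeta J K) := h.orthoX.comp hM.measurePreserving_fst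
  have hτ := h.one_le_tau
  have hζ := h.one_le_zeta
  obtain ⟨hiu, hN0, hN1, -⟩ := leftInverse_props h.s_pos h.lower
  have hN := h.eucl_leftInv_le
  have hρ := eucl_coeffW_le hM h.orthoW hr hr2
  have hN1' : ∀ v, eucl ((M.crossW Rb Rp * leftInv (M.crossW Rb Rp) - 1) *ᵥ v) ≤ 1 * eucl v := by
    simpa [leftInv] using hN1
  have hsn : 0 < Real.sqrt n := Real.sqrt_pos.2 (by positivity)
  have hdn : ∀ x : ℝ, x / (n : ℝ) = x / Real.sqrt n / Real.sqrt n := fun x => by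
    rw [div_div, Real.mul_self_sqrt (Nat.cast_nonneg n)]
  have hnX : 0 ≤ M.normX r := l2Norm_nonneg _ _
  have hnρ := eucl_nonneg (M.coeffW Rb r)
  set τ := M.tau J with hτd
  set ζ := M.zeta J K with hζd
  set ρ := M.coeffW Rb r with hρd
  set R := M.normX r + τ * Real.sqrt K / Real.sqrt n with hRd
  have hK0 : 0 ≤ τ * Real.sqrt K / Real.sqrt n := by positivity
  have hD0 : 0 ≤ D := le_trans (by positivity) hD
  have hR0 : 0 ≤ R := by positivity
  have hXR : M.normX r ≤ C * R := by nlinarith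
  have hτρ : τ * eucl ρ ≤ C * R := by
    have := mul_le_mul_of_nonneg_left hρ (by positivity : 0 ≤ τ)
    have : C * M.normX r ≤ C * R := mul_le_mul_of_nonneg_left (by linarith) (by linarith)
    linarith
  have hρ' : eucl ρ ≤ C * R := by nlinarith
  have hτK : τ * (Real.sqrt K / Real.sqrt n) ≤ C * R := by
    have : τ * (Real.sqrt K / Real.sqrt n) ≤ R := by rw [hRd, ← mul_div_assoc]; linarith
    nlinarith
  have hK' : Real.sqrt K / Real.sqrt n ≤ C * R := by
    have : 0 ≤ Real.sqrt K / Real.sqrt n := by positivity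
    nlinarith
  have hCR : 0 ≤ C * R := by positivity
  have hb : 0 ≤ 2496 * σ * D * C * R := by positivity
  -- 2496 = 52·24·2 = 104·24 is the largest constant among the seven terms; the 24 stems from the
  -- noise bounds and the 2 from |N| ≤ 2τ.
  have fin1 : ∀ a x : ℝ, 0 ≤ a → a ≤ 2496 → 0 ≤ x → x ≤ C * R →
      a * (τ * ζ ^ 2 / Real.sqrt n) * x ≤ 2496 * σ * D * C * R := fun a x ha ha' hx hx' => by
    calc a * (τ * ζ ^ 2 / Real.sqrt n) * x ≤ 2496 * D * (C * R) :=
          mul_le_mul (mul_le_mul ha' hD (by positivity) (by norm_num)) hx' hx (by positivity)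
      _ ≤ 2496 * D * (C * R) * σ := le_mul_of_one_le_right (by positivity) hσ
      _ = _ := by ring
  have fin2 : ∀ a x : ℝ, 0 ≤ a → a ≤ 2496 → 0 ≤ x → x ≤ C * R →
      a * σ * (τ * ζ ^ 2 / Real.sqrt n) * x ≤ 2496 * σ * D * C * R := fun a x ha ha' hx hx' => by
    calc a * σ * (τ * ζ ^ 2 / Real.sqrt n) * x ≤ 2496 * σ * D * (C * R) :=
          mul_le_mul (mul_le_mul (mul_le_mul_of_nonneg_right ha' (by linarith)) hD (by positivity)
            (by positivity)) hx' hx (by positivity)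
      _ = _ := by ring
  have t1 : SqDominated M.μ (fun ω => 52 * ζ * τ * eucl (fun k => sampleMean M.obs n
      (fun v => M.instr Rb k v * r v.1) ω - ρ k)) (2496 * σ * D * C * R) := by
    have hp := hM.measurePreserving_fst
    obtain ⟨i1, i2⟩ := hM.isSample.integral_eucl_sampleMean_sub_le hI (hr.comp hp.measurable)
      (hr2.comp_measurePreserving hp) hn
    have e : ∫ v : Obs d dw, (r ∘ fun v => v.1) v ^ 2 ∂M.lawObs = M.normX r ^ 2 := by
      rw [normX, l2Norm_sq, ← hp.map_eq, integral_map hp.measurable.aemeasurable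
        (hr.pow_const 2).aestronglyMeasurable]
      rfl
    have i3 : SqDominated M.μ (fun ω => eucl (fun k => sampleMean M.obs n
        (fun v => M.instr Rb k v * r v.1) ω - ρ k)) (ζ * M.normX r / Real.sqrt n) := by
      refine .of_integrable i1 (i2.trans (le_of_eq ?_))
      rw [e, div_pow, mul_pow, Real.sq_sqrt (Nat.cast_nonneg n)]
    refine (i3.const_mul _).mono (by positivity) (le_trans (le_of_eq ?_)
      (fin1 52 (M.normX r) (by norm_num) (by norm_num) hnX hXR))
    ring
  have t2 : SqDominated M.μ (fun ω => 52 * ζ * τ * eucl ((crossSample M.obs n (M.instr Rb)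
      (M.regr Rp) ω - crossMean M.lawObs (M.instr Rb) (M.regr Rp)) *ᵥ
      (leftInv (M.crossW Rb Rp) *ᵥ ρ))) (2496 * σ * D * C * R) := by
    refine ((sqDominated_crossSample_sub hM hI hR hn).const_mul _).mono
      (mul_nonneg (by positivity) (div_nonneg (mul_nonneg (by positivity) (eucl_nonneg _)) hsn.le))
      (le_trans ?_ (fin1 104 (τ * eucl ρ) (by norm_num) (by norm_num) (by positivity) hτρ))
    have e : 104 * (τ * ζ ^ 2 / Real.sqrt n) * (τ * eucl ρ) =
        52 * ζ * τ * (ζ * (2 * τ * eucl ρ) / Real.sqrt n) := by ring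
    rw [e]
    have := hN ρ
    gcongr
  have t3 : SqDominated M.μ (fun ω => 52 * ζ * τ * eucl ((crossSample M.obs n (M.instr Rb)
      (M.regr Rp) ω - crossMean M.lawObs (M.instr Rb) (M.regr Rp)) *ᵥ
      (leftInv (M.crossW Rb Rp) *ᵥ M.noise Rb n ω))) (2496 * σ * D * C * R) := by
    refine ((sqDominated_noise_instr hM h hu hσ hs hR hN hn hζn).const_mul _).mono
      (by positivity) (le_trans (le_of_eq ?_) (fin2 2496 (τ * (Real.sqrt K / Real.sqrt n))
        (by norm_num) (by norm_num) (by positivity) hτK))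
    rw [hdn]; ring
  have t4 : SqDominated M.μ (fun ω => 52 * ζ * τ * eucl ((crossSample M.obs n (M.instr Rb)
      (M.instr Rb) ω - crossMean M.lawObs (M.instr Rb) (M.instr Rb)) *ᵥ
      ((M.crossW Rb Rp * leftInv (M.crossW Rb Rp) - 1) *ᵥ ρ))) (2496 * σ * D * C * R) := by
    refine ((sqDominated_crossSample_sub hM hI hI hn).const_mul _).mono
      (mul_nonneg (by positivity) (div_nonneg (mul_nonneg (by positivity) (eucl_nonneg _)) hsn.le))
      (le_trans ?_ (fin1 52 (eucl ρ) (by norm_num) (by norm_num) hnρ hρ'))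
    have e : 52 * (τ * ζ ^ 2 / Real.sqrt n) * eucl ρ =
        52 * ζ * τ * (ζ * (1 * eucl ρ) / Real.sqrt n) := by ring
    rw [e]
    have := hN1' ρ
    gcongr
  have t5 : SqDominated M.μ (fun ω => 52 * ζ * τ * eucl ((crossSample M.obs n (M.instr Rb)
      (M.instr Rb) ω - crossMean M.lawObs (M.instr Rb) (M.instr Rb)) *ᵥ
      ((M.crossW Rb Rp * leftInv (M.crossW Rb Rp) - 1) *ᵥ M.noise Rb n ω)))
      (2496 * σ * D * C * R) := by
    refine ((sqDominated_noise_instr hM h hu hσ hs hI hN1' hn hζn).const_mul _).mono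
      (by positivity) (le_trans (le_of_eq ?_) (fin2 1248 (Real.sqrt K / Real.sqrt n)
        (by norm_num) (by norm_num) (by positivity) hK'))
    rw [hdn]; ring
  have t6 : SqDominated M.μ (fun ω => 104 * ζ * τ ^ 2 * eucl ((crossSample M.obs n (M.regr Rp)
      (M.instr Rb) ω - crossMean M.lawObs (M.regr Rp) (M.instr Rb)) *ᵥ
      ((M.crossW Rb Rp * leftInv (M.crossW Rb Rp) - 1) *ᵥ ρ))) (2496 * σ * D * C * R) := by
    refine ((sqDominated_crossSample_sub hM hR hI hn).const_mul _).mono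
      (mul_nonneg (by positivity) (div_nonneg (mul_nonneg (by positivity) (eucl_nonneg _)) hsn.le))
      (le_trans ?_ (fin1 104 (τ * eucl ρ) (by norm_num) (by norm_num) (by positivity) hτρ))
    have e : 104 * (τ * ζ ^ 2 / Real.sqrt n) * (τ * eucl ρ) =
        104 * ζ * τ ^ 2 * (ζ * (1 * eucl ρ) / Real.sqrt n) := by ring
    rw [e]
    have := hN1' ρ
    gcongr
  have t7 : SqDominated M.μ (fun ω => 104 * ζ * τ ^ 2 * eucl ((crossSample M.obs n (M.regr Rp)
      (M.instr Rb) ω - crossMean M.lawObs (M.regr Rp) (M.instr Rb)) *ᵥ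
      ((M.crossW Rb Rp * leftInv (M.crossW Rb Rp) - 1) *ᵥ M.noise Rb n ω)))
      (2496 * σ * D * C * R) := by
    refine ((sqDominated_noise_regr hM h hu hσ hs hR hN1' hn hζn).const_mul _).mono
      (by positivity) (le_trans (le_of_eq ?_) (fin2 2496 (τ * (Real.sqrt K / Real.sqrt n))
        (by norm_num) (by norm_num) (by positivity) hτK))
    rw [hdn]; ring
  have key := SqDominated.sum_seven hb t1 t2 t3 t4 t5 t6 t7
  refine SqDominated.mono key (by positivity) (le_of_eq ?_)
  ring

end

end NPIV

/-! ### Rates for the operator norms and for the leading noise. -/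

/-- The Gram fluctuation has second moment at most k because ζ² ≤ n, and the off-diagonal part
contributes 2nζ²√k. With X = ζ²√k/n the three pieces are bounded by 4X, 2X and 2X, and the two
additions make this 2(4 + 2(2 + 2))X = 24X. -/
theorem IsSample.sqDominated_opBound {Ω 𝒱 : Type*} [MeasurableSpace Ω] [MeasurableSpace 𝒱]
    {μ : Measure Ω} [IsProbabilityMeasure μ] {ν : Measure 𝒱} [IsProbabilityMeasure ν]
    {V : ℕ → Ω → 𝒱} (h : IsSample μ ν V) {m k : ℕ} {φ : Fin m → 𝒱 → ℝ} {χ : Fin k → 𝒱 → ℝ} {ζ : ℝ}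
    (hφ : IsBddOrtho ν φ ζ) (hχ : IsBddOrtho ν χ ζ) {n : ℕ} (hn : n ≠ 0) (hk : k ≠ 0)
    (hζ : 1 ≤ ζ) (hζn : ζ ^ 2 ≤ n) :
    SqDominated μ (opBound ν V n φ χ ζ) (24 * (ζ ^ 2 * Real.sqrt k / n)) := by
  have hn0 : (0 : ℝ) < n := by positivity
  have hk1 : (1 : ℝ) ≤ Real.sqrt k := by
    rw [Real.one_le_sqrt]; exact_mod_cast Nat.one_le_iff_ne_zero.2 hk
  have hζ2 : (1 : ℝ) ≤ ζ ^ 2 := one_le_pow₀ hζ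
  obtain ⟨i1, i2⟩ := h.integral_gram_frob_le hχ hn
  obtain ⟨i3, i4⟩ := h.integral_gramOffDiag_le hφ hχ n
  have hsq : ∀ {F : Ω → ℝ}, (∀ ω, 0 ≤ F ω) → (fun ω => Real.sqrt (F ω) ^ 2) = F := fun hF =>
    funext fun ω => Real.sq_sqrt (hF ω)
  have hF0 : ∀ ω, 0 ≤ ∑ l, ∑ l', (crossSample V n χ χ ω - 1) l l' ^ 2 := fun ω =>
    Finset.sum_nonneg fun _ _ => Finset.sum_nonneg fun _ _ => sq_nonneg _
  have hH0 : ∀ ω, 0 ≤ ∑ l, ∑ l', gramOffDiag ν V n φ χ l l' ω ^ 2 := fun ω =>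
    Finset.sum_nonneg fun _ _ => Finset.sum_nonneg fun _ _ => sq_nonneg _
  have t1 : SqDominated μ (fun ω => Real.sqrt (∑ l, ∑ l', (crossSample V n χ χ ω - 1) l l' ^ 2))
      (Real.sqrt k) := by
    refine .of_integrable ((hsq hF0).symm ▸ i1) ((hsq hF0).symm ▸ i2.trans ?_)
    rw [Real.sq_sqrt (Nat.cast_nonneg k), div_le_iff₀ hn0, mul_comm]
    exact mul_le_mul_of_nonneg_left hζn (Nat.cast_nonneg k)
  have t2 : SqDominated μ (fun ω => Real.sqrt (∑ l, ∑ l', gramOffDiag ν V n φ χ l l' ω ^ 2))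
      (2 * n * ζ ^ 2 * Real.sqrt k) := by
    refine .of_integrable ((hsq hH0).symm ▸ i3) ((hsq hH0).symm ▸ i4.trans ?_)
    have : (2 * n * ζ ^ 2 * Real.sqrt k) ^ 2 = 4 * n ^ 2 * (ζ ^ 4 * k) := by
      rw [mul_pow, Real.sq_sqrt (Nat.cast_nonneg k)]; ring
    rw [this]
    exact mul_le_mul_of_nonneg_right (by nlinarith) (by positivity)
  have t0 : SqDominated μ (fun _ => 2 * ζ ^ 2 / n + 2 / n) (4 * (ζ ^ 2 * Real.sqrt k / n)) := by
    refine ⟨fun _ => _, fun _ => le_rfl, integrable_const _, ?_⟩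
    rw [integral_const, probReal_univ, one_smul]
    refine pow_le_pow_left₀ (by positivity) ?_ 2
    rw [← add_div, ← mul_div_assoc]
    refine div_le_div_of_nonneg_right ?_ hn0.le
    nlinarith
  have key := t0.add ((t1.const_mul (2 * ζ ^ 2 / n)).add (t2.const_mul ((n : ℝ) ^ 2)⁻¹)
    (by positivity) (by positivity)) (by positivity) (by positivity)
  have e : opBound ν V n φ χ ζ = fun ω => (2 * ζ ^ 2 / n + 2 / n) +
      (2 * ζ ^ 2 / n * Real.sqrt (∑ l, ∑ l', (crossSample V n χ χ ω - 1) l l' ^ 2) +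
        ((n : ℝ) ^ 2)⁻¹ * Real.sqrt (∑ l, ∑ l', gramOffDiag ν V n φ χ l l' ω ^ 2)) := by
    ext ω; simp only [opBound]; ring
  rw [e]
  refine key.mono (by positivity) (le_of_eq ?_)
  field_simp
  ring

namespace NPIV

variable {Ω : Type*} [MeasurableSpace Ω] {d dw : ℕ} {M : NPIV Ω d dw} {J K : ℕ}
  {Rb : Matrix (Fin K) (Fin K) ℝ} {Rp : Matrix (Fin J) (Fin J) ℝ}

/-- A row is the transposed left inverse applied to R eⱼ: the transpose has norm at most 2τ, and
whitening scales the unit vector eⱼ by at most e^(-1/2). -/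
theorem IsRegular.eucl_row_le (h : M.IsRegular Rb Rp) (hJ : J ≠ 0) (j : Fin J) :
    eucl ((Rpᵀ * leftInv (M.crossW Rb Rp)) j) ≤ 2 * M.tau J / Real.sqrt (M.e J) := by
  have hτ := h.one_le_tau
  have e1 : (Rpᵀ * leftInv (M.crossW Rb Rp)) j =
      (leftInv (M.crossW Rb Rp))ᵀ *ᵥ (Rp *ᵥ Pi.single j 1) := by
    rw [Matrix.mulVec_mulVec, Matrix.mulVec_single_one]
    ext k
    simp [Matrix.mul_apply, mul_comm]
  rw [e1]
  have h1 : eucl (Pi.single j (1 : ℝ)) = 1 := by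
    rw [eucl_eq_sqrt]; simp [Pi.single_apply]
  have h2 := eucl_whitening_le hJ (h.basisX.posDef J) h.whitenX.eq_one (Pi.single j 1)
  rw [h1, mul_one] at h2
  refine (eucl_transpose_mulVec_le (by positivity) h.eucl_leftInv_le _).trans ?_
  rw [div_eq_mul_inv]
  exact mul_le_mul_of_nonneg_left h2 (by positivity)

/-- Exponential inequality for the leading stochastic term, at truncation level `B`. -/
theorem measure_norm_noise_gt_le (hM : M.IsModel) (h : M.IsRegular Rb Rp) {δ : ℝ}
    (hu : M.ResidualMoments δ) {σ : ℝ} (hσ : 1 ≤ σ) (hs : M.CondVarLE σ) (hJ : J ≠ 0)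
    {a : ℝ} (ha : a = 2 * M.tau J / Real.sqrt (M.e J)) {B κ t η x : ℝ} (hB : 0 < B)
    (hκ : ∫ v, |M.resid v| ^ (2 + δ) ∂M.lawObs ≤ κ) (ht : 0 ≤ t)
    (htb : t * (2 * (M.zeta J K * a) * B) ≤ 1) (hη : 0 < η) {n : ℕ} (hn : n ≠ 0) (hx : 0 ≤ x) :
    M.μ {ω | x + M.zeta J K * a * (κ / B ^ (1 + δ)) * (1 + 1 / η) <
        ‖Rpᵀ *ᵥ (leftInv (M.crossW Rb Rp) *ᵥ M.noise Rb n ω)‖} ≤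
      ENNReal.ofReal (2 * J * Real.exp (-t * (n * x) + n * (t ^ 2 * (σ * a ^ 2)))) +
        ENNReal.ofReal η := by
  have := hM.isProbabilityMeasure_lawObs
  have hI : IsBddOrtho M.lawObs (M.instr Rb) (M.zeta J K) := h.orthoW.comp hM.measurePreserving_snd
  have hζ := h.one_le_zeta
  have hτ := h.one_le_tau
  have hrow := fun j => (h.eucl_row_le hJ j).trans_eq ha.symm
  have ha0 : 0 ≤ a := by rw [ha]; positivity
  simp_rw [Matrix.mulVec_mulVec, mulVec_noise]
  refine hM.isSample.measure_norm_sampleMean_mul_gt_le (fun j => hI.measurable_lin _)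
    hM.measurable_resid (by positivity) (fun j => ?_) hB hu.delta_pos (hM.integrable_resid_rpow hu)
    hκ (hM.memLp_resid hu) (fun j => (instr_lin_mul_resid hM hu h.orthoW _).2.2) (fun j => ?_) ht
    htb hη hn hx
  · filter_upwards [hI.exists_abs_lin_le ((Rpᵀ * leftInv (M.crossW Rb Rp)) j)] with v hv
    refine hv.trans ?_
    rw [abs_of_nonneg (zero_le_one.trans hζ)]
    exact mul_le_mul_of_nonneg_left (hrow j) (by positivity)
  · refine (integral_instr_lin_mul_resid_sq_le hM h.orthoW hs _).trans ?_
    exact mul_le_mul_of_nonneg_left (pow_le_pow_left₀ (eucl_nonneg _) (hrow j) 2) (by linarith)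

end NPIV

namespace NPIV

variable {Ω : Type*} [MeasurableSpace Ω] {d dw : ℕ} {M : NPIV Ω d dw} {J K : ℕ → ℕ}
  {Rb : ∀ n, Matrix (Fin (K n)) (Fin (K n)) ℝ} {Rp : ∀ n, Matrix (Fin (J n)) (Fin (J n)) ℝ}

theorem tau_nonneg (j : ℕ) : 0 ≤ M.tau j :=
  Real.iSup_nonneg fun _ => div_nonneg (l2Norm_nonneg _ _) (l2Norm_nonneg _ _)

theorem xi_nonneg (j : ℕ) : 0 ≤ M.xi j :=
  Real.iSup_nonneg fun _ => Finset.sum_nonneg fun _ _ => abs_nonneg _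

theorem SieveSetup.eventually_ne_zero (hS : M.SieveSetup J K) : ∀ᶠ n in atTop, J n ≠ 0 :=
  hS.tendsto.eventually_ne_atTop 0

theorem exists_isRegular (hM : M.IsModel) (hd : M.RegressorDensity) (hS : M.SieveSetup J K)
    (hA : M.SieveApprox J K) :
    ∃ (Rb : ∀ n, Matrix (Fin (K n)) (Fin (K n)) ℝ) (Rp : ∀ n, Matrix (Fin (J n)) (Fin (J n)) ℝ),
      ∀ᶠ n in atTop, M.IsRegular (Rb n) (Rp n) := by
  have hb := fun n => exists_whitening (hS.basisW.posDef (K n))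
  have hp := fun n => exists_whitening (hS.basisX.posDef (J n))
  choose Rb hb1 hb2 hb3 using hb
  choose Rp hp1 hp2 hp3 using hp
  refine ⟨Rb, Rp, ?_⟩
  filter_upwards [hS.eventually_ne_zero, hA.instrument.bound (by norm_num : (0 : ℝ) < 1 / 2)]
    with n hJ hD
  have := hM.isProbabilityMeasure_lawW
  have hWX : IsWhitening M.lawX (M.ψ (J n)) (Rp n) := ⟨hp1 n, hp2 n, hp3 n⟩
  have hWW : IsWhitening M.lawW (M.b (K n)) (Rb n) := ⟨hb1 n, hb2 n, hb3 n⟩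
  have oX := hM.isBddOrtho_X (K := K n) hd hS.basisX (hp2 n) (hp3 n)
  have oW := hM.isBddOrtho_W (J := J n) hS.basisW (hb2 n) (hb3 n)
  obtain ⟨hτ1, hτ2⟩ := tau_bounds hM oX oW hJ (hp1 n)
    (crossW_injective hM hd hS.basisX hS.basisW hWW hWX (hS.rank n))
  refine ⟨hS.basisX, hS.basisW, hWX, hWW, oX, oW, hτ1, ?_, ?_⟩
  · have h1 : (1 : ℝ) ≤ K n := by
      exact_mod_cast (Nat.one_le_iff_ne_zero.2 hJ).trans (hS.le n)
    have h2 := h1.trans oW.card_le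
    have h3 : 0 ≤ M.zeta (J n) (K n) := (zetaSup_nonneg _ _).trans (le_max_left _ _)
    nlinarith
  · refine eucl_crossMean_ge hM oX oW (hp1 n) (hb3 n) (fun k => hM.memLp_basisW hS.basisW k 2)
      hτ1 hτ2 ?_
    have h1 : 0 ≤ (M.tau (J n))⁻¹ := inv_nonneg.2 (tau_nonneg _)
    rw [Real.norm_of_nonneg h1] at hD
    exact (le_abs_self _).trans hD

section

variable (hM : M.IsModel) (hS : M.SieveSetup J K) {δ : ℝ} (hG : M.SieveGrowth δ J K)
  (hreg : ∀ᶠ n in atTop, M.IsRegular (Rb n) (Rp n))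

theorem SieveGrowth.exists_bound (hG : M.SieveGrowth δ J K) :
    ∃ D : ℝ, 1 ≤ D ∧
      ∀ᶠ n : ℕ in atTop, M.tau (J n) * M.zeta (J n) (K n) ^ 2 / Real.sqrt n ≤ D := by
  obtain ⟨D, hD⟩ := hG.illPosed.bound
  refine ⟨max D 1, le_max_right _ _, hD.mono fun n hn => ?_⟩
  rw [norm_one, mul_one] at hn
  exact (le_abs_self _).trans (hn.trans (le_max_left _ _))

include hG hreg in
-- As τ ≥ 1, the ill-posedness condition gives ζ² ≤ D√n, which is at most n once √n ≥ D.
theorem eventually_zeta_sq_le : ∀ᶠ n : ℕ in atTop, M.zeta (J n) (K n) ^ 2 ≤ n := by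
  obtain ⟨D, hD1, hD⟩ := hG.exists_bound
  have hs : Tendsto (fun n : ℕ => Real.sqrt n) atTop atTop :=
    Real.tendsto_sqrt_atTop.comp tendsto_natCast_atTop_atTop
  filter_upwards [hD, hreg, hs.eventually_ge_atTop D] with n h1 h2 h3
  have hsn : 0 < Real.sqrt n := by linarith
  rw [div_le_iff₀ hsn] at h1
  have h4 := le_mul_of_one_le_left (sq_nonneg (M.zeta (J n) (K n))) h2.one_le_tau
  calc _ ≤ D * Real.sqrt n := h4.trans h1
    _ ≤ Real.sqrt n * Real.sqrt n := mul_le_mul_of_nonneg_right h3 hsn.le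
    _ = n := Real.mul_self_sqrt (Nat.cast_nonneg n)

include hM hreg in
theorem eventually_card_le : ∀ᶠ n : ℕ in atTop, (K n : ℝ) ≤ M.zeta (J n) (K n) ^ 2 := by
  filter_upwards [hreg] with n h
  have := hM.isProbabilityMeasure_lawW
  exact h.orthoW.card_le

include hM hS hG hreg in
-- Multiplied by τ², the bound is of order (τζ²/√n)²·√q/ζ². Since J ≤ q ≤ K ≤ ζ², this is
-- O(J^(-1/2)), which vanishes. The threshold 16 corresponds to an operator norm of at most 1/(4τ),
-- half the lower bound of S.
theorem tendsto_measure_opBound {p q : ℕ → ℕ} {φ : ∀ n, Fin (p n) → Obs d dw → ℝ}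
    {χ : ∀ n, Fin (q n) → Obs d dw → ℝ}
    (hφ : ∀ᶠ n in atTop, IsBddOrtho M.lawObs (φ n) (M.zeta (J n) (K n)))
    (hχ : ∀ᶠ n in atTop, IsBddOrtho M.lawObs (χ n) (M.zeta (J n) (K n)))
    (hq : ∀ n, J n ≤ q n ∧ q n ≤ K n) :
    Tendsto (fun n => M.μ {ω | 1 < 16 * |M.tau (J n) ^ 2 *
      opBound M.lawObs M.obs n (φ n) (χ n) (M.zeta (J n) (K n)) ω|}) atTop (nhds 0) := by
  have := hM.isProbabilityMeasure_lawObs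
  obtain ⟨D, hD1, hD⟩ := hG.exists_bound
  have key : IsBigOInProb M.μ (fun n ω => M.tau (J n) ^ 2 *
      opBound M.lawObs M.obs n (φ n) (χ n) (M.zeta (J n) (K n)) ω)
      fun n => (Real.sqrt (J n))⁻¹ := by
    refine IsBigOInProb.of_sqDominated (c := 24 * D ^ 2)
      (fun n => inv_nonneg.2 (Real.sqrt_nonneg _)) ?_
    filter_upwards [hφ, hχ, hreg, hD, hS.eventually_ne_zero, eventually_zeta_sq_le hG hreg,
      eventually_card_le hM hreg, eventually_ne_atTop 0] with n h1 h2 h3 h4 h5 h6 h7 h8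
    have hτ := h3.one_le_tau
    have hζ := h3.one_le_zeta
    have hJ0 : (0 : ℝ) < Real.sqrt (J n) := Real.sqrt_pos.2 (by positivity)
    have hJq : Real.sqrt (J n) ≤ Real.sqrt (q n) :=
      Real.sqrt_le_sqrt (by exact_mod_cast (hq n).1)
    have hsn : 0 < Real.sqrt n := Real.sqrt_pos.2 (by positivity)
    have hqζ : (q n : ℝ) ≤ M.zeta (J n) (K n) ^ 2 :=
      le_trans (by exact_mod_cast (hq n).2) h7
    refine ((hM.isSample.sqDominated_opBound h1 h2 h8
      (Nat.pos_iff_ne_zero.1 ((Nat.pos_of_ne_zero h5).trans_le (hq n).1)) hζ h6).const_mul _).mono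
      (by positivity) ?_
    set τ := M.tau (J n)
    set ζ := M.zeta (J n) (K n)
    have hx0 : 0 ≤ τ * ζ ^ 2 / Real.sqrt n := by positivity
    have e : τ ^ 2 * (24 * (ζ ^ 2 * Real.sqrt (q n) / n)) =
        24 * (τ * ζ ^ 2 / Real.sqrt n) ^ 2 * (Real.sqrt (q n) / ζ ^ 2) := by
      rw [div_pow, Real.sq_sqrt (Nat.cast_nonneg n)]
      field_simp
    rw [e]
    have h9 : Real.sqrt (q n) / ζ ^ 2 ≤ (Real.sqrt (J n))⁻¹ := by
      rw [div_le_iff₀ (by positivity), ← div_eq_inv_mul, le_div_iff₀ hJ0]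
      calc _ ≤ Real.sqrt (q n) * Real.sqrt (q n) := by gcongr
        _ = q n := Real.mul_self_sqrt (Nat.cast_nonneg _)
        _ ≤ _ := hqζ
    gcongr
  refine key.tendsto_measure (a := fun _ => 16) (Eventually.of_forall fun _ => by norm_num) ?_
    one_pos
  have h1 : Tendsto (fun n => Real.sqrt (J n)) atTop atTop :=
    Real.tendsto_sqrt_atTop.comp (tendsto_natCast_atTop_atTop.comp hS.tendsto)
  simpa using h1.inv_tendsto_atTop.const_mul 16

include hM hS hG hreg in
theorem isBigOInProb_norm_noise (hu : M.ResidualMoments δ) :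
    IsBigOInProb M.μ (fun n ω => ‖(Rp n)ᵀ *ᵥ (leftInv (M.crossW (Rb n) (Rp n)) *ᵥ
      M.noise (Rb n) n ω)‖)
      fun n => 2 * M.tau (J n) / Real.sqrt (M.e (J n)) * Real.sqrt (Real.log n / n) := by
  intro ε hε
  obtain ⟨σ, hσ, hs⟩ := hM.exists_condVarLE hu
  have hδ := hu.delta_pos
  set κ := ∫ v, |M.resid v| ^ (2 + δ) ∂M.lawObs with hκ
  have hκ0 : 0 ≤ κ := integral_nonneg fun v => by positivity
  -- 3σ is the Bernstein part; the κ term is the tail beyond truncation, with Markov's inequality at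
  -- probability ε/2.
  refine ⟨3 * σ + κ * (1 + 1 / (ε / 2)), by positivity, ?_⟩
  have hm : Tendsto (fun n : ℕ => (2 : ℝ) ^ (1 + δ) * (M.zeta (J n) (K n) ^ ((2 + δ) / δ) *
      Real.sqrt (Real.log n / n)) ^ δ) atTop (nhds 0) := by
    have h1 := (isLittleO_one_iff ℝ).1 hG.moment
    have h2 := h1.rpow_const (p := δ) (Or.inr hδ.le)
    rw [Real.zero_rpow hδ.ne'] at h2
    simpa using h2.const_mul ((2 : ℝ) ^ (1 + δ))
  have hn2 : Tendsto (fun n : ℕ => (2 : ℝ) / n) atTop (nhds 0) :=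
    tendsto_const_nhds.div_atTop tendsto_natCast_atTop_atTop
  have hlog : Tendsto (fun n : ℕ => Real.log n) atTop atTop :=
    Real.tendsto_log_atTop.comp tendsto_natCast_atTop_atTop
  filter_upwards [hm.eventually_le_const one_pos, hn2.eventually_le_const (half_pos hε),
    hlog.eventually_ge_atTop 1, hreg, hS.eventually_ne_zero, eventually_zeta_sq_le hG hreg,
    eventually_card_le hM hreg, eventually_ne_atTop 0] with n h1 h2 h3 h4 hJ h6 h7 hn
  have hτ := h4.one_le_tau
  have hζ := h4.one_le_zeta
  have he : 0 < M.e (J n) := lambdaMin_pos hJ (h4.basisX.posDef _)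
  have hn0 : (0 : ℝ) < n := by positivity
  set a := 2 * M.tau (J n) / Real.sqrt (M.e (J n)) with ha
  set ζ := M.zeta (J n) (K n)
  set l := Real.sqrt (Real.log n / n) with hl
  have ha0 : 0 < a := div_pos (by positivity) (Real.sqrt_pos.2 he)
  have hl0 : 0 < l := Real.sqrt_pos.2 (div_pos (by linarith) hn0)
  have hll : n * l ^ 2 = Real.log n := by
    rw [hl, Real.sq_sqrt (div_nonneg (by linarith) hn0.le)]; field_simp
  -- Truncation level chosen so that the tail contribution ζaκ/B^(1+δ) equals κ·a·l, which is
  -- exactly of the target order.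
  set B := (ζ / l) ^ (1 / (1 + δ)) with hB
  have hζl : 0 < ζ / l := div_pos (by linarith) hl0
  have hB0 : 0 < B := Real.rpow_pos_of_pos hζl _
  have hBp : B ^ (1 + δ) = ζ / l := by
    rw [hB, ← Real.rpow_mul hζl.le, one_div_mul_cancel (by linarith), Real.rpow_one]
  -- The (1 + δ)-th power of the left side is 2^(1+δ)·(ζ^((2+δ)/δ)·l)^δ, which tends to 0 by the
  -- moment growth condition.
  have hprod : 2 * l * ζ * B ≤ 1 := by
    by_contra hcon
    push Not at hcon
    have h8 := Real.one_lt_rpow hcon (by linarith : 0 < 1 + δ)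
    refine absurd h1 (not_le.2 (h8.trans_eq ?_))
    rw [Real.mul_rpow (by positivity) hB0.le, hBp, Real.mul_rpow (by positivity) (by linarith),
      Real.mul_rpow (by norm_num) hl0.le, Real.mul_rpow (by positivity) hl0.le,
      ← Real.rpow_mul (by linarith), div_mul_cancel₀ _ hδ.ne', Real.rpow_add hl0, Real.rpow_one,
      show 2 + δ = (1 + δ) + 1 by ring, Real.rpow_add (by linarith : 0 < ζ), Real.rpow_one]
    field_simp
    rw [show 1 + δ + 1 = δ + (2 : ℕ) by push_cast; ring, Real.rpow_add (by linarith),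
      Real.rpow_natCast]
    ring
  -- With these t and x the exponent is −3 log n + (log n)/σ ≤ −2 log n. As J ≤ K ≤ ζ² ≤ n, the
  -- union bound is at most 2n·n⁻² = 2/n.
  have key := measure_norm_noise_gt_le hM h4 hu hσ hs hJ ha hB0 hκ.ge
    (t := l / (a * σ)) (η := ε / 2) (x := 3 * a * σ * l) (by positivity) ?_ (half_pos hε) hn
    (by positivity)
  · have e1 : 3 * a * σ * l + ζ * a * (κ / B ^ (1 + δ)) * (1 + 1 / (ε / 2)) =
        (3 * σ + κ * (1 + 1 / (ε / 2))) * (a * l) := by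
      rw [hBp]
      field_simp
    rw [e1] at key
    have hset : {ω | (3 * σ + κ * (1 + 1 / (ε / 2))) * (a * l) <
        |‖(Rp n)ᵀ *ᵥ (leftInv (M.crossW (Rb n) (Rp n)) *ᵥ M.noise (Rb n) n ω)‖|} =
        {ω | (3 * σ + κ * (1 + 1 / (ε / 2))) * (a * l) <
        ‖(Rp n)ᵀ *ᵥ (leftInv (M.crossW (Rb n) (Rp n)) *ᵥ M.noise (Rb n) n ω)‖} := by
      simp_rw [abs_of_nonneg (norm_nonneg _)]
    rw [hset]
    refine key.trans ?_
    rw [← add_halves ε, ENNReal.ofReal_add (by positivity) (by positivity), add_halves]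
    refine add_le_add (ENNReal.ofReal_le_ofReal ?_) le_rfl
    have e2 : -(l / (a * σ)) * (n * (3 * a * σ * l)) + n * ((l / (a * σ)) ^ 2 * (σ * a ^ 2)) =
        -3 * Real.log n + Real.log n / σ := by
      rw [← hll]; field_simp
    have e3 : -3 * Real.log n + Real.log n / σ ≤ -Real.log n + -Real.log n := by
      have := div_le_self (by linarith : 0 ≤ Real.log n) hσ
      linarith
    have e4 : (J n : ℝ) ≤ n := le_trans (by exact_mod_cast hS.le n) (h7.trans h6)
    rw [e2]
    calc 2 * (J n : ℝ) * Real.exp (-3 * Real.log n + Real.log n / σ)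
        ≤ 2 * n * (Real.exp (-Real.log n) * Real.exp (-Real.log n)) := by
          rw [← Real.exp_add]; gcongr
      _ = 2 / n := by
          rw [Real.exp_neg, Real.exp_log hn0]; field_simp
      _ ≤ _ := h2
  · refine le_trans ?_ hprod
    have e5 : l / (a * σ) * (2 * (ζ * a) * B) = 2 * l * ζ * B / σ := by field_simp
    rw [e5]
    exact div_le_self (by positivity) hσ

end

end NPIV

theorem measurable_linComb {α : Type*} [MeasurableSpace α] {m : ℕ} {φ : Fin m → α → ℝ}
    (hφ : ∀ j, Measurable (φ j)) (c : Fin m → ℝ) : Measurable (linComb φ c) :=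
  Finset.measurable_fun_sum _ fun j _ => (hφ j).mul_const _

/-! ### Lebesgue's lemma and the final assembly. -/

namespace NPIV

section Lebesgue

variable {Ω : Type*} [MeasurableSpace Ω] {d dw : ℕ} {M : NPIV Ω d dw} {J K : ℕ}
  {Rb : Matrix (Fin K) (Fin K) ℝ} {Rp : Matrix (Fin J) (Fin J) ℝ}

variable (hM : M.IsModel) (hd : M.RegressorDensity) (h : M.IsRegular Rb Rp)

include hM hd h

/-- A crude bound via L². It makes the supremum defining the Lebesgue constant finite and settles
functions of zero sup-norm, which cannot be normalised. -/
theorem supNorm_projX_le_zeta {f : EuclideanSpace ℝ (Fin d) → ℝ} (hf : Measurable f)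
    (hfb : BoundedOn M.XX f) :
    supNorm M.XX (M.projX J f) ≤ M.zeta J K * supNorm M.XX f := by
  have := hM.isProbabilityMeasure_lawX
  have hζ := h.one_le_zeta
  have hL : MemLp f 2 M.lawX := hfb.memLp hf hd.mem_XX 2
  have h1 : eucl (M.coeffX Rp f) ≤ supNorm M.XX f := by
    refine le_trans (b := M.normX f) (le_of_sq_le_sq ?_ (l2Norm_nonneg _ _))
      (normX_le_supNorm hM hd hfb)
    rw [normX, l2Norm_sq, eucl_sq]
    exact h.orthoX.bessel hL
  refine supNorm_le (mul_nonneg (by linarith) (supNorm_nonneg _ _)) fun x hx => ?_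
  rw [projX_eq hM hd h.basisX h.whitenX hL]
  exact (h.abs_sieveFun_le_zeta _ hx).trans (mul_le_mul_of_nonneg_left h1 (by linarith))

theorem supNorm_projX_le_lebesgueConst {f : EuclideanSpace ℝ (Fin d) → ℝ} (hf : Measurable f)
    (hfb : BoundedOn M.XX f) :
    supNorm M.XX (M.projX J f) ≤ lebesgueConst M.lawX M.XX (M.ψ J) * supNorm M.XX f := by
  rcases (supNorm_nonneg M.XX f).eq_or_lt with h0 | h0
  · have := supNorm_projX_le_zeta hM hd h hf hfb
    rw [← h0, mul_zero] at this ⊢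
    exact this
  · have hbdd : BddAbove (Set.range fun g : {g : EuclideanSpace ℝ (Fin d) → ℝ //
        Measurable g ∧ BoundedOn M.XX g ∧ supNorm M.XX g ≤ 1} =>
        supNorm M.XX (l2Proj M.lawX (M.ψ J) g)) := by
      refine ⟨M.zeta J K, ?_⟩
      rintro _ ⟨⟨g, hg1, hg2, hg3⟩, rfl⟩
      refine (supNorm_projX_le_zeta hM hd h hg1 hg2).trans ?_
      exact mul_le_of_le_one_right (zero_le_one.trans h.one_le_zeta) hg3
    set c := supNorm M.XX f
    have hcf : ∀ x ∈ M.XX, |f x * c⁻¹| ≤ 1 := fun x hx => by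
      rw [abs_mul, abs_of_pos (inv_pos.2 h0), ← div_eq_mul_inv, div_le_one h0]
      exact hfb.abs_le_supNorm hx
    have h1 := le_ciSup hbdd ⟨fun x => f x * c⁻¹, hf.mul_const _, ⟨1, hcf⟩,
      supNorm_le zero_le_one hcf⟩
    have h2 : l2Proj M.lawX (M.ψ J) (fun x => f x * c⁻¹) =
        fun x => M.projX J f x * c⁻¹ := by
      have e : (fun j => ∫ x, M.ψ J j x * (f x * c⁻¹) ∂M.lawX) =
          c⁻¹ • fun j => ∫ x, M.ψ J j x * f x ∂M.lawX := by
        ext j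
        simp only [← mul_assoc, integral_mul_const, Pi.smul_apply, smul_eq_mul, mul_comm]
      ext x
      simp only [projX, l2Proj, e, Matrix.mulVec_smul, linComb, Finset.sum_mul, Pi.smul_apply,
        smul_eq_mul]
      exact Finset.sum_congr rfl fun j _ => by ring
    have hPb : BoundedOn M.XX (M.projX J f) := BoundedOn.linComb (h.basisX.bounded J) _
    refine supNorm_le (mul_nonneg (Real.iSup_nonneg fun _ => supNorm_nonneg _ _) h0.le)
      fun x hx => ?_
    have h3 : BoundedOn M.XX fun x => M.projX J f x * c⁻¹ := hPb.mul_const _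
    have h4 := (h3.abs_le_supNorm hx).trans ((congrArg (supNorm M.XX) h2).ge.trans h1)
    rwa [abs_mul, abs_of_pos (inv_pos.2 h0), ← div_eq_mul_inv, div_le_iff₀ h0] at h4

/-- Lebesgue's lemma. -/
theorem supNorm_sub_projX_le {f g : EuclideanSpace ℝ (Fin d) → ℝ} (hf : Measurable f)
    (hfb : BoundedOn M.XX f) (hg : g ∈ M.Psi J) :
    supNorm M.XX (f - M.projX J f) ≤
      (1 + lebesgueConst M.lawX M.XX (M.ψ J)) * supNorm M.XX (f - g) := by
  have := hM.isProbabilityMeasure_lawX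
  obtain ⟨c, rfl⟩ := mem_sieveSpace_iff.1 hg
  have hψ : ∀ j, MemLp (M.ψ J j) 2 M.lawX := fun j => hM.memLp_basisX hd h.basisX j 2
  have hgb : BoundedOn M.XX (linComb (M.ψ J) c) := BoundedOn.linComb (h.basisX.bounded J) c
  have hgm := measurable_linComb (h.basisX.measurable J) c
  have hL : MemLp f 2 M.lawX := hfb.memLp hf hd.mem_XX 2
  have hgL : MemLp (linComb (M.ψ J) c) 2 M.lawX := hgb.memLp hgm hd.mem_XX 2
  -- The projection fixes the sieve function g, so f may be replaced by f − g.
  have e : f - M.projX J f =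
      (f - linComb (M.ψ J) c) - M.projX J (f - linComb (M.ψ J) c) := by
    rw [projX, projX, l2Proj_sub (fun j => (hψ j).integrable_mul hL)
      (fun j => (hψ j).integrable_mul hgL), l2Proj_self (h.basisX.posDef J)
      (fun j k => (hψ j).integrable_mul (hψ k))]
    abel
  have hdb := hfb.sub hgb
  have hPb : BoundedOn M.XX (M.projX J (f - linComb (M.ψ J) c)) :=
    BoundedOn.linComb (h.basisX.bounded J) _
  have h1 := supNorm_projX_le_lebesgueConst hM hd h (hf.sub hgm) hdb
  have h2 : 0 ≤ lebesgueConst M.lawX M.XX (M.ψ J) :=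
    Real.iSup_nonneg fun _ => supNorm_nonneg _ _
  have h3 := supNorm_nonneg M.XX (f - linComb (M.ψ J) c)
  rw [e]
  refine supNorm_le (by positivity) fun x hx => ?_
  refine (abs_sub _ _).trans ?_
  have h4 := hdb.abs_le_supNorm hx
  have h5 := (hPb.abs_le_supNorm hx).trans h1
  linarith

end Lebesgue

variable {Ω : Type*} [MeasurableSpace Ω] {d dw : ℕ} {M : NPIV Ω d dw} {J K : ℕ → ℕ}

theorem sqrt_log_div_eq (n : ℕ) (e : ℝ) :
    Real.sqrt (Real.log n / (n * e)) = Real.sqrt (Real.log n / n) / Real.sqrt e := by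
  rw [← div_div, Real.sqrt_div (div_nonneg (Real.log_natCast_nonneg n) (Nat.cast_nonneg n))]

theorem isBigOInProb_hHat {δ : ℝ}
    {ginv : ∀ m : ℕ, Matrix (Fin m) (Fin m) ℝ → Matrix (Fin m) (Fin m) ℝ} (hg : IsGenInverse ginv)
    (hM : M.IsModel) (hS : M.SieveSetup J K) (hd : M.RegressorDensity) (hh : BoundedOn M.XX M.h₀)
    (hu : M.ResidualMoments δ) (hG : M.SieveGrowth δ J K) (hA : M.SieveApprox J K) :
    IsBigOInProb M.μ (fun n ω => supNorm M.XX (M.hHat ginv n (J n) (K n) ω - M.h₀))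
      (fun n => supNorm M.XX (M.h₀ - M.projX (J n) M.h₀)
        + M.tau (J n) * M.xi (J n) * Real.sqrt (Real.log n / (n * M.e (J n)))) := by
  have := hM.isProbabilityMeasure_lawX
  have := hM.isProbabilityMeasure_lawObs
  have hm := hM.measurable_h₀
  have hL : MemLp M.h₀ 2 M.lawX := hh.memLp hm hd.mem_XX 2
  obtain ⟨Rb, Rp, hreg⟩ := exists_isRegular hM hd hS hA
  obtain ⟨σ, hσ, hs⟩ := hM.exists_condVarLE hu
  obtain ⟨D, hD1, hD⟩ := hG.exists_bound
  obtain ⟨C₁, hC₁, hA2⟩ := hA.stableL2.exists_pos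
  obtain ⟨C₂, hC₂, hA3⟩ := hA.stableSup.exists_pos
  obtain ⟨C₃, hC₃, hKJ⟩ := hS.bigO.exists_pos
  set rate : ℕ → ℝ := fun n => supNorm M.XX (M.h₀ - M.projX (J n) M.h₀)
    + M.tau (J n) * M.xi (J n) * Real.sqrt (Real.log n / (n * M.e (J n))) with hrate
  have hstoch : ∀ n, 0 ≤ M.tau (J n) * M.xi (J n) * Real.sqrt (Real.log n / (n * M.e (J n))) :=
    fun n => mul_nonneg (mul_nonneg (tau_nonneg _) (xi_nonneg _)) (Real.sqrt_nonneg _)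
  have hbias : ∀ n, supNorm M.XX (M.h₀ - M.projX (J n) M.h₀) ≤ rate n := fun n =>
    le_add_of_nonneg_right (hstoch n)
  have hproj : ∀ n, BoundedOn M.XX (M.projX (J n) M.h₀) ∧ Measurable (M.projX (J n) M.h₀) :=
    fun n => ⟨BoundedOn.linComb (hS.basisX.bounded (J n)) _,
      measurable_linComb (hS.basisX.measurable (J n)) _⟩
  have hlog : ∀ᶠ n : ℕ in atTop, 1 ≤ Real.log n :=
    (Real.tendsto_log_atTop.comp tendsto_natCast_atTop_atTop).eventually_ge_atTop 1
  have p1 : IsBigOInProb M.μ (fun n _ => supNorm M.XX (M.h₀ - M.projX (J n) M.h₀) +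
      supNorm M.XX (M.Q (J n) (K n) M.h₀ - M.projX (J n) M.h₀)) rate := by
    refine IsBigOInProb.of_deterministic (c := 1 + C₂) (by positivity) (hA3.bound.mono fun n hn => ?_)
    rw [Real.norm_of_nonneg (supNorm_nonneg _ _), Real.norm_of_nonneg (supNorm_nonneg _ _)] at hn
    rw [abs_of_nonneg (add_nonneg (supNorm_nonneg _ _) (supNorm_nonneg _ _))]
    have := mul_le_mul_of_nonneg_left (hbias n) hC₂.le
    linarith [hbias n]
  have p2 : IsBigOInProb M.μ (fun n ω => M.xi (J n) * ‖(Rp n)ᵀ *ᵥ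
      (leftInv (M.crossW (Rb n) (Rp n)) *ᵥ M.noise (Rb n) n ω)‖) rate := by
    refine ((isBigOInProb_norm_noise hM hS hG hreg hu).const_mul
      (Eventually.of_forall fun n => xi_nonneg (J n))).of_rate_le (c := 2) two_pos
      (Eventually.of_forall fun n => ?_)
    have h1 := supNorm_nonneg M.XX (M.h₀ - M.projX (J n) M.h₀)
    simp only [hrate]
    rw [sqrt_log_div_eq]
    calc _ = 2 * (M.tau (J n) * M.xi (J n) *
          (Real.sqrt (Real.log n / n) / Real.sqrt (M.e (J n)))) := by ring
      _ ≤ _ := by linarith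
  have p3 : IsBigOInProb M.μ
      (fun n => M.remainder (Rb n) (Rp n) n (M.h₀ - M.projX (J n) M.h₀)) rate := by
    have h1 : IsBigOInProb M.μ
        (fun n => M.remainder (Rb n) (Rp n) n (M.h₀ - M.projX (J n) M.h₀))
        (fun n => M.normX (M.h₀ - M.projX (J n) M.h₀) +
          M.tau (J n) * Real.sqrt (K n) / Real.sqrt n) := by
      refine IsBigOInProb.of_sqDominated (c := 190 * (2496 * σ * D * max C₁ 1))
        (fun n => add_nonneg (l2Norm_nonneg _ _) (div_nonneg (mul_nonneg (tau_nonneg _)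
          (Real.sqrt_nonneg _)) (Real.sqrt_nonneg _))) ?_
      filter_upwards [hreg, hD, eventually_zeta_sq_le hG hreg, hA2.bound, eventually_ne_atTop 0]
        with n e1 e2 e3 e4 e5
      refine sqDominated_remainder hM e1 hu hσ hs (hm.sub (hproj n).2)
        (hL.sub ((hproj n).1.memLp (hproj n).2 hd.mem_XX 2)) e5 e3 e2 (le_max_right _ _) ?_
      have h2 : 0 ≤ M.normX (M.h₀ - M.projX (J n) M.h₀) := l2Norm_nonneg _ _
      rw [Real.norm_of_nonneg h2] at e4
      exact (le_abs_self _).trans (e4.trans (mul_le_mul_of_nonneg_right (le_max_left _ _) h2))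
    -- τ√(K/n) is absorbed in the stochastic rate: √K ≤ √(C₃J), √J ≤ ξ/√e and 1 ≤ log n.
    refine h1.of_rate_le (c := 1 + Real.sqrt C₃) (by positivity) ?_
    filter_upwards [hreg, hKJ.bound, hlog, eventually_ne_atTop 0, hS.eventually_ne_zero]
      with n e1 e2 e3 e4 e5
    have hn0 : (0 : ℝ) < n := by positivity
    have h2 := normX_le_supNorm hM hd (hh.sub (hproj n).1)
    rw [Real.norm_natCast, Real.norm_natCast] at e2
    have h3 : Real.sqrt (K n) ≤ Real.sqrt C₃ * Real.sqrt (J n) := by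
      rw [← Real.sqrt_mul hC₃.le]; exact Real.sqrt_le_sqrt e2
    have h4 := hM.card_le_xi hd hS.basisX e5 e1.whitenX.eq_one
    have h5 : (Real.sqrt n)⁻¹ ≤ Real.sqrt (Real.log n / n) := by
      rw [← Real.sqrt_inv]
      exact Real.sqrt_le_sqrt (by rw [← one_div]; gcongr)
    have h6 : M.tau (J n) * Real.sqrt (K n) / Real.sqrt n ≤ Real.sqrt C₃ *
        (M.tau (J n) * M.xi (J n) * Real.sqrt (Real.log n / (n * M.e (J n)))) := by
      rw [sqrt_log_div_eq]
      have hτ := tau_nonneg (M := M) (J n)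
      calc M.tau (J n) * Real.sqrt (K n) / Real.sqrt n
          = M.tau (J n) * Real.sqrt (K n) * (Real.sqrt n)⁻¹ := div_eq_mul_inv _ _
        _ ≤ M.tau (J n) * (Real.sqrt C₃ * (M.xi (J n) / Real.sqrt (M.e (J n)))) *
            Real.sqrt (Real.log n / n) := by
            have hq := div_nonneg (xi_nonneg (M := M) (J n)) (Real.sqrt_nonneg (M.e (J n)))
            exact mul_le_mul (mul_le_mul_of_nonneg_left
              (h3.trans (mul_le_mul_of_nonneg_left h4 (Real.sqrt_nonneg _))) hτ) h5
              (by positivity) (by positivity)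
        _ = _ := by ring
    have h7 := mul_nonneg (Real.sqrt_nonneg C₃)
      (supNorm_nonneg M.XX (M.h₀ - M.projX (J n) M.h₀))
    have h8 := hstoch n
    simp only [hrate]
    nlinarith
  have hI : ∀ᶠ n in atTop, IsBddOrtho M.lawObs (M.instr (Rb n)) (M.zeta (J n) (K n)) :=
    hreg.mono fun n h => h.orthoW.comp hM.measurePreserving_snd
  have hR : ∀ᶠ n in atTop, IsBddOrtho M.lawObs (M.regr (Rp n)) (M.zeta (J n) (K n)) :=
    hreg.mono fun n h => h.orthoX.comp hM.measurePreserving_fst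
  -- The exceptional events for Ŝ − S and Ĝ − 1. Outside them the deterministic bound holds, so the
  -- estimator itself never has to be measurable.
  have hB1 := tendsto_measure_opBound hM hS hG hreg hI hR fun n => ⟨le_rfl, hS.le n⟩
  have hB2 := tendsto_measure_opBound hM hS hG hreg hI hI fun n => ⟨hS.le n, le_rfl⟩
  have hB := hB1.add hB2
  rw [add_zero] at hB
  refine ((p1.add p2).add p3).of_le (tendsto_of_tendsto_of_tendsto_of_le_of_le
    tendsto_const_nhds hB (fun _ => zero_le)
    fun n => measure_union_le _ _) ?_
  filter_upwards [hreg, hI, hR, eventually_ne_atTop 0] with n e1 e2 e3 e4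
  filter_upwards [hM.isSample.eucl_crossSample_sub_sq_le e2 e3 e4,
    hM.isSample.eucl_crossSample_sub_sq_le e2 e2 e4] with ω g1 g2 hω
  simp only [Set.mem_union, Set.mem_ofPred_eq, not_or, not_lt] at hω
  have hτ := e1.one_le_tau
  -- Translates the events into squared operator norms at most (1/(4τ))². For Ĝ − 1 only 1/2 is
  -- needed, which is weaker as τ ≥ 1.
  have hop : ∀ x : ℝ, 16 * |M.tau (J n) ^ 2 * x| ≤ 1 → x ≤ (1 / (2 * M.tau (J n)) / 2) ^ 2 := by
    intro x hx
    have h1 := (mul_le_mul_of_nonneg_left (le_abs_self (M.tau (J n) ^ 2 * x))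
      (by norm_num : (0 : ℝ) ≤ 16)).trans hx
    have h2 : (1 / (2 * M.tau (J n)) / 2) ^ 2 = 1 / (16 * M.tau (J n) ^ 2) := by
      field_simp; norm_num
    rw [h2, le_div_iff₀ (by positivity)]
    linarith
  have hhalf : 1 / (2 * M.tau (J n)) / 2 ≤ 1 / 2 := by
    refine div_le_div_of_nonneg_right ?_ zero_le_two
    rw [div_le_one (by positivity)]; linarith
  have hpos : 0 ≤ 1 / (2 * M.tau (J n)) / 2 := by positivity
  have key := supNorm_hHat_sub_le hM hd e1 hg hm hh (n := n) (ω := ω)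
    (fun c => le_of_sq_le_sq ((g1 c).trans (by
      rw [mul_pow]; exact mul_le_mul_of_nonneg_right (hop _ hω.1) (sq_nonneg _)))
      (mul_nonneg hpos (eucl_nonneg _)))
    (fun v => le_of_sq_le_sq ((g2 v).trans (by
      rw [mul_pow]
      exact mul_le_mul_of_nonneg_right ((hop _ hω.2).trans (pow_le_pow_left₀ hpos hhalf 2))
        (sq_nonneg _))) (mul_nonneg (by norm_num) (eucl_nonneg _)))
  rw [abs_of_nonneg (supNorm_nonneg _ _)]
  exact key.trans (le_abs_self _)

end NPIV

theorem theorem2p1 {Ω : Type*} [MeasurableSpace Ω] {d dw : ℕ} (M : NPIV Ω d dw)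
    (H : Set (EuclideanSpace ℝ (Fin d) → ℝ)) (δ : ℝ) (J K : ℕ → ℕ)
    (ginv : ∀ m : ℕ, Matrix (Fin m) (Fin m) ℝ → Matrix (Fin m) (Fin m) ℝ)
    (hginv : IsGenInverse ginv)
    (hmodel : M.IsModel) (hsetup : M.SieveSetup J K)
    (hdensity : M.RegressorDensity) (hinj : M.TInjective) (hdense : M.SieveDense H)
    (hres : M.ResidualMoments δ) (hgrowth : M.SieveGrowth δ J K)
    (happrox : M.SieveApprox J K) :
    IsBigOInProb M.μ (fun n ω => supNorm M.XX (M.hHat ginv n (J n) (K n) ω - M.h₀))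
      (fun n => supNorm M.XX (M.h₀ - M.projX (J n) M.h₀)
        + M.tau (J n) * M.xi (J n) * Real.sqrt (Real.log n / (n * M.e (J n)))) ∧
    ((fun n => lebesgueConst M.lawX M.XX (M.ψ (J n))) =O[atTop] (fun _ => (1 : ℝ)) →
      (fun n => M.xi (J n) / Real.sqrt (M.e (J n))) =O[atTop]
        (fun n => Real.sqrt (J n)) →
      ∀ h₀J : ℕ → EuclideanSpace ℝ (Fin d) → ℝ,
        (∀ n, h₀J n ∈ M.Psi (J n) ∧
          ∀ h ∈ M.Psi (J n), supNorm M.XX (M.h₀ - h₀J n) ≤ supNorm M.XX (M.h₀ - h)) →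
        IsBigOInProb M.μ (fun n ω => supNorm M.XX (M.hHat ginv n (J n) (K n) ω - M.h₀))
          (fun n => supNorm M.XX (M.h₀ - h₀J n)
            + M.tau (J n) * Real.sqrt (J n * Real.log n / n))) := by
  have hb := (hdense.bounded _ hdense.mem).2
  have hm := hmodel.measurable_h₀
  have part1 := NPIV.isBigOInProb_hHat hginv hmodel hsetup hdensity hb hres hgrowth happrox
  refine ⟨part1, fun hΛ hξ h₀J hJ => ?_⟩
  obtain ⟨Rb, Rp, hreg⟩ := NPIV.exists_isRegular hmodel hdensity hsetup happrox
  obtain ⟨L, hL, hΛ⟩ := hΛ.exists_pos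
  obtain ⟨C, hC, hξ⟩ := hξ.exists_pos
  -- 1 + L is the factor in Lebesgue's lemma, and C bounds ξ/√e by √J in the stochastic term.
  refine part1.of_rate_le (c := 1 + L + C) (by positivity) ?_
  filter_upwards [hreg, hΛ.bound, hξ.bound] with n e1 e2 e3
  rw [norm_one, mul_one] at e2
  rw [Real.norm_of_nonneg (Real.sqrt_nonneg _)] at e3
  have h1 := NPIV.supNorm_sub_projX_le hmodel hdensity e1 hm hb (hJ n).1
  have h2 := supNorm_nonneg M.XX (M.h₀ - h₀J n)
  have h3 : supNorm M.XX (M.h₀ - M.projX (J n) M.h₀) ≤ (1 + L) * supNorm M.XX (M.h₀ - h₀J n) :=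
    h1.trans (mul_le_mul_of_nonneg_right (by linarith [(le_abs_self _).trans e2]) h2)
  have hτ := NPIV.tau_nonneg (M := M) (J n)
  have h4 : M.tau (J n) * M.xi (J n) * Real.sqrt (Real.log n / (n * M.e (J n))) ≤
      C * (M.tau (J n) * Real.sqrt (J n * Real.log n / n)) := by
    rw [NPIV.sqrt_log_div_eq, mul_div_assoc, Real.sqrt_mul (Nat.cast_nonneg _)]
    calc _ = M.tau (J n) * (M.xi (J n) / Real.sqrt (M.e (J n))) *
          Real.sqrt (Real.log n / n) := by ring
      _ ≤ M.tau (J n) * (C * Real.sqrt (J n)) * Real.sqrt (Real.log n / n) := by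
          have := (le_abs_self _).trans e3
          gcongr
      _ = _ := by ring
  have h5 : 0 ≤ M.tau (J n) * Real.sqrt (J n * Real.log n / n) := by positivity
  nlinarith [mul_nonneg hC.le h2, mul_nonneg hL.le h5]
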